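/- Let $\mathcal E=\{x\in\mathbb R: |x|>1\}$, let $L^2(\mathcal E)$ be the complex Lebesgue space, and let $g>0$. The space $W^{1,2}(\mathcal E)$ consists of the $v\in L^2(\mathcal E)$ with weak derivative $v'\in L^2(\mathcal E)$, normed by $\|v\|_{W^{1,2}(\mathcal E)}^2=\|v\|_{L^2(\mathcal E)}^2+\|v'\|_{L^2(\mathcal E)}^2$, and $W^{\frac12,2}(\mathcal E)$ consists of the $v\in L^2(\mathcal E)$ for which $$\|v\|_{W^{\frac12,2}(\mathcal E)}^2=\|v\|_{L^2(\mathcal E)}^2+\iint_{\mathcal E\times\mathcal E}\frac{|v(x)-v(y)|^2}{|x-y|^2}\,dx\,dy<\infty .$$ Let $\Lambda_{\mathbb H}:W^{1,2}(\mathbb R)\to L^2(\mathbb R)$, $\widehat{\Lambda_{\mathbb H}\eta}(\xi)=|\xi|\,\hat\eta(\xi)$ with $\hat\eta(\xi)=\int_{\mathbb R} e^{-ix\xi}\eta(x)\,dx$, be the Dirichlet-to-Neumann map of the upper half-plane. For $v\in W^{1,2}(\mathcal E)$ vanishing outside a bounded set, let $\eta(v)(x)=v(x)$ for $|x|>1$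 and $\eta(v)(x)=v(1/x)$ for $0<|x|<1$, and set $\Lambda_\Omega v=(\Lambda_{\mathbb H}\,\eta(v))|_{\mathcal E}$. Let $\Lambda_\Omega: W^{1,2}(\mathcal E)\to L^2(\mathcal E)$ also denote the extension of this map by continuity. It is the Dirichlet-to-Neumann map of $\Omega=\{(x,y): x^2+y^2>1,\ y>0\}$ with homogeneous Neumann condition on the half circle, and is regarded as an unbounded operator on $L^2(\mathcal E)$ with domain $W^{1,2}(\mathcal E)$. Then $\Lambda_\Omega$ is well defined, the operator $\mathbb I+g\Lambda_\Omega$ has exactly one nonnegative self-adjoint square root $(\mathbb I+g\Lambda_\Omega)^{\frac12}$ on $L^2(\mathcal E)$, and the form domain $\mathcal D((\mathbb I+g\Lambda_\Omega)^{\frac12})$, that is, the completion of $W^{1,2}(\mathcal E)$ in $L^2(\mathcal E)$ with respect to the norm $\|(\mathbb I+g\Lambda_\Omega)^{\frac12}v\|_{L^2(\mathcal E)}$, which is also the domain of the operator $(\mathbb I+g\Lambda_\Omega)^{\frac12}$, satisfies $$\mathcal D\big((\mathbb I+g\Lambda_\Omega)^{\frac12}\big)=W^{\frac12,2}(\mathcal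 E)=\big(L^2(\mathcal E),W^{1,2}(\mathcal E)\big)_{\frac12,2}$$ with equivalent norms. Here the last space is the real interpolation space, with norm $\big(\int_0^\infty (t^{-\frac12}K(t,v))^2\,\frac{dt}{t}\big)^{\frac12}$, where $K(t,v)=\inf\{\|v-b\|_{L^2(\mathcal E)}+t\|b\|_{W^{1,2}(\mathcal E)}: b\in W^{1,2}(\mathcal E)\}$. -/

import Mathlib

open MeasureTheory Filter Topology
open scoped ENNReal NNReal FourierTransform ContDiff

noncomputable section

namespace HalfSobolev

/-- The free surface `{x ∈ ℝ : |x| > 1}`. -/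
def freeSurface : Set ℝ := {x | 1 < |x|}

/-- Lebesgue measure on the free surface. -/
abbrev surfaceMeasure : Measure ℝ := (volume : Measure ℝ).restrict freeSurface

/-- The complex Hilbert space `L²` of the free surface. -/
abbrev L2E : Type := Lp (α := ℝ) ℂ 2 surfaceMeasure

/-- The complex Hilbert space `L²(ℝ)`. -/
abbrev L2R : Type := Lp (α := ℝ) ℂ 2 (volume : Measure ℝ)

/-! ### Sobolev spaces on the free surface -/

/-- `d ∈ L²` is the weak derivative of `v ∈ L²` on the free surface. -/
def IsWeakDeriv (v d : L2E) : Prop :=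
  ∀ φ : ℝ → ℝ, ContDiff ℝ ∞ φ → HasCompactSupport φ → tsupport φ ⊆ freeSurface →
    ∫ x, deriv φ x • v x ∂surfaceMeasure = -∫ x, φ x • d x ∂surfaceMeasure

/-- `W^{1,2}`: the elements of `L²` with a weak derivative in `L²`. -/
def sobolevOne : Set L2E := {v | ∃ d : L2E, IsWeakDeriv v d}

/-- The norm of `W^{1/2,2}`, extended by the value `∞` to all of `L²`:
`‖v‖² = ‖v‖²_{L²} + ∬ |v(x) - v(y)|² / |x - y|² dx dy`. -/
def halfNorm (v : L2E) : ℝ≥0∞ :=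
  (‖v‖ₑ ^ 2 +
    ∫⁻ x, ∫⁻ y, ‖v x - v y‖ₑ ^ 2 / ‖x - y‖ₑ ^ 2 ∂surfaceMeasure ∂surfaceMeasure) ^ (1 / 2 : ℝ)

/-- `W^{1/2,2}`: the elements of `L²` of finite `W^{1/2,2}` norm. -/
def sobolevHalf : Set L2E := {v | halfNorm v < ⊤}

/-! ### Real interpolation between `L²` and `W^{1,2}` -/

/-- The `K`-functional of the couple `(L², W^{1,2})`:
the infimum of `‖v - b‖_{L²} + t ‖b‖_{W^{1,2}}` over `b ∈ W^{1,2}`. -/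
def kFunctional (t : ℝ) (v : L2E) : ℝ≥0∞ :=
  ⨅ (b : L2E) (d : L2E) (_ : IsWeakDeriv b d),
    ‖v - b‖ₑ + ENNReal.ofReal t * (‖b‖ₑ ^ 2 + ‖d‖ₑ ^ 2) ^ (1 / 2 : ℝ)

/-- The norm of the real interpolation space `(L², W^{1,2})_{1/2,2}`, extended by the value `∞`
to all of `L²`: the square root of `∫_0^∞ (t^{-1/2} K(t, v))² dt / t`. -/
def interpNorm (v : L2E) : ℝ≥0∞ :=
  (∫⁻ t in Set.Ioi (0 : ℝ),
    (ENNReal.ofReal (t ^ (-(1 / 2) : ℝ)) * kFunctional t v) ^ 2 / ENNReal.ofReal t) ^ (1 / 2 : ℝ)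

/-- The real interpolation space `(L², W^{1,2})_{1/2,2}`. -/
def interpSpace : Set L2E := {v | interpNorm v < ⊤}

/-! ### The Dirichlet-to-Neumann map -/

/-- `η` is the extension of `v` to the real line with `η(x) = v(1/x)` for `0 < |x| < 1`. -/
def IsReflection (v : L2E) (η : L2R) : Prop :=
  (∀ᵐ x : ℝ, 1 < |x| → η x = v x) ∧ (∀ᵐ x : ℝ, |x| < 1 → η x = v x⁻¹)

/-- `w` is the image of `η` under the Dirichlet-to-Neumann map of the upper half-plane, the
Fourier multiplier by the modulus of the frequency. The Fourier transform here has the kernel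
`exp (-2 π i x ξ)`, so that the frequency is `2 π ξ`. For `η ∈ L²(ℝ)`, such a `w ∈ L²(ℝ)` exists
exactly when `η ∈ W^{1,2}(ℝ)`. -/
def IsHalfPlaneDtN (η w : L2R) : Prop :=
  ∀ᵐ ξ : ℝ, (𝓕 w : L2R) ξ = ((2 * Real.pi * |ξ| : ℝ) : ℂ) * (𝓕 η : L2R) ξ

lemma integrable_bdd_smul {ψ : ℝ → ℝ} (hψ : Continuous ψ) (hc : HasCompactSupport ψ) (v : L2E) :
    Integrable (fun x => ψ x • v x) surfaceMeasure :=
  memLp_one_iff_integrable.1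
    ((Lp.memLp v).smul (hψ.memLp_of_hasCompactSupport (p := 2) (μ := surfaceMeasure) hc))

lemma IsWeakDeriv.add {v d v' d' : L2E} (h : IsWeakDeriv v d) (h' : IsWeakDeriv v' d') :
    IsWeakDeriv (v + v') (d + d') := by
  intro φ hφ hc hs
  have hd : Continuous (deriv φ) := hφ.continuous_deriv (by simp)
  have e1 : (fun x => deriv φ x • (v + v') x) =ᵐ[surfaceMeasure]
      fun x => deriv φ x • v x + deriv φ x • v' x := by
    filter_upwards [Lp.coeFn_add v v'] with x hx
    rw [hx, Pi.add_apply, smul_add]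
  have e2 : (fun x => φ x • (d + d') x) =ᵐ[surfaceMeasure]
      fun x => φ x • d x + φ x • d' x := by
    filter_upwards [Lp.coeFn_add d d'] with x hx
    rw [hx, Pi.add_apply, smul_add]
  rw [integral_congr_ae e1, integral_congr_ae e2,
    integral_add (integrable_bdd_smul hd hc.deriv v) (integrable_bdd_smul hd hc.deriv v'),
    integral_add (integrable_bdd_smul hφ.continuous hc d)
      (integrable_bdd_smul hφ.continuous hc d'), h φ hφ hc hs, h' φ hφ hc hs]
  ring

lemma IsWeakDeriv.smul {v d : L2E} (c : ℂ) (h : IsWeakDeriv v d) :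
    IsWeakDeriv (c • v) (c • d) := by
  intro φ hφ hc hs
  have e1 : (fun x => deriv φ x • (c • v) x) =ᵐ[surfaceMeasure]
      fun x => c • (deriv φ x • v x) := by
    filter_upwards [Lp.coeFn_smul c v] with x hx
    rw [hx, Pi.smul_apply, smul_comm]
  have e2 : (fun x => φ x • (c • d) x) =ᵐ[surfaceMeasure] fun x => c • (φ x • d x) := by
    filter_upwards [Lp.coeFn_smul c d] with x hx
    rw [hx, Pi.smul_apply, smul_comm]
  rw [integral_congr_ae e1, integral_congr_ae e2, integral_smul, integral_smul, h φ hφ hc hs,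
    smul_neg]

lemma measurableSet_freeSurface : MeasurableSet freeSurface :=
  measurableSet_lt measurable_const continuous_abs.measurable

lemma ae_inv_of_ae {p : ℝ → Prop} (h : ∀ᵐ x ∂surfaceMeasure, p x) :
    ∀ᵐ x : ℝ, |x| < 1 → p x⁻¹ := by
  rw [ae_restrict_iff' measurableSet_freeSurface, ae_iff] at h
  set N : Set ℝ := {x | ¬(x ∈ freeSurface → p x)} with hN
  have hd : DifferentiableOn ℝ (fun x : ℝ => x⁻¹) N := by
    intro x hx
    have hx1 : 1 < |x| := (Classical.not_imp.1 hx).1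
    have hx0 : x ≠ 0 := by
      rintro rfl
      norm_num at hx1
    exact (differentiableAt_inv hx0).differentiableWithinAt
  have h0 := addHaar_image_eq_zero_of_differentiableOn_of_addHaar_eq_zero volume hd h
  rw [ae_iff]
  refine measure_mono_null (t := {0} ∪ (fun x : ℝ => x⁻¹) '' N) ?_
    (measure_union_null (by simp) h0)
  intro x hx
  obtain ⟨hx1, hx2⟩ := Classical.not_imp.1 hx
  by_cases hx0 : x = 0
  · exact Or.inl hx0
  · refine Or.inr ⟨x⁻¹, Classical.not_imp.2 ⟨?_, hx2⟩, inv_inv x⟩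
    change 1 < |x⁻¹|
    rw [abs_inv]
    exact (one_lt_inv₀ (abs_pos.2 hx0)).2 hx1

lemma ae_of_ae_surface {p : ℝ → Prop} (h : ∀ᵐ x ∂surfaceMeasure, p x) :
    ∀ᵐ x : ℝ, 1 < |x| → p x :=
  (ae_restrict_iff' measurableSet_freeSurface).1 h

lemma IsReflection.add {v v' : L2E} {η η' : L2R} (h : IsReflection v η)
    (h' : IsReflection v' η') : IsReflection (v + v') (η + η') := by
  have e := Lp.coeFn_add v v'
  constructor
  · filter_upwards [h.1, h'.1, Lp.coeFn_add η η', ae_of_ae_surface e] with x h1 h2 h3 h4 hx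
    rw [h3, h4 hx, Pi.add_apply, Pi.add_apply, h1 hx, h2 hx]
  · filter_upwards [h.2, h'.2, Lp.coeFn_add η η', ae_inv_of_ae e] with x h1 h2 h3 h4 hx
    rw [h3, h4 hx, Pi.add_apply, Pi.add_apply, h1 hx, h2 hx]

lemma IsReflection.smul {v : L2E} {η : L2R} (c : ℂ) (h : IsReflection v η) :
    IsReflection (c • v) (c • η) := by
  have e := Lp.coeFn_smul c v
  constructor
  · filter_upwards [h.1, Lp.coeFn_smul c η, ae_of_ae_surface e] with x h1 h3 h4 hx
    rw [h3, h4 hx, Pi.smul_apply, Pi.smul_apply, h1 hx]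
  · filter_upwards [h.2, Lp.coeFn_smul c η, ae_inv_of_ae e] with x h1 h3 h4 hx
    rw [h3, h4 hx, Pi.smul_apply, Pi.smul_apply, h1 hx]

lemma IsHalfPlaneDtN.add {η w η' w' : L2R} (h : IsHalfPlaneDtN η w)
    (h' : IsHalfPlaneDtN η' w') : IsHalfPlaneDtN (η + η') (w + w') := by
  unfold IsHalfPlaneDtN
  rw [FourierTransform.fourier_add, FourierTransform.fourier_add]
  filter_upwards [h, h', Lp.coeFn_add (𝓕 η : L2R) (𝓕 η'), Lp.coeFn_add (𝓕 w : L2R) (𝓕 w')]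
    with ξ h1 h2 h3 h4
  rw [h3, h4, Pi.add_apply, Pi.add_apply, h1, h2, mul_add]

lemma IsHalfPlaneDtN.smul {η w : L2R} (c : ℂ) (h : IsHalfPlaneDtN η w) :
    IsHalfPlaneDtN (c • η) (c • w) := by
  unfold IsHalfPlaneDtN
  rw [FourierTransform.fourier_smul, FourierTransform.fourier_smul]
  filter_upwards [h, Lp.coeFn_smul c (𝓕 η : L2R), Lp.coeFn_smul c (𝓕 w : L2R)]
    with ξ h1 h3 h4
  rw [h3, h4, Pi.smul_apply, Pi.smul_apply, h1, smul_eq_mul, smul_eq_mul]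
  ring

/-- The Dirichlet-to-Neumann map on the elements of `W^{1,2}` with bounded support. The triple
`(v, d, w)` belongs to this subspace if `v` has the weak derivative `d`, vanishes near infinity,
and `w` is the restriction to the free surface of the image of the reflection of `v` under the
Dirichlet-to-Neumann map of the half-plane. -/
def dtnCore : Submodule ℂ (L2E × L2E × L2E) where
  carrier := {p | IsWeakDeriv p.1 p.2.1 ∧
    (∃ a : ℝ, ∀ᵐ x ∂surfaceMeasure, a < |x| → p.1 x = 0) ∧
    ∃ η w : L2R, IsReflection p.1 η ∧ IsHalfPlaneDtN η w ∧ p.2.2 =ᵐ[surfaceMeasure] w}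
  zero_mem' := by
    have hE := ae_of_ae_surface (Lp.coeFn_zero ℂ 2 surfaceMeasure)
    have hI := ae_inv_of_ae (Lp.coeFn_zero ℂ 2 surfaceMeasure)
    have hR := Lp.coeFn_zero ℂ 2 (volume : Measure ℝ)
    refine ⟨?_, ⟨0, ?_⟩, 0, 0, ⟨?_, ?_⟩, ?_, ?_⟩
    · simpa using (show IsWeakDeriv ((0 : ℂ) • (0 : L2E)) ((0 : ℂ) • (0 : L2E)) from by
        intro φ _ _ _
        have e : ∀ ψ : ℝ → ℝ, (fun x => ψ x • ((0 : ℂ) • (0 : L2E) : L2E) x)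
            =ᵐ[surfaceMeasure] fun _ => (0 : ℂ) := by
          intro ψ
          rw [zero_smul]
          filter_upwards [Lp.coeFn_zero ℂ 2 surfaceMeasure] with x hx
          rw [hx, Pi.zero_apply, smul_zero]
        rw [integral_congr_ae (e _), integral_congr_ae (e _)]
        simp)
    · filter_upwards [Lp.coeFn_zero ℂ 2 surfaceMeasure] with x hx _
      exact hx
    · filter_upwards [hE, hR] with x h1 h2 hx
      rw [h2]
      exact (h1 hx).symm
    · filter_upwards [hI, hR] with x h1 h2 hx
      rw [h2]
      exact (h1 hx).symm
    · have h0 : (𝓕 (0 : L2R) : L2R) = 0 := (Lp.fourierTransformₗᵢ ℝ ℂ).map_zero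
      unfold IsHalfPlaneDtN
      rw [h0]
      filter_upwards [hR] with ξ h1
      rw [h1, Pi.zero_apply, mul_zero]
    · filter_upwards [Lp.coeFn_zero ℂ 2 surfaceMeasure, ae_restrict_of_ae hR] with x h1 h2
      rw [h2]
      exact h1
  add_mem' := by
    rintro ⟨v, d, w⟩ ⟨v', d', w'⟩ ⟨h1, ⟨a, h2⟩, η, W, h3, h4, h5⟩ ⟨h1', ⟨a', h2'⟩, η', W', h3', h4', h5'⟩
    refine ⟨h1.add h1', ⟨max a a', ?_⟩, η + η', W + W', h3.add h3', h4.add h4', ?_⟩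
    · filter_upwards [h2, h2', Lp.coeFn_add v v'] with x e1 e2 e3 hx
      have f1 := e1 ((le_max_left _ _).trans_lt hx)
      have f2 := e2 ((le_max_right _ _).trans_lt hx)
      change (v + v') x = 0
      rw [e3, Pi.add_apply, f1, f2, add_zero]
    · filter_upwards [h5, h5', Lp.coeFn_add w w', ae_restrict_of_ae (Lp.coeFn_add W W')]
        with x e1 e2 e3 e4
      change (w + w') x = _
      rw [e3, e4, Pi.add_apply, Pi.add_apply, e1, e2]
  smul_mem' := by
    rintro c ⟨v, d, w⟩ ⟨h1, ⟨a, h2⟩, η, W, h3, h4, h5⟩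
    refine ⟨h1.smul c, ⟨a, ?_⟩, c • η, c • W, h3.smul c, h4.smul c, ?_⟩
    · filter_upwards [h2, Lp.coeFn_smul c v] with x e1 e3 hx
      change (c • v) x = 0
      rw [e3, Pi.smul_apply, e1 hx, smul_zero]
    · filter_upwards [h5, Lp.coeFn_smul c w, ae_restrict_of_ae (Lp.coeFn_smul c W)]
        with x e1 e3 e4
      change (c • w) x = _
      rw [e3, e4, Pi.smul_apply, Pi.smul_apply, e1]

/-- The graph of the extension by continuity of the Dirichlet-to-Neumann map to `W^{1,2}`:
`(v, w)` belongs to it if, for some `d`, the triple `(v, d, w)` is a limit of elements of `dtnCore`.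
Convergence of the first two components is convergence in `W^{1,2}`, that of the third is
convergence in `L²`. -/
def dtnGraph : Submodule ℂ (L2E × L2E) :=
  dtnCore.topologicalClosure.map
    ((LinearMap.fst ℂ L2E (L2E × L2E)).prod
      ((LinearMap.snd ℂ L2E L2E).comp (LinearMap.snd ℂ L2E (L2E × L2E))))

/-- The Dirichlet-to-Neumann map, as an unbounded operator on `L²` of the free surface. -/
def dtn : L2E →ₗ.[ℂ] L2E := dtnGraph.toLinearPMap

/-- The unbounded operator `I + g Λ`, where `Λ` is the Dirichlet-to-Neumann map. -/
def idAddDtn (g : ℝ) : L2E →ₗ.[ℂ] L2E := (LinearMap.id : L2E →ₗ[ℂ] L2E) +ᵥ ((g : ℂ) • dtn)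

/-! ### Square roots and form domains -/

/-- `S` is a nonnegative self-adjoint operator with `S ∘ S = A`, where the domain of `S ∘ S`
consists of the `v` in the domain of `S` such that `S v` is in the domain of `S`. -/
def IsPosSqrt (S A : L2E →ₗ.[ℂ] L2E) : Prop :=
  IsSelfAdjoint S ∧ (∀ v : S.domain, 0 ≤ (inner ℂ (S v) (v : L2E)).re) ∧
    ∀ v w : L2E, (v, w) ∈ A.graph ↔ ∃ u : L2E, (v, u) ∈ S.graph ∧ (u, w) ∈ S.graph

/-- The completion of the domain of `A` with respect to the norm `‖S v‖`, realized inside `L²`: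
the limits in `L²` of sequences in the domain of `A` that are Cauchy for this norm. -/
def formCompletion (S A : L2E →ₗ.[ℂ] L2E) : Set L2E :=
  {v | ∃ u s : ℕ → L2E, (∀ n, u n ∈ A.domain ∧ (u n, s n) ∈ S.graph) ∧
    Tendsto u atTop (𝓝 v) ∧ CauchySeq s}

end HalfSobolev

end

/-! Everything is compared with one diagonal model. Each component of the free surface is translated
to the positive half-line and functions are extended evenly. The Fourier transforms of the two even
extensions (`spec`) diagonalize the Neumann Laplacian of the half-lines; its square root N is
multiplication by 2π|ξ|. An even extension creates no jump at the origin, so W^{1,2} is exactly the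
space of finite energy for the weight |2πξ|² (`mem_sobolevOne_iff`).

On the line, the Gagliardo seminorm is a constant multiple of the form of the half-plane operator
(`IsHalfPlaneDtN.gagl_eq`), and it is invariant under x ↦ 1/x (`gagl_comp_inv`). The invariance has
two uses. It makes the half-plane operator equivariant under inversion
(`IsHalfPlaneDtN.equivariant`), so that Λ inherits symmetry and positivity. It also turns the form
of Λ, up to a constant, into a double integral over the free surface with kernel |x - y|⁻² + |xy -
1|⁻² (`IsReflection.gagl_eq`, `dtnCore_re`). With the same constant, the form of N has kernel |s -
t|⁻² + |s + t|⁻² on each half-line.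

For x and y on one component, at distances s and t from its end point, xy - 1 = s + t + st; and
different components are a positive distance apart. The two kernels therefore differ by at most a
kernel with uniformly bounded row integrals, and Schur's test bounds the difference of the forms by
a multiple of ‖v‖² (`kernelForm_kerZ_le`). A densely defined symmetric operator with L²-bounded form
is bounded (`norm_le_of_form_le`), so Λ = N + B with B bounded and symmetric
(`exists_perturbation`). This identifies the closure and its domain (`exists_mem_dtnGraph_iff`), and
Neumann series show that Λ + k is onto for every k > 0 (`dtn_surjective`).

Hence I + gΛ is symmetric, bounded below by I and onto. Its inverse T is a bounded nonnegative
operator with a unique nonnegative root R, and the root of I + gΛ is R⁻¹ (`exists_sqrt`). The form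
of I + gΛ is comparable with the energy of weight 1 + |ξ| (`exists_form_equiv`); spectral cut-offs
then show that the range of R is the space where this energy is finite (`exists_root_equiv`), and
the same comparison of kernels identifies it with W^{1/2,2} (`exists_halfNorm_equiv`).

For the interpolation space, K(t, v)² is comparable with the energy of weight min(1, t²w²), where w
= (1 + (2πξ)²)^{1/2}. Since ∫ t⁻² min(1, t²w²) dt = 2w and w is comparable with 1 + |ξ|, the
interpolation norm is the same energy norm (`exists_interpNorm_equiv`). -/

namespace HalfSobolev

/-! ### The L² Fourier transform by duality with Schwartz functions -/

open SchwartzMap in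
-- The L² transform agrees with the transform of tempered distributions. This duality replaces the
-- integral formula, which is not available for general L² functions.
lemma integral_mul_fourier (f : L2R) (g : 𝓢(ℝ, ℂ)) :
    ∫ x, g x * (𝓕 f : L2R) x = ∫ x, (𝓕 g) x * f x := by
  have h := congrArg (fun T => T g) (Lp.fourier_toTemperedDistribution_eq f)
  simp only [TemperedDistribution.fourier_apply, Lp.toTemperedDistribution_apply,
    smul_eq_mul] at h
  exact h.symm

lemma lintegral_enorm_sq {μ : Measure ℝ} (f : Lp (α := ℝ) ℂ 2 μ) :
    ∫⁻ x, ‖f x‖ₑ ^ 2 ∂μ = ‖f‖ₑ ^ 2 := by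
  rw [Lp.enorm_def, eLpNorm_eq_lintegral_rpow_enorm_toReal (by norm_num) (by norm_num)]
  simp only [ENNReal.toReal_ofNat, ENNReal.rpow_ofNat, one_div]
  rw [← ENNReal.rpow_natCast, ← ENNReal.rpow_mul]
  norm_num

open SchwartzMap in
lemma fourier_coeFn_schwartz (g : 𝓢(ℝ, ℂ)) (y : ℝ) :
    (𝓕 g) y = ∫ x : ℝ, Complex.exp (↑(-2 * Real.pi * x * y) * Complex.I) * g x := by
  rw [SchwartzMap.fourier_coe, Real.fourier_real_eq_integral_exp_smul]
  rfl

/-- The real test function `g` as a complex Schwartz function, multiplied by `m`. -/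
lemma exists_schwartz_mul {g : ℝ → ℝ} (hg : ContDiff ℝ ∞ g) (hc : HasCompactSupport g)
    {m : ℝ → ℂ} (hm : ContDiff ℝ ∞ m) :
    ∃ G : SchwartzMap ℝ ℂ, ∀ x, G x = m x * (g x : ℂ) := by
  have h1 : HasCompactSupport (fun x => m x * (g x : ℂ)) :=
    (hc.comp_left (g := fun t : ℝ => (t : ℂ)) (by simp)).mul_left
  have h2 : ContDiff ℝ ∞ (fun x => m x * (g x : ℂ)) :=
    hm.mul (Complex.ofRealCLM.contDiff.comp hg)
  exact ⟨h1.toSchwartzMap h2, fun x => rfl⟩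

lemma contDiff_exp_mul (h : ℝ) :
    ContDiff ℝ ∞ (fun ξ : ℝ => Complex.exp (↑(2 * Real.pi * h * ξ) * Complex.I)) := by
  have : ContDiff ℝ ∞ (fun ξ : ℝ => ((2 * Real.pi * h * ξ : ℝ) : ℂ)) :=
    Complex.ofRealCLM.contDiff.comp (contDiff_const.mul contDiff_id)
  exact (this.mul contDiff_const).cexp

lemma locallyIntegrable_L2R (f : L2R) : LocallyIntegrable f volume :=
  (Lp.memLp f).locallyIntegrable (by norm_num)

/-- Tested against g, the exponential is absorbed into the test function: modulating a Schwartz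
function translates its transform, and translation invariance of Lebesgue measure moves the shift
back onto f. -/
lemma fourier_translate {f fh : L2R} {h : ℝ} (e : ∀ᵐ x : ℝ, fh x = f (x + h)) :
    ∀ᵐ ξ : ℝ, (𝓕 fh : L2R) ξ =
      Complex.exp (↑(2 * Real.pi * h * ξ) * Complex.I) * (𝓕 f : L2R) ξ := by
  have hexp := contDiff_exp_mul h
  refine ae_eq_of_integral_contDiff_smul_eq (locallyIntegrable_L2R _) ?_ ?_
  · have := (locallyIntegrable_L2R (𝓕 f : L2R)).locallyIntegrableOn Set.univ
    rw [← locallyIntegrableOn_univ]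
    exact this.continuousOn_mul hexp.continuous.continuousOn isOpen_univ.isLocallyClosed
  · intro g hg hc
    obtain ⟨G, hG⟩ := exists_schwartz_mul hg hc (m := fun _ => 1) contDiff_const
    obtain ⟨H, hH⟩ := exists_schwartz_mul hg hc hexp
    have key : ∀ y : ℝ, (𝓕 H) (y + h) = (𝓕 G) y := by
      intro y
      rw [fourier_coeFn_schwartz, fourier_coeFn_schwartz]
      congr 1
      ext x
      rw [hG, hH, one_mul, ← mul_assoc, ← Complex.exp_add]
      congr 2
      push_cast
      ring
    calc ∫ x, g x • (𝓕 fh : L2R) x = ∫ x, G x * (𝓕 fh : L2R) x := by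
          simp [hG]
      _ = ∫ x, (𝓕 G) x * fh x := integral_mul_fourier _ _
      _ = ∫ x, (𝓕 H) (x + h) * f (x + h) := by
          refine integral_congr_ae ?_
          filter_upwards [e] with x hx
          rw [hx, key]
      _ = ∫ x, (𝓕 H) x * f x := integral_add_right_eq_self (fun x => (𝓕 H) x * f x) h
      _ = ∫ x, H x * (𝓕 f : L2R) x := (integral_mul_fourier _ _).symm
      _ = _ := by
          congr 1
          ext x
          rw [hH, Complex.real_smul]
          ring

lemma fourier_comp_neg {f fn : L2R} (e : ∀ᵐ x : ℝ, fn x = f (-x)) :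
    ∀ᵐ ξ : ℝ, (𝓕 fn : L2R) ξ = (𝓕 f : L2R) (-ξ) := by
  set F : L2R := Lp.compMeasurePreserving (fun x : ℝ => -x) (Measure.measurePreserving_neg volume)
    (𝓕 f : L2R) with hF
  have eF : ∀ᵐ ξ : ℝ, F ξ = (𝓕 f : L2R) (-ξ) :=
    Lp.coeFn_compMeasurePreserving _ (Measure.measurePreserving_neg volume)
  suffices ∀ᵐ ξ : ℝ, (𝓕 fn : L2R) ξ = F ξ by
    filter_upwards [this, eF] with ξ h1 h2
    rw [h1, h2]
  refine ae_eq_of_integral_contDiff_smul_eq (locallyIntegrable_L2R _) (locallyIntegrable_L2R _) ?_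
  intro g hg hc
  obtain ⟨G, hG⟩ := exists_schwartz_mul hg hc (m := fun _ => 1) contDiff_const
  have hc' : HasCompactSupport (fun x => g (-x)) := hc.comp_homeomorph (Homeomorph.neg ℝ)
  obtain ⟨H, hH⟩ := exists_schwartz_mul (hg.comp contDiff_neg) hc' (m := fun _ => 1) contDiff_const
  have key : ∀ y : ℝ, (𝓕 H) (-y) = (𝓕 G) y := by
    intro y
    rw [fourier_coeFn_schwartz, fourier_coeFn_schwartz, ← integral_neg_eq_self]
    congr 1
    ext x
    rw [hG, hH]
    simp
  calc ∫ x, g x • (𝓕 fn : L2R) x = ∫ x, G x * (𝓕 fn : L2R) x := by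
        simp [hG]
    _ = ∫ x, (𝓕 G) x * fn x := integral_mul_fourier _ _
    _ = ∫ x, (𝓕 H) (-x) * f (-x) := by
        refine integral_congr_ae ?_
        filter_upwards [e] with x hx
        rw [hx, key]
    _ = ∫ x, (𝓕 H) x * f x := integral_neg_eq_self (fun x => (𝓕 H) x * f x) volume
    _ = ∫ x, H x * (𝓕 f : L2R) x := (integral_mul_fourier _ _).symm
    _ = ∫ x, H (-x) * (𝓕 f : L2R) (-x) :=
        (integral_neg_eq_self (fun x => H x * (𝓕 f : L2R) x) volume).symm
    _ = _ := by
        refine integral_congr_ae ?_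
        filter_upwards [eF] with x hx
        rw [hx, hH, Complex.real_smul]
        simp

/-! ### The Gagliardo seminorm on the Fourier side -/

/-- The Gagliardo seminorm of order one half on the line, squared. -/
noncomputable def gagl (f : ℝ → ℂ) : ℝ≥0∞ :=
  ∫⁻ x, ∫⁻ y, ‖f x - f y‖ₑ ^ 2 / ‖x - y‖ₑ ^ 2

/-- The constant relating the Gagliardo seminorm to the Fourier transform. -/
noncomputable def gaglConst : ℝ≥0∞ :=
  ∫⁻ u : ℝ, ‖1 - Complex.exp (↑(2 * Real.pi * u) * Complex.I)‖ₑ ^ 2 / ‖u‖ₑ ^ 2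

lemma lintegral_comp_mul_left {F : ℝ → ℝ≥0∞} (hF : Measurable F) {a : ℝ} (ha : a ≠ 0) :
    ∫⁻ x, F (a * x) = ENNReal.ofReal |a⁻¹| * ∫⁻ x, F x := by
  have : ∫⁻ x, F x ∂(Measure.map (fun x => a * x) (volume : Measure ℝ)) = ∫⁻ x, F (a * x) :=
    lintegral_map hF (measurable_const_mul a)
  rw [← this, Real.map_volume_mul_left ha, lintegral_smul_measure, smul_eq_mul]

/-- Scaling u = ξh: the denominator contributes |ξ|² and the Jacobian |ξ|⁻¹. -/
lemma lintegral_difference_quotient (ξ : ℝ) :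
    ∫⁻ h : ℝ, ‖1 - Complex.exp (↑(2 * Real.pi * h * ξ) * Complex.I)‖ₑ ^ 2 / ‖h‖ₑ ^ 2
      = gaglConst * ‖ξ‖ₑ := by
  by_cases hξ : ξ = 0
  · simp [hξ]
  have hm : Measurable (fun u : ℝ =>
      ‖1 - Complex.exp (↑(2 * Real.pi * u) * Complex.I)‖ₑ ^ 2 / ‖u‖ₑ ^ 2) := by
    fun_prop
  have h2 := lintegral_comp_mul_left hm hξ
  have hx0 : ‖ξ‖ₑ ≠ 0 := by simpa using hξ
  have hxt : ‖ξ‖ₑ ≠ ⊤ := enorm_ne_top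
  have h3 : ∀ h : ℝ, ‖1 - Complex.exp (↑(2 * Real.pi * h * ξ) * Complex.I)‖ₑ ^ 2 / ‖h‖ₑ ^ 2
      = ‖ξ‖ₑ ^ 2 * (‖1 - Complex.exp (↑(2 * Real.pi * (ξ * h)) * Complex.I)‖ₑ ^ 2
        / ‖ξ * h‖ₑ ^ 2) := by
    intro h
    rw [enorm_mul, mul_pow, show 2 * Real.pi * h * ξ = 2 * Real.pi * (ξ * h) by ring,
      ENNReal.div_eq_inv_mul, ENNReal.div_eq_inv_mul,
      ENNReal.mul_inv (Or.inl (by simpa using hξ)) (Or.inl (by simp)), ← mul_assoc, ← mul_assoc, ← mul_assoc,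
      ENNReal.mul_inv_cancel (by simpa using hξ) (by simp), one_mul]
  simp_rw [h3]
  rw [lintegral_const_mul _ (by fun_prop), h2, gaglConst, ← mul_assoc, mul_comm]
  congr 1
  rw [abs_inv, ENNReal.ofReal_inv_of_pos (abs_pos.2 hξ), ← Real.norm_eq_abs,
    ofReal_norm, sq, mul_assoc, ENNReal.mul_inv_cancel hx0 hxt, mul_one]

/-- With y = x + h the seminorm is an integral over h of ‖f - f(· + h)‖² / h². Plancherel for each
fixed h gives the multiplier |1 - exp(2πihξ)|², and Tonelli leaves the h-integral, which scales like
|ξ|. -/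
lemma gagl_eq_lintegral (f : L2R) :
    gagl f = gaglConst * ∫⁻ ξ, ‖ξ‖ₑ * ‖(𝓕 f : L2R) ξ‖ₑ ^ 2 := by
  have hf : Measurable f := (Lp.stronglyMeasurable f).measurable
  have hFf : Measurable (𝓕 f : L2R) := (Lp.stronglyMeasurable _).measurable
  have h1 : ∀ h : ℝ, ∫⁻ x, ‖f x - f (x + h)‖ₑ ^ 2
      = ∫⁻ ξ, ‖1 - Complex.exp (↑(2 * Real.pi * h * ξ) * Complex.I)‖ₑ ^ 2
        * ‖(𝓕 f : L2R) ξ‖ₑ ^ 2 := by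
    intro h
    have mp := measurePreserving_add_right (volume : Measure ℝ) h
    set fh : L2R := Lp.compMeasurePreserving (fun x : ℝ => x + h) mp f
    have e : ∀ᵐ x : ℝ, fh x = f (x + h) := Lp.coeFn_compMeasurePreserving f mp
    calc ∫⁻ x, ‖f x - f (x + h)‖ₑ ^ 2 = ∫⁻ x, ‖(f - fh : L2R) x‖ₑ ^ 2 := by
          refine lintegral_congr_ae ?_
          filter_upwards [e, Lp.coeFn_sub f fh] with x h1 h2
          rw [h2, Pi.sub_apply, h1]
      _ = ‖(𝓕 (f - fh) : L2R)‖ₑ ^ 2 := by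
          rw [lintegral_enorm_sq, ← ofReal_norm, ← ofReal_norm,
            Lp.norm_fourier_eq]
      _ = ∫⁻ ξ, ‖(𝓕 (f - fh) : L2R) ξ‖ₑ ^ 2 := (lintegral_enorm_sq _).symm
      _ = _ := by
          have e2 : (𝓕 (f - fh) : L2R) = 𝓕 f - 𝓕 fh := (Lp.fourierTransformₗᵢ ℝ ℂ).map_sub f fh
          refine lintegral_congr_ae ?_
          rw [e2]
          filter_upwards [fourier_translate e, Lp.coeFn_sub (𝓕 f : L2R) (𝓕 fh)] with ξ h1 h2
          rw [h2, Pi.sub_apply, h1, ← mul_pow, ← enorm_mul]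
          congr 2
          ring
  calc gagl f = ∫⁻ x, ∫⁻ h, ‖f x - f (x + h)‖ₑ ^ 2 / ‖h‖ₑ ^ 2 := by
        unfold gagl
        refine lintegral_congr fun x => ?_
        rw [← lintegral_add_left_eq_self _ x]
        refine lintegral_congr fun h => ?_
        rw [show x - (x + h) = -h by ring, enorm_neg]
    _ = ∫⁻ h, ∫⁻ x, ‖f x - f (x + h)‖ₑ ^ 2 / ‖h‖ₑ ^ 2 := by
        refine lintegral_lintegral_swap (Measurable.aemeasurable ?_)
        simp only [Function.uncurry_def]
        fun_prop
    _ = ∫⁻ h, ∫⁻ ξ, ‖1 - Complex.exp (↑(2 * Real.pi * h * ξ) * Complex.I)‖ₑ ^ 2 / ‖h‖ₑ ^ 2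
        * ‖(𝓕 f : L2R) ξ‖ₑ ^ 2 := by
        refine lintegral_congr fun h => ?_
        simp_rw [div_eq_mul_inv]
        rw [lintegral_mul_const _ (by fun_prop), h1, ← lintegral_mul_const _ (by fun_prop)]
        refine lintegral_congr fun ξ => ?_
        ring
    _ = ∫⁻ ξ, ∫⁻ h, ‖1 - Complex.exp (↑(2 * Real.pi * h * ξ) * Complex.I)‖ₑ ^ 2 / ‖h‖ₑ ^ 2
        * ‖(𝓕 f : L2R) ξ‖ₑ ^ 2 := by
        refine lintegral_lintegral_swap (Measurable.aemeasurable ?_)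
        simp only [Function.uncurry_def]
        fun_prop
    _ = ∫⁻ ξ, gaglConst * (‖ξ‖ₑ * ‖(𝓕 f : L2R) ξ‖ₑ ^ 2) := by
        refine lintegral_congr fun ξ => ?_
        rw [lintegral_mul_const _ (by fun_prop), lintegral_difference_quotient, mul_assoc]
    _ = _ := by
        rw [lintegral_const_mul _ (by fun_prop)]

lemma gaglConst_ne_zero : gaglConst ≠ 0 := by
  unfold gaglConst
  rw [← pos_iff_ne_zero, lintegral_pos_iff_support (by fun_prop)]
  refine lt_of_lt_of_le ?_ (measure_mono (s := Set.Ioo (0 : ℝ) 1) ?_)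
  · simp
  · intro u hu
    rw [Function.mem_support]
    refine ENNReal.div_ne_zero.2 ⟨?_, by simp⟩
    rw [pow_ne_zero_iff two_ne_zero, enorm_ne_zero, sub_ne_zero, ne_comm, Ne,
      Complex.exp_eq_one_iff]
    rintro ⟨n, hn⟩
    have h1 : (2 * Real.pi * Complex.I) * (u : ℂ) = (2 * Real.pi * Complex.I) * (n : ℂ) := by
      push_cast at hn
      linear_combination hn
    have h2 := mul_left_cancel₀ Complex.two_pi_I_ne_zero h1
    have h3 : u = n := by exact_mod_cast h2
    have h4 := hu.1
    have h5 := hu.2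
    rw [h3] at h4 h5
    have h6 : 0 < n := by exact_mod_cast h4
    have h7 : n < 1 := by exact_mod_cast h5
    omega

lemma gaglConst_ne_top : gaglConst ≠ ⊤ := by
  have hint : Integrable (fun u : ℝ => 8 * (2 * Real.pi) ^ 2 * (1 + u ^ 2)⁻¹) :=
    integrable_inv_one_add_sq.const_mul _
  refine ne_top_of_le_ne_top hint.2.ne (lintegral_mono fun u => ?_)
  by_cases hu : u = 0
  · simp [hu]
  have h1 : ‖1 - Complex.exp (↑(2 * Real.pi * u) * Complex.I)‖ ≤ 2 := by
    refine (norm_sub_le _ _).trans ?_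
    rw [Complex.norm_exp_ofReal_mul_I]
    norm_num
  have h2 : ‖1 - Complex.exp (↑(2 * Real.pi * u) * Complex.I)‖ ≤ 2 * Real.pi * |u| := by
    have := Real.norm_exp_I_mul_ofReal_sub_one_le (x := 2 * Real.pi * u)
    rw [norm_sub_rev, mul_comm]
    refine this.trans (le_of_eq ?_)
    rw [Real.norm_eq_abs, abs_mul, abs_of_pos Real.two_pi_pos]
  -- From z² ≤ (2π)²u² and z² ≤ 4 follows z²(1 + u²) ≤ ((2π)² + 4)u², and 4 ≤ 7(2π)².
  have h3 : ‖1 - Complex.exp (↑(2 * Real.pi * u) * Complex.I)‖ ^ 2 / |u| ^ 2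
      ≤ 8 * (2 * Real.pi) ^ 2 * (1 + u ^ 2)⁻¹ := by
    set z := ‖1 - Complex.exp (↑(2 * Real.pi * u) * Complex.I)‖
    have hz : 0 ≤ z := norm_nonneg _
    have h4 : z ^ 2 ≤ (2 * Real.pi) ^ 2 * u ^ 2 := by
      rw [← sq_abs u, ← mul_pow]
      exact pow_le_pow_left₀ hz h2 2
    have h5 : z ^ 2 ≤ 4 := by nlinarith
    have h6 : 1 ≤ (2 * Real.pi) ^ 2 := by nlinarith [Real.pi_gt_three]
    have hu2 : 0 < u ^ 2 := by positivity
    rw [sq_abs, ← div_eq_mul_inv, div_le_div_iff₀ hu2 (by positivity)]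
    nlinarith
  calc _ = ENNReal.ofReal (‖1 - Complex.exp (↑(2 * Real.pi * u) * Complex.I)‖ ^ 2 / |u| ^ 2) := by
        rw [ENNReal.ofReal_div_of_pos (by positivity), ENNReal.ofReal_pow (norm_nonneg _),
          ENNReal.ofReal_pow (abs_nonneg _), ofReal_norm, ← Real.norm_eq_abs,
          ofReal_norm]
    _ ≤ _ := by
        rw [← ofReal_norm]
        exact ENNReal.ofReal_le_ofReal (h3.trans (le_abs_self _))

/-! ### The quadratic form of the half-plane operator -/

lemma inner_eq_integral {μ : Measure ℝ} (f g : Lp (α := ℝ) ℂ 2 μ) :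
    inner ℂ f g = ∫ x, (starRingEnd ℂ (f x)) * g x ∂μ := by
  rw [L2.inner_def]
  congr 1
  ext x
  rw [RCLike.inner_apply, mul_comm]

lemma IsHalfPlaneDtN.inner_symm {η w η' w' : L2R} (h : IsHalfPlaneDtN η w)
    (h' : IsHalfPlaneDtN η' w') : (inner ℂ w η' : ℂ) = inner ℂ η w' := by
  rw [← Lp.inner_fourier_eq, ← Lp.inner_fourier_eq η, inner_eq_integral, inner_eq_integral]
  refine integral_congr_ae ?_
  filter_upwards [h, h'] with ξ h1 h2
  rw [h1, h2, map_mul, Complex.conj_ofReal]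
  ring

lemma IsHalfPlaneDtN.inner_eq {η w : L2R} (h : IsHalfPlaneDtN η w) :
    (inner ℂ w η : ℂ) = ((∫ ξ, 2 * Real.pi * |ξ| * ‖(𝓕 η : L2R) ξ‖ ^ 2 : ℝ) : ℂ) := by
  rw [← Lp.inner_fourier_eq, inner_eq_integral, ← integral_complex_ofReal]
  refine integral_congr_ae ?_
  filter_upwards [h] with ξ h1
  rw [h1, map_mul, Complex.conj_ofReal, mul_assoc, Complex.conj_mul']
  push_cast
  ring

lemma IsHalfPlaneDtN.integrable {η w : L2R} (h : IsHalfPlaneDtN η w) :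
    Integrable (fun ξ => 2 * Real.pi * |ξ| * ‖(𝓕 η : L2R) ξ‖ ^ 2) := by
  have := (L2.integrable_inner (𝕜 := ℂ) (𝓕 w : L2R) (𝓕 η : L2R)).norm
  refine this.congr ?_
  filter_upwards [h] with ξ h1
  rw [h1, RCLike.inner_apply, map_mul, Complex.conj_ofReal, norm_mul, norm_mul, Complex.norm_real,
    RCLike.norm_conj, Real.norm_of_nonneg (by positivity)]
  ring

/-- The Gagliardo seminorm is the quadratic form of the half-plane operator. -/
lemma IsHalfPlaneDtN.gagl_eq {η w : L2R} (h : IsHalfPlaneDtN η w) :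
    gagl η = gaglConst * ENNReal.ofReal ((2 * Real.pi)⁻¹ * (inner ℂ w η : ℂ).re) := by
  rw [gagl_eq_lintegral, h.inner_eq, Complex.ofReal_re, ← integral_const_mul,
    ofReal_integral_eq_lintegral_ofReal (h.integrable.const_mul _)
      (Eventually.of_forall fun ξ => by positivity)]
  congr 1
  refine lintegral_congr fun ξ => ?_
  rw [show (2 * Real.pi)⁻¹ * (2 * Real.pi * |ξ| * ‖(𝓕 η : L2R) ξ‖ ^ 2)
    = |ξ| * ‖(𝓕 η : L2R) ξ‖ ^ 2 by field_simp, ENNReal.ofReal_mul (abs_nonneg _),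
    ENNReal.ofReal_pow (norm_nonneg _), ofReal_norm, ← Real.norm_eq_abs, ofReal_norm]

lemma IsHalfPlaneDtN.re_inner_nonneg {η w : L2R} (h : IsHalfPlaneDtN η w) :
    0 ≤ (inner ℂ w η : ℂ).re := by
  rw [h.inner_eq, Complex.ofReal_re]
  exact integral_nonneg fun ξ => by positivity

/-- An `L²` function on the line with finite spectral energy is in the domain of the half-plane
operator. -/
lemma exists_isHalfPlaneDtN {η : L2R}
    (h : ∫⁻ ξ, ‖2 * Real.pi * ξ‖ₑ ^ 2 * ‖(𝓕 η : L2R) ξ‖ₑ ^ 2 ≠ ⊤) :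
    ∃ w : L2R, IsHalfPlaneDtN η w := by
  have hm : Measurable (𝓕 η : L2R) := (Lp.stronglyMeasurable _).measurable
  have hml : MemLp (fun ξ : ℝ => ((2 * Real.pi * |ξ| : ℝ) : ℂ) * (𝓕 η : L2R) ξ) 2 := by
    refine ⟨by fun_prop, ?_⟩
    rw [eLpNorm_lt_top_iff_lintegral_rpow_enorm_lt_top (by norm_num) (by norm_num)]
    refine lt_of_le_of_lt (le_of_eq (lintegral_congr fun ξ => ?_)) h.lt_top
    rw [ENNReal.toReal_ofNat, ENNReal.rpow_ofNat, enorm_mul, mul_pow, ← ofReal_norm,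
      ← ofReal_norm (2 * Real.pi * ξ), Complex.norm_real]
    congr 3
    simp
  refine ⟨𝓕⁻ hml.toLp, ?_⟩
  unfold IsHalfPlaneDtN
  rw [FourierTransform.fourier_fourierInv_eq]
  exact hml.coeFn_toLp

/-! ### Weak derivatives on the line -/

/-- `D` is the weak derivative of `V` on the line, tested with Schwartz functions. -/
def IsLineWeakDeriv (V D : L2R) : Prop :=
  ∀ ψ : SchwartzMap ℝ ℂ, ∫ x, deriv ψ x * V x = -∫ x, ψ x * D x

lemma fourier_smul_id (g : SchwartzMap ℝ ℂ) :
    ∃ H : SchwartzMap ℝ ℂ, (∀ x, H x = -(2 * Real.pi * Complex.I) * x * g x) ∧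
      ∀ x, deriv (𝓕 g : SchwartzMap ℝ ℂ) x = (𝓕 H : SchwartzMap ℝ ℂ) x := by
  have h := SchwartzMap.lineDerivOp_fourier_eq g (1 : ℝ)
  refine ⟨-(2 * Real.pi * Complex.I) • (SchwartzMap.smulLeftCLM ℂ fun x => inner ℝ x (1 : ℝ)) g,
    fun x => ?_, fun x => ?_⟩
  · have : (fun x : ℝ => inner ℝ x (1 : ℝ)).HasTemperateGrowth := by fun_prop
    rw [smul_apply, SchwartzMap.smulLeftCLM_apply_apply this]
    simp
    ring
  · rw [← h]
    simp [SchwartzMap.lineDerivOp_apply_eq_fderiv]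

lemma locallyIntegrable_mul {m : ℝ → ℂ} (hm : Continuous m) (f : L2R) :
    LocallyIntegrable (fun x => m x * f x) volume := by
  have := (locallyIntegrable_L2R f).locallyIntegrableOn Set.univ
  rw [← locallyIntegrableOn_univ]
  exact this.continuousOn_mul hm.continuousOn isOpen_univ.isLocallyClosed

/-- The Schwartz class is stable under the Fourier transform, so the test function can be written as
a transform and the derivative becomes multiplication by the frequency. Compactly supported tests
would not survive this exchange. -/
lemma isLineWeakDeriv_iff {V D : L2R} :
    IsLineWeakDeriv V D ↔
      ∀ᵐ ξ : ℝ, (𝓕 D : L2R) ξ = (2 * Real.pi * Complex.I) * ξ * (𝓕 V : L2R) ξ := by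
  have hcont : Continuous (fun ξ : ℝ => (2 * Real.pi * Complex.I) * (ξ : ℂ)) := by fun_prop
  constructor
  · intro h
    refine ae_eq_of_integral_contDiff_smul_eq (locallyIntegrable_L2R _)
      (locallyIntegrable_mul hcont _) ?_
    intro g hg hc
    obtain ⟨G, hG⟩ := exists_schwartz_mul hg hc (m := fun _ => 1) contDiff_const
    obtain ⟨H, hH, hH'⟩ := fourier_smul_id G
    calc ∫ x, g x • (𝓕 D : L2R) x = ∫ x, G x * (𝓕 D : L2R) x := by simp [hG]
      _ = ∫ x, (𝓕 G) x * D x := integral_mul_fourier _ _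
      _ = -∫ x, deriv (𝓕 G : SchwartzMap ℝ ℂ) x * V x := by rw [h (𝓕 G), neg_neg]
      _ = -∫ x, (𝓕 H) x * V x := by simp_rw [hH']
      _ = -∫ x, H x * (𝓕 V : L2R) x := by rw [integral_mul_fourier]
      _ = _ := by
        rw [← integral_neg]
        congr 1
        ext x
        rw [hH, hG, Complex.real_smul]
        ring
  · intro h ψ
    obtain ⟨H, hH, hH'⟩ := fourier_smul_id (𝓕⁻ ψ)
    have e : 𝓕 (𝓕⁻ ψ : SchwartzMap ℝ ℂ) = ψ := FourierTransform.fourier_fourierInv_eq ψ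
    rw [e] at hH'
    simp_rw [hH']
    rw [← integral_mul_fourier, ← e, ← integral_mul_fourier, ← integral_neg]
    refine integral_congr_ae ?_
    filter_upwards [h] with ξ h1
    rw [hH, h1]
    ring

lemma IsLineWeakDeriv.lintegral_eq {V D : L2R} (h : IsLineWeakDeriv V D) :
    ∫⁻ ξ, ‖2 * Real.pi * ξ‖ₑ ^ 2 * ‖(𝓕 V : L2R) ξ‖ₑ ^ 2 = ‖D‖ₑ ^ 2 := by
  rw [← ofReal_norm, ← Lp.norm_fourier_eq, ofReal_norm, ← lintegral_enorm_sq]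
  refine lintegral_congr_ae ?_
  filter_upwards [isLineWeakDeriv_iff.1 h] with ξ h1
  rw [h1, enorm_mul (2 * Real.pi * Complex.I * (ξ : ℂ)), mul_pow]
  congr 2
  rw [← ofReal_norm, ← ofReal_norm]
  simp

lemma exists_isLineWeakDeriv {V : L2R}
    (h : ∫⁻ ξ, ‖2 * Real.pi * ξ‖ₑ ^ 2 * ‖(𝓕 V : L2R) ξ‖ₑ ^ 2 ≠ ⊤) :
    ∃ D : L2R, IsLineWeakDeriv V D := by
  have hm : Measurable (𝓕 V : L2R) := (Lp.stronglyMeasurable _).measurable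
  have hml : MemLp (fun ξ : ℝ => (2 * Real.pi * Complex.I) * ξ * (𝓕 V : L2R) ξ) 2 := by
    refine ⟨by fun_prop, ?_⟩
    rw [eLpNorm_lt_top_iff_lintegral_rpow_enorm_lt_top (by norm_num) (by norm_num)]
    refine lt_of_le_of_lt (le_of_eq (lintegral_congr fun ξ => ?_)) h.lt_top
    rw [ENNReal.toReal_ofNat, ENNReal.rpow_ofNat, enorm_mul, mul_pow, ← ofReal_norm,
      ← ofReal_norm (2 * Real.pi * ξ)]
    congr 3
    simp
  refine ⟨𝓕⁻ hml.toLp, isLineWeakDeriv_iff.2 ?_⟩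
  rw [FourierTransform.fourier_fourierInv_eq]
  exact hml.coeFn_toLp

/-- Provides the test functions for `IsHalfPlaneDtN.equivariant`. -/
lemma exists_isHalfPlaneDtN_schwartz (ψ : SchwartzMap ℝ ℂ) :
    ∃ w : L2R, IsHalfPlaneDtN (ψ.toLp 2) w := by
  have h : IsLineWeakDeriv (ψ.toLp 2) ((SchwartzMap.derivCLM ℂ ℂ ψ).toLp 2) := by
    intro φ
    have e1 : ∫ x, deriv φ x * (ψ.toLp 2 volume : L2R) x = ∫ x, deriv φ x * ψ x := by
      refine integral_congr_ae ?_
      filter_upwards [ψ.coeFn_toLp 2] with x hx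
      rw [hx]
    have e2 : ∫ x, φ x * ((SchwartzMap.derivCLM ℂ ℂ ψ).toLp 2 volume : L2R) x
        = ∫ x, φ x * deriv ψ x := by
      refine integral_congr_ae ?_
      filter_upwards [(SchwartzMap.derivCLM ℂ ℂ ψ).coeFn_toLp 2] with x hx
      rw [hx, SchwartzMap.derivCLM_apply]
    rw [e1, e2, SchwartzMap.integral_mul_deriv_eq_neg_deriv_mul φ ψ, neg_neg]
  refine exists_isHalfPlaneDtN ?_
  rw [h.lintegral_eq]
  finiteness

/-! ### Half-line coordinates on the free surface -/

/-- The sign of a half-line. -/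
noncomputable def sg (b : Bool) : ℝ := if b then 1 else -1

/-- Lebesgue measure on the positive half-line. -/
noncomputable abbrev posMeasure : Measure ℝ := (volume : Measure ℝ).restrict (Set.Ioi 0)

/-- The affine map from the positive half-line to a component of the free surface. -/
noncomputable def toSurface (b : Bool) (x : ℝ) : ℝ := sg b * (1 + x)

lemma sg_mul_sg (b : Bool) : sg b * sg b = 1 := by cases b <;> simp [sg]

lemma abs_sg (b : Bool) : |sg b| = 1 := by cases b <;> simp [sg]

lemma abs_toSurface {b : Bool} {x : ℝ} (hx : 0 < x) : |toSurface b x| = 1 + x := by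
  rw [toSurface, abs_mul, abs_sg, one_mul, abs_of_pos (by linarith)]

lemma measurePreserving_toSurface (b : Bool) :
    MeasurePreserving (toSurface b) volume (volume : Measure ℝ) := by
  have h1 := measurePreserving_add_left (volume : Measure ℝ) 1
  cases b
  · have := (Measure.measurePreserving_neg (volume : Measure ℝ)).comp h1
    convert this using 1
    ext x
    simp [toSurface, sg]
  · convert h1 using 1
    ext x
    simp [toSurface, sg]

lemma continuous_toSurface (b : Bool) : Continuous (toSurface b) := by
  unfold toSurface
  fun_prop

lemma measurable_toSurface (b : Bool) : Measurable (toSurface b) :=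
  (continuous_toSurface b).measurable

lemma measurableEmbedding_toSurface (b : Bool) : MeasurableEmbedding (toSurface b) := by
  refine (continuous_toSurface b).measurableEmbedding fun x y h => ?_
  have h2 : sg b * (sg b * (1 + x)) = sg b * (sg b * (1 + y)) := congrArg _ h
  rw [← mul_assoc, ← mul_assoc, sg_mul_sg] at h2
  linarith

lemma map_toSurface (b : Bool) :
    Measure.map (toSurface b) posMeasure = volume.restrict {y : ℝ | 1 < sg b * y} := by
  have hm : MeasurableSet {y : ℝ | 1 < sg b * y} :=
    measurableSet_lt measurable_const (measurable_const_mul _)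
  have h := (measurePreserving_toSurface b).restrict_preimage hm
  have e : toSurface b ⁻¹' {y : ℝ | 1 < sg b * y} = Set.Ioi 0 := by
    ext x
    simp only [toSurface, Set.mem_preimage, Set.mem_ofPred_eq, ← mul_assoc, sg_mul_sg, Set.mem_Ioi]
    constructor <;> intro h <;> linarith
  rw [e] at h
  exact h.map_eq

lemma surfaceMeasure_eq : surfaceMeasure =
    Measure.map (toSurface true) posMeasure + Measure.map (toSurface false) posMeasure := by
  rw [map_toSurface, map_toSurface, ← Measure.restrict_union]
  · refine congrArg (volume.restrict) (Set.ext fun y => ?_)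
    simp [freeSurface, sg, lt_abs]
  · rw [Set.disjoint_left]
    intro y h1 h2
    simp only [sg, Set.mem_ofPred_eq] at h1 h2
    norm_num at h1 h2
    linarith
  · exact measurableSet_lt measurable_const (measurable_const_mul _)

lemma volume_eq_pos_add : (volume : Measure ℝ) =
    posMeasure + Measure.map (fun x : ℝ => -x) posMeasure := by
  have h := (Measure.measurePreserving_neg (volume : Measure ℝ)).restrict_preimage
    (measurableSet_Iio (a := (0 : ℝ)))
  have e : (fun x : ℝ => -x) ⁻¹' Set.Iio 0 = Set.Ioi 0 := by
    ext x
    simp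
  have h2 : Measure.map (fun x : ℝ => -x) posMeasure = volume.restrict (Set.Iio 0) := by
    rw [e] at h
    exact h.map_eq
  rw [h2, restrict_Iio_eq_restrict_Iic, ← Measure.restrict_union
    (by rw [Set.disjoint_left]; intro x h1 h2; exact absurd (Set.mem_Ioi.1 h1) (not_lt.2 h2)) measurableSet_Iic,
    Set.union_comm, Set.Iic_union_Ioi, Measure.restrict_univ]

lemma measurableEmbedding_neg : MeasurableEmbedding (fun x : ℝ => -x) :=
  (Homeomorph.neg ℝ).measurableEmbedding

lemma lintegral_surface (F : ℝ → ℝ≥0∞) : ∫⁻ x, F x ∂surfaceMeasure =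
    ∫⁻ s, F (toSurface true s) ∂posMeasure + ∫⁻ s, F (toSurface false s) ∂posMeasure := by
  rw [surfaceMeasure_eq, lintegral_add_measure, (measurableEmbedding_toSurface _).lintegral_map,
    (measurableEmbedding_toSurface _).lintegral_map]

lemma lintegral_line (F : ℝ → ℝ≥0∞) : ∫⁻ x, F x =
    ∫⁻ s, F s ∂posMeasure + ∫⁻ s, F (-s) ∂posMeasure := by
  conv_lhs => rw [volume_eq_pos_add]
  rw [lintegral_add_measure, measurableEmbedding_neg.lintegral_map]

lemma ae_surface_iff {p : ℝ → Prop} : (∀ᵐ x ∂surfaceMeasure, p x) ↔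
    ∀ b, ∀ᵐ s ∂posMeasure, p (toSurface b s) := by
  rw [surfaceMeasure_eq, ae_add_measure_iff, (measurableEmbedding_toSurface _).ae_map_iff,
    (measurableEmbedding_toSurface _).ae_map_iff, Bool.forall_bool, and_comm]

lemma ae_line_iff {p : ℝ → Prop} : (∀ᵐ x : ℝ, p x) ↔
    (∀ᵐ s ∂posMeasure, p s) ∧ ∀ᵐ s ∂posMeasure, p (-s) := by
  conv_lhs => rw [volume_eq_pos_add]
  rw [ae_add_measure_iff, measurableEmbedding_neg.ae_map_iff]

lemma integrable_surface_iff {F : ℝ → ℂ} : Integrable F surfaceMeasure ↔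
    ∀ b, Integrable (fun s => F (toSurface b s)) posMeasure := by
  rw [surfaceMeasure_eq, integrable_add_measure, (measurableEmbedding_toSurface _).integrable_map_iff,
    (measurableEmbedding_toSurface _).integrable_map_iff, Bool.forall_bool, and_comm]
  rfl

lemma integral_surface {F : ℝ → ℂ} (hF : Integrable F surfaceMeasure) :
    ∫ x, F x ∂surfaceMeasure =
    ∫ s, F (toSurface true s) ∂posMeasure + ∫ s, F (toSurface false s) ∂posMeasure := by
  rw [surfaceMeasure_eq, integrable_add_measure] at hF
  rw [surfaceMeasure_eq, integral_add_measure hF.1 hF.2,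
    (measurableEmbedding_toSurface _).integral_map, (measurableEmbedding_toSurface _).integral_map]

lemma integrable_line_iff {F : ℝ → ℂ} : Integrable F ↔
    Integrable F posMeasure ∧ Integrable (fun s => F (-s)) posMeasure := by
  conv_lhs => rw [volume_eq_pos_add]
  rw [integrable_add_measure, measurableEmbedding_neg.integrable_map_iff]
  rfl

lemma integral_line {F : ℝ → ℂ} (hF : Integrable F) :
    ∫ x, F x = ∫ s, F s ∂posMeasure + ∫ s, F (-s) ∂posMeasure := by
  have h := hF
  rw [volume_eq_pos_add, integrable_add_measure] at h
  conv_lhs => rw [volume_eq_pos_add]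
  rw [integral_add_measure h.1 h.2, measurableEmbedding_neg.integral_map]

lemma ae_pos : ∀ᵐ s ∂posMeasure, (0 : ℝ) < s := ae_restrict_mem measurableSet_Ioi

/-! ### Even extensions -/

lemma memLp_iff_lintegral {μ : Measure ℝ} {f : ℝ → ℂ} (hf : Measurable f) :
    MemLp f 2 μ ↔ ∫⁻ x, ‖f x‖ₑ ^ 2 ∂μ < ⊤ := by
  rw [MemLp, eLpNorm_lt_top_iff_lintegral_rpow_enorm_lt_top (by norm_num) (by norm_num)]
  simp [hf.aestronglyMeasurable]

lemma measurable_L2E (v : L2E) : Measurable v := (Lp.stronglyMeasurable v).measurable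

lemma measurable_L2R (v : L2R) : Measurable v := (Lp.stronglyMeasurable v).measurable

lemma lintegral_abs (F : ℝ → ℝ≥0∞) : ∫⁻ x, F |x| = 2 * ∫⁻ s, F s ∂posMeasure := by
  rw [lintegral_line, two_mul]
  congr 1 <;>
  · refine lintegral_congr_ae ?_
    filter_upwards [ae_pos] with s hs
    simp only [abs_neg, abs_of_pos hs]

lemma lintegral_L2E (v : L2E) : ∫⁻ s, ‖v (toSurface true s)‖ₑ ^ 2 ∂posMeasure +
    ∫⁻ s, ‖v (toSurface false s)‖ₑ ^ 2 ∂posMeasure = ‖v‖ₑ ^ 2 := by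
  rw [← lintegral_enorm_sq, lintegral_surface]

lemma lintegral_L2E_le (v : L2E) (b : Bool) :
    ∫⁻ s, ‖v (toSurface b s)‖ₑ ^ 2 ∂posMeasure ≤ ‖v‖ₑ ^ 2 := by
  rw [← lintegral_L2E]
  cases b
  · exact le_add_self
  · exact le_self_add

lemma memLp_evenExt (v : L2E) (b : Bool) : MemLp (fun x : ℝ => v (toSurface b |x|)) 2 := by
  have h1 := measurable_L2E v
  have h2 := measurable_toSurface b
  rw [memLp_iff_lintegral (by fun_prop), lintegral_abs (fun x => ‖v (toSurface b x)‖ₑ ^ 2)]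
  refine ENNReal.mul_lt_top (by simp) ((lintegral_L2E_le v b).trans_lt ?_)
  exact ENNReal.pow_lt_top enorm_lt_top

lemma ae_evenExt {p : ℝ → Prop} (h : ∀ᵐ x ∂surfaceMeasure, p x) (b : Bool) :
    ∀ᵐ x : ℝ, p (toSurface b |x|) := by
  have h1 := ae_surface_iff.1 h b
  rw [ae_line_iff]
  constructor <;>
  · filter_upwards [h1, ae_pos] with s hs hs0
    simpa only [abs_neg, abs_of_pos hs0] using hs

/-- The even extension of the restriction of `v` to a component of the free surface, translated
to the origin. -/
noncomputable def evenExt (b : Bool) : L2E →ₗ[ℂ] L2R where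
  toFun v := (memLp_evenExt v b).toLp
  map_add' v w := by
    refine Lp.ext ?_
    filter_upwards [(memLp_evenExt (v + w) b).coeFn_toLp, (memLp_evenExt v b).coeFn_toLp,
      (memLp_evenExt w b).coeFn_toLp, ae_evenExt (Lp.coeFn_add v w) b,
      Lp.coeFn_add (memLp_evenExt v b).toLp (memLp_evenExt w b).toLp] with x h1 h2 h3 h4 h5
    rw [h1, h5, Pi.add_apply, h2, h3, h4, Pi.add_apply]
  map_smul' c v := by
    refine Lp.ext ?_
    filter_upwards [(memLp_evenExt (c • v) b).coeFn_toLp, (memLp_evenExt v b).coeFn_toLp,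
      ae_evenExt (Lp.coeFn_smul c v) b,
      Lp.coeFn_smul c (memLp_evenExt v b).toLp] with x h1 h2 h4 h5
    rw [RingHom.id_apply, h1, h5, Pi.smul_apply, h2, h4, Pi.smul_apply]

lemma coeFn_evenExt (b : Bool) (v : L2E) : ∀ᵐ x : ℝ, evenExt b v x = v (toSurface b |x|) :=
  (memLp_evenExt v b).coeFn_toLp

lemma coeFn_evenExt_pos (b : Bool) (v : L2E) :
    ∀ᵐ s ∂posMeasure, evenExt b v s = v (toSurface b s) := by
  filter_upwards [(ae_line_iff.1 (coeFn_evenExt b v)).1, ae_pos] with s h1 h2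
  rw [h1, abs_of_pos h2]

lemma evenExt_neg (b : Bool) (v : L2E) : ∀ᵐ x : ℝ, evenExt b v x = evenExt b v (-x) := by
  have h := coeFn_evenExt b v
  have h2 : ∀ᵐ x : ℝ, evenExt b v (-x) = v (toSurface b |-x|) :=
    (Measure.measurePreserving_neg (volume : Measure ℝ)).quasiMeasurePreserving.ae h
  filter_upwards [h, h2] with x h1 h2
  rw [h1, h2, abs_neg]

lemma enorm_evenExt (b : Bool) (v : L2E) :
    ‖evenExt b v‖ₑ ^ 2 = 2 * ∫⁻ s, ‖v (toSurface b s)‖ₑ ^ 2 ∂posMeasure := by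
  rw [← lintegral_enorm_sq, ← lintegral_abs (fun x => ‖v (toSurface b x)‖ₑ ^ 2)]
  refine lintegral_congr_ae ?_
  filter_upwards [coeFn_evenExt b v] with x hx
  rw [hx]

lemma enorm_evenExt_add (v : L2E) :
    ‖evenExt true v‖ₑ ^ 2 + ‖evenExt false v‖ₑ ^ 2 = 2 * ‖v‖ₑ ^ 2 := by
  rw [enorm_evenExt, enorm_evenExt, ← mul_add, lintegral_L2E]

lemma inner_evenExt_add (v w : L2E) :
    (inner ℂ (evenExt true v) (evenExt true w) : ℂ) + inner ℂ (evenExt false v) (evenExt false w)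
      = 2 * inner ℂ v w := by
  have hb : ∀ b, (inner ℂ (evenExt b v) (evenExt b w) : ℂ)
      = 2 * ∫ s, (starRingEnd ℂ (v (toSurface b s))) * w (toSurface b s) ∂posMeasure := by
    intro b
    have hi : Integrable (fun x => (starRingEnd ℂ (evenExt b v x)) * evenExt b w x) := by
      refine (L2.integrable_inner (𝕜 := ℂ) (evenExt b v) (evenExt b w)).congr
        (Eventually.of_forall fun x => ?_)
      simp only [RCLike.inner_apply, mul_comm]
    rw [inner_eq_integral, integral_line hi, two_mul]
    have h1 := ae_line_iff.1 (coeFn_evenExt b v)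
    have h2 := ae_line_iff.1 (coeFn_evenExt b w)
    congr 1
    · refine integral_congr_ae ?_
      filter_upwards [h1.1, h2.1, ae_pos] with s e1 e2 e3
      rw [e1, e2, abs_of_pos e3]
    · refine integral_congr_ae ?_
      filter_upwards [h1.2, h2.2, ae_pos] with s e1 e2 e3
      rw [e1, e2, abs_neg, abs_of_pos e3]
  have hi : Integrable (fun x => (starRingEnd ℂ (v x)) * w x) surfaceMeasure := by
    refine (L2.integrable_inner (𝕜 := ℂ) v w).congr (Eventually.of_forall fun x => ?_)
    simp only [RCLike.inner_apply, mul_comm]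
  rw [hb, hb, ← mul_add, inner_eq_integral, integral_surface hi]

/-- A pair of functions on the positive half-line defines a function on the free surface. -/
lemma exists_glue (G : Bool → L2R) :
    ∃ v : L2E, ∀ b, ∀ᵐ s ∂posMeasure, v (toSurface b s) = G b s := by
  set f : ℝ → ℂ := fun y => if 0 < y then G true (y - 1) else G false (-y - 1) with hf
  have hfm : Measurable f := by
    have h1 := measurable_L2R (G true)
    have h2 := measurable_L2R (G false)
    exact Measurable.ite measurableSet_Ioi (by fun_prop) (by fun_prop)
  have hfb : ∀ b, ∀ s : ℝ, 0 < s → f (toSurface b s) = G b s := by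
    intro b s hs
    cases b
    · simp only [hf, toSurface, sg]
      rw [if_neg (by norm_num; linarith)]
      congr 1
      norm_num
    · simp only [hf, toSurface, sg]
      rw [if_pos (by norm_num; linarith)]
      congr 1
      norm_num
  have hml : MemLp f 2 surfaceMeasure := by
    have hb : ∀ b, ∫⁻ s, ‖f (toSurface b s)‖ₑ ^ 2 ∂posMeasure < ⊤ := by
      intro b
      calc ∫⁻ s, ‖f (toSurface b s)‖ₑ ^ 2 ∂posMeasure = ∫⁻ s, ‖G b s‖ₑ ^ 2 ∂posMeasure := by
            refine lintegral_congr_ae ?_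
            filter_upwards [ae_pos] with s hs
            rw [hfb b s hs]
        _ ≤ ∫⁻ s, ‖G b s‖ₑ ^ 2 := lintegral_mono' Measure.restrict_le_self le_rfl
        _ = ‖G b‖ₑ ^ 2 := lintegral_enorm_sq _
        _ < ⊤ := ENNReal.pow_lt_top enorm_lt_top
    rw [memLp_iff_lintegral hfm, lintegral_surface]
    exact ENNReal.add_lt_top.2 ⟨hb true, hb false⟩
  refine ⟨hml.toLp, fun b => ?_⟩
  filter_upwards [ae_surface_iff.1 hml.coeFn_toLp b, ae_pos] with s h1 h2
  rw [h1, hfb b s h2]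

/-- Even functions are even extensions. -/
lemma exists_evenExt_eq (G : Bool → L2R) (hG : ∀ b, ∀ᵐ x : ℝ, G b x = G b (-x)) :
    ∃ v : L2E, ∀ b, evenExt b v = G b := by
  obtain ⟨v, hv⟩ := exists_glue G
  refine ⟨v, fun b => Lp.ext ?_⟩
  have h1 := ae_line_iff.1 (coeFn_evenExt b v)
  have h2 := (ae_line_iff.1 (hG b)).1
  refine ae_line_iff.2 ⟨?_, ?_⟩
  · filter_upwards [h1.1, hv b, ae_pos] with s e1 e2 e3
    rw [e1, abs_of_pos e3, e2]
  · filter_upwards [h1.2, hv b, ae_pos, h2] with s e1 e2 e3 e4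
    rw [e1, abs_neg, abs_of_pos e3, e2, e4]

lemma evenExt_injective {v w : L2E} (h : ∀ b, evenExt b v = evenExt b w) : v = w := by
  refine Lp.ext (ae_surface_iff.2 fun b => ?_)
  have h1 := coeFn_evenExt_pos b v
  rw [h b] at h1
  filter_upwards [h1, coeFn_evenExt_pos b w] with s e1 e2
  rw [← e1, e2]

/-! ### Spectral energies -/

/-- The Fourier transform of the even extension. -/
noncomputable def spec (b : Bool) (v : L2E) : L2R := 𝓕 (evenExt b v)

lemma spec_sub (b : Bool) (v w : L2E) : spec b (v - w) = spec b v - spec b w := by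
  rw [spec, map_sub]
  exact (Lp.fourierTransformₗᵢ ℝ ℂ).map_sub _ _

lemma spec_smul (b : Bool) (c : ℂ) (v : L2E) : spec b (c • v) = c • spec b v := by
  rw [spec, map_smul]
  exact (Lp.fourierTransformₗᵢ ℝ ℂ).map_smul _ _

lemma spec_neg (b : Bool) (v : L2E) : ∀ᵐ ξ : ℝ, spec b v ξ = spec b v (-ξ) :=
  fourier_comp_neg (evenExt_neg b v)

lemma spec_injective {v w : L2E} (h : ∀ b, spec b v = spec b w) : v = w :=
  evenExt_injective fun b => (Lp.fourierTransformₗᵢ ℝ ℂ).injective (h b)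

/-- The weighted spectral energy of `v`. -/
noncomputable def energy (m : ℝ → ℝ≥0∞) (v : L2E) : ℝ≥0∞ :=
  (∫⁻ ξ, m ξ * ‖spec true v ξ‖ₑ ^ 2) + ∫⁻ ξ, m ξ * ‖spec false v ξ‖ₑ ^ 2

/-- Plancherel on the line; the factor 2 is the doubling by even extension, and it recurs whenever
an energy is compared with a norm on the free surface. -/
lemma energy_one (v : L2E) : energy (fun _ => 1) v = 2 * ‖v‖ₑ ^ 2 := by
  have hb : ∀ b, ∫⁻ ξ, 1 * ‖spec b v ξ‖ₑ ^ 2 = ‖evenExt b v‖ₑ ^ 2 := by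
    intro b
    simp_rw [one_mul]
    rw [lintegral_enorm_sq, ← ofReal_norm, ← ofReal_norm, spec, Lp.norm_fourier_eq]
  rw [← enorm_evenExt_add, ← hb, ← hb, energy]

/-- Multiplication of the spectrum by an even function. -/
lemma exists_spec_mul {m : ℝ → ℂ} (hm : Measurable m) (he : ∀ ξ, m (-ξ) = m ξ) {v : L2E}
    (h : ∀ b, ∫⁻ ξ, ‖m ξ‖ₑ ^ 2 * ‖spec b v ξ‖ₑ ^ 2 ≠ ⊤) :
    ∃ u : L2E, ∀ b, ∀ᵐ ξ : ℝ, spec b u ξ = m ξ * spec b v ξ := by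
  have hml : ∀ b, MemLp (fun ξ => m ξ * spec b v ξ) 2 := by
    intro b
    have := measurable_L2R (spec b v)
    rw [memLp_iff_lintegral (by fun_prop)]
    simp_rw [enorm_mul, mul_pow]
    exact (h b).lt_top
  set M : Bool → L2R := fun b => (hml b).toLp with hM
  have eM : ∀ b, ∀ᵐ ξ : ℝ, M b ξ = m ξ * spec b v ξ := fun b => (hml b).coeFn_toLp
  obtain ⟨u, hu⟩ := exists_evenExt_eq (fun b => (𝓕⁻ (M b) : L2R)) fun b => by
    set f : L2R := 𝓕⁻ (M b) with hf
    have hFf : (𝓕 f : L2R) = M b := FourierTransform.fourier_fourierInv_eq _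
    have mp := Measure.measurePreserving_neg (volume : Measure ℝ)
    set fn : L2R := Lp.compMeasurePreserving (fun x : ℝ => -x) mp f
    have e1 : ∀ᵐ x : ℝ, fn x = f (-x) := Lp.coeFn_compMeasurePreserving _ mp
    -- Evenness of f is read off its transform: `M b` is even because m and `spec b v` are, and the
    -- Fourier transform is injective.
    have e2 : (𝓕 fn : L2R) = 𝓕 f := by
      refine Lp.ext ?_
      have e3 : ∀ᵐ ξ : ℝ, M b (-ξ) = m (-ξ) * spec b v (-ξ) :=
        mp.quasiMeasurePreserving.ae (eM b)
      filter_upwards [fourier_comp_neg e1, e3, eM b, spec_neg b v] with ξ h1 h2 h3 h4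
      rw [h1, hFf, h2, h3, he, h4]
    have e4 : fn = f := (Lp.fourierTransformₗᵢ ℝ ℂ).injective e2
    filter_upwards [e1] with x hx
    rw [← hx, e4]
  refine ⟨u, fun b => ?_⟩
  rw [spec, hu b, FourierTransform.fourier_fourierInv_eq]
  exact eM b

lemma isOpen_freeSurface : IsOpen freeSurface := isOpen_lt continuous_const continuous_abs

/-- Real and imaginary parts are admissible real tests. Complex tests are needed because Schwartz
functions are complex-valued. -/
lemma IsWeakDeriv.complex_test {v d : L2E} (h : IsWeakDeriv v d) {φ : ℝ → ℂ}
    (hφ : ContDiff ℝ ∞ φ) (hc : HasCompactSupport φ) (hs : tsupport φ ⊆ freeSurface) :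
    ∫ x, deriv φ x * v x ∂surfaceMeasure = -∫ x, φ x * d x ∂surfaceMeasure := by
  have hd : ∀ x, HasDerivAt φ (deriv φ x) x := fun x =>
    (hφ.differentiable (by simp) x).hasDerivAt
  have key : ∀ L : ℂ →L[ℝ] ℝ, ∫ x, L (deriv φ x) • v x ∂surfaceMeasure
      = -∫ x, L (φ x) • d x ∂surfaceMeasure := by
    intro L
    have h1 := h (fun x => L (φ x)) (L.contDiff.comp hφ) (hc.comp_left (map_zero L))
      ((closure_mono (fun x hx => by
        rw [Function.mem_support] at hx ⊢
        intro h0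
        rw [h0, map_zero] at hx
        exact hx rfl)).trans hs)
    have h2 : ∀ x, deriv (fun x => L (φ x)) x = L (deriv φ x) := fun x =>
      (L.hasFDerivAt.comp_hasDerivAt x (hd x)).deriv
    simp_rw [h2] at h1
    exact h1
  have hdc : Continuous (deriv φ) := hφ.continuous_deriv (by simp)
  have split : ∀ (ψ : ℝ → ℂ) (u : L2E), Continuous ψ → HasCompactSupport ψ →
      ∫ x, ψ x * u x ∂surfaceMeasure = ∫ x, Complex.reCLM (ψ x) • u x ∂surfaceMeasure +
        Complex.I * ∫ x, Complex.imCLM (ψ x) • u x ∂surfaceMeasure := by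
    intro ψ u hψ hψc
    have i1 : Integrable (fun x => Complex.reCLM (ψ x) • u x) surfaceMeasure :=
      integrable_bdd_smul (Complex.reCLM.continuous.comp hψ) (hψc.comp_left (map_zero _)) u
    have i2 : Integrable (fun x => Complex.imCLM (ψ x) • u x) surfaceMeasure :=
      integrable_bdd_smul (Complex.imCLM.continuous.comp hψ) (hψc.comp_left (map_zero _)) u
    rw [← integral_const_mul, ← integral_add i1 (i2.const_mul _)]
    congr 1
    ext x
    conv_lhs => rw [← Complex.re_add_im (ψ x)]
    simp only [Complex.reCLM_apply, Complex.imCLM_apply, Complex.real_smul]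
    ring
  rw [split _ _ hdc hc.deriv, split _ _ hφ.continuous hc, key, key]
  ring

/-! ### Cut-off functions -/

lemma deriv_smoothTransition_eq_zero {t : ℝ} (ht : t < 0 ∨ 1 < t) :
    deriv Real.smoothTransition t = 0 := by
  rcases ht with ht | ht
  · have : Real.smoothTransition =ᶠ[𝓝 t] fun _ => 0 := by
      filter_upwards [Iio_mem_nhds ht] with x hx
      exact Real.smoothTransition.zero_of_nonpos (le_of_lt hx)
    rw [this.deriv_eq, deriv_const]
  · have : Real.smoothTransition =ᶠ[𝓝 t] fun _ => 1 := by
      filter_upwards [Ioi_mem_nhds ht] with x hx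
      exact Real.smoothTransition.one_of_one_le (le_of_lt hx)
    rw [this.deriv_eq, deriv_const]

lemma contDiff_smoothTransition : ContDiff ℝ ∞ Real.smoothTransition :=
  Real.smoothTransition.contDiff

lemma exists_deriv_smoothTransition_bound :
    ∃ M : ℝ, 0 ≤ M ∧ ∀ t, |deriv Real.smoothTransition t| ≤ M := by
  have hc : Continuous (deriv Real.smoothTransition) :=
    contDiff_smoothTransition.continuous_deriv (by simp)
  have hs : HasCompactSupport (deriv Real.smoothTransition) := by
    refine HasCompactSupport.intro (isCompact_Icc (a := (0 : ℝ)) (b := 1)) fun t ht => ?_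
    refine deriv_smoothTransition_eq_zero ?_
    by_contra hcon
    push Not at hcon
    exact ht ⟨hcon.1, hcon.2⟩
  obtain ⟨M, hM⟩ := hs.exists_bound_of_continuous hc
  exact ⟨M, (norm_nonneg _).trans (hM 0), hM⟩

lemma hasDerivAt_smoothTransition (t : ℝ) :
    HasDerivAt Real.smoothTransition (deriv Real.smoothTransition t) t :=
  (contDiff_smoothTransition.differentiable (by simp) t).hasDerivAt

/-- A smooth cut-off near the end points of the free surface. -/
noncomputable def innerCut (n x : ℝ) : ℝ := Real.smoothTransition (n * (x ^ 2 - 1) - 1)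

/-- A smooth cut-off near infinity. -/
noncomputable def outerCut (n x : ℝ) : ℝ := Real.smoothTransition (2 - x ^ 2 / n)

lemma contDiff_innerCut (n : ℝ) : ContDiff ℝ ∞ (innerCut n) :=
  contDiff_smoothTransition.comp (by fun_prop)

lemma contDiff_outerCut (n : ℝ) : ContDiff ℝ ∞ (outerCut n) :=
  contDiff_smoothTransition.comp (by fun_prop)

lemma hasDerivAt_innerCut (n x : ℝ) : HasDerivAt (innerCut n)
    (deriv Real.smoothTransition (n * (x ^ 2 - 1) - 1) * (n * (2 * x))) x := by
  have h : HasDerivAt (fun x : ℝ => n * (x ^ 2 - 1) - 1) (n * (2 * x)) x := by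
    have := (((hasDerivAt_pow 2 x).sub_const 1).const_mul n).sub_const 1
    simpa using this
  exact (hasDerivAt_smoothTransition _).comp x h

lemma hasDerivAt_outerCut (n x : ℝ) : HasDerivAt (outerCut n)
    (deriv Real.smoothTransition (2 - x ^ 2 / n) * (-(2 * x / n))) x := by
  have h : HasDerivAt (fun x : ℝ => 2 - x ^ 2 / n) (-(2 * x / n)) x := by
    have := ((hasDerivAt_pow 2 x).div_const n).const_sub 2
    simpa using this
  exact (hasDerivAt_smoothTransition _).comp x h

lemma innerCut_nonneg (n x : ℝ) : 0 ≤ innerCut n x := Real.smoothTransition.nonneg _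
lemma innerCut_le_one (n x : ℝ) : innerCut n x ≤ 1 := Real.smoothTransition.le_one _
lemma outerCut_nonneg (n x : ℝ) : 0 ≤ outerCut n x := Real.smoothTransition.nonneg _
lemma outerCut_le_one (n x : ℝ) : outerCut n x ≤ 1 := Real.smoothTransition.le_one _

lemma innerCut_eventually {x : ℝ} (hx : 1 < |x|) :
    ∀ᶠ n : ℕ in atTop, innerCut n x = 1 ∧ deriv (innerCut n) x = 0 := by
  have hx2 : 0 < x ^ 2 - 1 := by
    have := sq_lt_sq' (by linarith) hx
    rw [sq_abs] at this
    linarith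
  have h : Tendsto (fun n : ℕ => (n : ℝ) * (x ^ 2 - 1)) atTop atTop :=
    tendsto_natCast_atTop_atTop.atTop_mul_const hx2
  filter_upwards [h.eventually_gt_atTop 2] with n hn
  refine ⟨Real.smoothTransition.one_of_one_le (by linarith), ?_⟩
  rw [(hasDerivAt_innerCut n x).deriv, deriv_smoothTransition_eq_zero (Or.inr (by linarith)),
    zero_mul]

lemma outerCut_eventually (x : ℝ) :
    ∀ᶠ n : ℕ in atTop, outerCut n x = 1 ∧ deriv (outerCut n) x = 0 := by
  have h : Tendsto (fun n : ℕ => x ^ 2 / (n : ℝ)) atTop (𝓝 0) :=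
    tendsto_const_div_atTop_nhds_zero_nat _
  filter_upwards [h.eventually_lt_const one_pos] with n hn
  refine ⟨Real.smoothTransition.one_of_one_le (by linarith), ?_⟩
  rw [(hasDerivAt_outerCut n x).deriv, deriv_smoothTransition_eq_zero (Or.inr (by linarith)),
    zero_mul]

/-- Where the derivative does not vanish, x² ≤ 2n, so 2|x|/n ≤ 4/|x|. The bound is uniform in n and
square integrable on the free surface. -/
lemma abs_deriv_outerCut_le {M : ℝ} (hM : ∀ t, |deriv Real.smoothTransition t| ≤ M) {n x : ℝ}
    (hn : 0 < n) (hx : 1 < |x|) : |deriv (outerCut n) x| ≤ 4 * M * |x|⁻¹ := by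
  have hM0 : 0 ≤ M := (abs_nonneg _).trans (hM 0)
  have hx0 : 0 < |x| := by linarith
  rw [(hasDerivAt_outerCut n x).deriv]
  by_cases h : 2 - x ^ 2 / n < 0
  · rw [deriv_smoothTransition_eq_zero (Or.inl h), zero_mul, abs_zero]
    positivity
  · have h1 : x ^ 2 / n ≤ 2 := by linarith
    rw [div_le_iff₀ hn, ← sq_abs] at h1
    have h2 : |-(2 * x / n)| ≤ 4 * |x|⁻¹ := by
      rw [abs_neg, abs_div, abs_mul, abs_two, abs_of_pos hn, div_le_iff₀ hn, mul_assoc,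
        inv_mul_eq_div, mul_div_assoc', le_div_iff₀ hx0]
      nlinarith
    rw [abs_mul]
    calc _ ≤ M * (4 * |x|⁻¹) := mul_le_mul (hM _) h2 (abs_nonneg _) hM0
      _ = _ := by ring

/-- Where the derivative does not vanish, n(|x|² - 1) ≤ 2. The growth of order n is compensated by
|x| - 1: since n(|x| - 1) ≤ 2 and |x|² ≤ 3, the constant is 2 · 2 · 3 = 12. -/
lemma abs_deriv_innerCut_mul_le {M : ℝ} (hM : ∀ t, |deriv Real.smoothTransition t| ≤ M)
    {n x : ℝ} (hn : 1 ≤ n) (hx : 1 < |x|) :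
    |deriv (innerCut n) x| * (|x| - 1) ≤ 12 * M * |x|⁻¹ := by
  have hM0 : 0 ≤ M := (abs_nonneg _).trans (hM 0)
  have hx0 : 0 < |x| := by linarith
  rw [(hasDerivAt_innerCut n x).deriv]
  by_cases h : 1 < n * (x ^ 2 - 1) - 1
  · rw [deriv_smoothTransition_eq_zero (Or.inr h), zero_mul, abs_zero, zero_mul]
    positivity
  · have h1 : n * (|x| ^ 2 - 1) ≤ 2 := by
      rw [sq_abs]
      linarith
    have h2 : n * (2 * |x|) * (|x| - 1) ≤ 12 * |x|⁻¹ := by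
      rw [← div_eq_mul_inv, le_div_iff₀ hx0]
      have h3 : n * (|x| - 1) ≤ 2 := by nlinarith
      have h4 : |x| ^ 2 ≤ 3 := by nlinarith
      nlinarith [mul_le_mul h3 h4 (by positivity) (by norm_num)]
    rw [abs_mul, abs_mul, abs_mul, abs_two, abs_of_pos (by linarith : 0 < n), mul_assoc]
    calc _ ≤ M * (12 * |x|⁻¹) := mul_le_mul (hM _) h2 (by
          have : 0 ≤ |x| - 1 := by linarith
          positivity) hM0
      _ = _ := by ring

lemma memLp_inv_abs : MemLp (fun x : ℝ => ((|x|⁻¹ : ℝ) : ℂ)) 2 surfaceMeasure := by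
  have hm : Measurable (fun x : ℝ => ((|x|⁻¹ : ℝ) : ℂ)) := by
    have : Measurable (fun x : ℝ => |x|) := measurable_norm
    fun_prop
  rw [memLp_iff_lintegral hm]
  have hint : Integrable (fun x : ℝ => 2 * (1 + x ^ 2)⁻¹) surfaceMeasure :=
    (integrable_inv_one_add_sq.const_mul 2).integrableOn
  refine lt_of_le_of_lt (lintegral_mono_ae ?_) hint.2
  filter_upwards [ae_restrict_mem measurableSet_freeSurface] with x hx
  have hx1 : 1 < |x| := hx
  rw [← ofReal_norm, ← ENNReal.ofReal_pow (norm_nonneg _), ← ofReal_norm]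
  refine ENNReal.ofReal_le_ofReal ?_
  have hx2 : 1 < x ^ 2 := by
    have := sq_lt_sq' (by linarith) hx1
    rw [sq_abs] at this
    linarith
  rw [Complex.norm_real, Real.norm_eq_abs, Real.norm_eq_abs, abs_inv, abs_abs,
    abs_of_nonneg (by positivity : 0 ≤ 2 * (1 + x ^ 2)⁻¹), inv_pow, sq_abs, ← div_eq_mul_inv,
    ← one_div, div_le_div_iff₀ (by positivity) (by positivity)]
  linarith

/-- Serves as the dominating function for the terms in which a cut-off is differentiated. -/
lemma integrable_inv_abs_mul (v : L2E) :
    Integrable (fun x => ((|x|⁻¹ : ℝ) : ℂ) * v x) surfaceMeasure :=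
  memLp_one_iff_integrable.1 ((Lp.memLp v).mul memLp_inv_abs)

/-! ### Integration by parts up to the end points -/

/-- Integration by parts against functions which vanish at the end points of the free surface but
whose support reaches them. -/
lemma IsWeakDeriv.integral_of_vanishing {v d : L2E} (h : IsWeakDeriv v d) {χ : ℝ → ℂ}
    (hχ : ContDiffOn ℝ ∞ χ freeSurface) {C : ℝ} (hC : ∀ x ∈ freeSurface, ‖χ x‖ ≤ C)
    (hC1 : ∀ x ∈ freeSurface, ‖χ x‖ ≤ C * (|x| - 1))
    (i1 : Integrable (fun x => deriv χ x * v x) surfaceMeasure)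
    (i2 : Integrable (fun x => χ x * d x) surfaceMeasure) :
    ∫ x, deriv χ x * v x ∂surfaceMeasure = -∫ x, χ x * d x ∂surfaceMeasure := by
  obtain ⟨M, hM0, hM⟩ := exists_deriv_smoothTransition_bound
  have hC0 : 0 ≤ C := (norm_nonneg _).trans (hC 2 (by change (1 : ℝ) < |2|; norm_num))
  have hvm := measurable_L2E v
  have hdm := measurable_L2E d
  set θ : ℕ → ℝ → ℝ := fun n x => innerCut n x * outerCut n x with hθ
  have hθd : ∀ n x, HasDerivAt (θ n)
      (deriv (innerCut n) x * outerCut n x + innerCut n x * deriv (outerCut n) x) x := by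
    intro n x
    have h1 := hasDerivAt_innerCut n x
    have h2 := hasDerivAt_outerCut n x
    rw [h1.deriv, h2.deriv]
    exact h1.mul h2
  have hθs : ∀ n, ContDiff ℝ ∞ (θ n) := fun n => (contDiff_innerCut n).mul (contDiff_outerCut n)
  have hθ1 : ∀ n x, |θ n x| ≤ 1 := by
    intro n x
    rw [abs_of_nonneg (mul_nonneg (innerCut_nonneg _ _) (outerCut_nonneg _ _))]
    exact mul_le_one₀ (innerCut_le_one _ _) (outerCut_nonneg _ _) (outerCut_le_one _ _)
  have hE : ∀ᵐ x ∂surfaceMeasure, x ∈ freeSurface := ae_restrict_mem measurableSet_freeSurface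
  have hχd : ∀ x ∈ freeSurface, HasDerivAt χ (deriv χ x) x := fun x hx =>
    ((hχ.differentiableOn (by simp)).differentiableAt
      (isOpen_freeSurface.mem_nhds hx)).hasDerivAt
  have hχm : AEStronglyMeasurable χ surfaceMeasure :=
    hχ.continuousOn.aestronglyMeasurable measurableSet_freeSurface
  -- the identity for the truncated test functions
  have hn : ∀ n : ℕ, 1 ≤ n →
      ∫ x, ((θ n x : ℂ) * (deriv χ x * v x) + χ x * ((deriv (θ n) x : ℝ) : ℂ) * v x) ∂surfaceMeasure
        = -∫ x, (θ n x : ℂ) * (χ x * d x) ∂surfaceMeasure := by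
    intro n hn
    have hn0 : (1 : ℝ) ≤ n := by exact_mod_cast hn
    have hn1 : (0 : ℝ) < n := by linarith
    -- The set outside which `θ n` vanishes: `innerCut` is zero for x² ≤ 1 + 1/n and `outerCut` for
    -- x² ≥ 2n. It is compact inside the free surface, so θχ is an admissible test.
    set K : Set ℝ := {x | 1 + 1 / (n : ℝ) ≤ x ^ 2 ∧ x ^ 2 ≤ 2 * n} with hK
    have hKE : K ⊆ freeSurface := by
      intro x hx
      have h1 : 1 + 1 / (n : ℝ) ≤ x ^ 2 := hx.1
      have h2 : 0 < 1 / (n : ℝ) := by positivity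
      change 1 < |x|
      by_contra hcon
      push Not at hcon
      have := abs_le_one_iff_mul_self_le_one.1 hcon
      nlinarith
    have hKc : IsCompact K := by
      have hcl : IsClosed K := by
        have e : K = (fun x : ℝ => x ^ 2) ⁻¹' Set.Icc (1 + 1 / (n : ℝ)) (2 * n) := rfl
        rw [e]
        exact isClosed_Icc.preimage (by fun_prop)
      refine (isCompact_Icc (a := -(2 * (n : ℝ))) (b := 2 * n)).of_isClosed_subset hcl ?_
      intro x hx
      have h1 : x ^ 2 ≤ 2 * n := hx.2
      exact abs_le.1 (abs_le_of_sq_le_sq (by nlinarith) (by positivity))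
    have hθK : ∀ x, x ∉ K → θ n x = 0 := by
      intro x hx
      by_cases h1 : 1 + 1 / (n : ℝ) ≤ x ^ 2
      · have h2 : 2 * (n : ℝ) < x ^ 2 := by
          by_contra hcon
          exact hx ⟨h1, not_lt.1 hcon⟩
        have h3 : outerCut n x = 0 := Real.smoothTransition.zero_of_nonpos (by
          rw [sub_nonpos, le_div_iff₀ hn1]
          exact h2.le)
        simp only [hθ, h3, mul_zero]
      · have h3 : innerCut n x = 0 := Real.smoothTransition.zero_of_nonpos (by
          push Not at h1
          have h4 := mul_lt_mul_of_pos_left h1 hn1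
          have h5 : (n : ℝ) * (1 + 1 / n) = n + 1 := by field_simp
          nlinarith)
        simp only [hθ, h3, zero_mul]
    set φ : ℝ → ℂ := fun x => (θ n x : ℂ) * χ x with hφ
    have hφK : ∀ x, x ∉ K → φ x = 0 := by
      intro x hx
      simp only [hφ, hθK x hx, Complex.ofReal_zero, zero_mul]
    have hφs : ContDiff ℝ ∞ φ := by
      rw [contDiff_iff_contDiffAt]
      intro x
      by_cases hx : x ∈ freeSurface
      · exact (Complex.ofRealCLM.contDiff.comp (hθs n)).contDiffAt.mul
          (hχ.contDiffAt (isOpen_freeSurface.mem_nhds hx))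
      · have : φ =ᶠ[𝓝 x] fun _ => 0 := by
          filter_upwards [hKc.isClosed.isOpen_compl.mem_nhds (fun h' => hx (hKE h'))] with y hy
          exact hφK y hy
        exact contDiffAt_const.congr_of_eventuallyEq this
    have ht := h.complex_test hφs (HasCompactSupport.intro hKc hφK)
      ((closure_minimal (fun x hx => by
        by_contra hcon
        exact hx (hφK x hcon)) hKc.isClosed).trans hKE)
    have e1 : ∫ x, deriv φ x * v x ∂surfaceMeasure = ∫ x, ((θ n x : ℂ) * (deriv χ x * v x)
        + χ x * ((deriv (θ n) x : ℝ) : ℂ) * v x) ∂surfaceMeasure := by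
      refine integral_congr_ae ?_
      filter_upwards [hE] with x hx
      have h1 : HasDerivAt (fun x => (θ n x : ℂ)) ((deriv (θ n) x : ℝ) : ℂ) x := by
        rw [(hθd n x).deriv]
        exact (hθd n x).ofReal_comp
      have h2 : HasDerivAt φ _ x := h1.mul (hχd x hx)
      rw [h2.deriv]
      ring
    rw [← e1, ht]
    congr 2
    ext x
    simp only [hφ, mul_assoc]
  -- limits
  have hθlim : ∀ x ∈ freeSurface, ∀ᶠ n : ℕ in atTop, θ n x = 1 ∧ deriv (θ n) x = 0 := by
    intro x hx
    filter_upwards [innerCut_eventually hx, outerCut_eventually x] with n h1 h2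
    rw [(hθd n x).deriv]
    simp only [hθ, h1.1, h1.2, h2.1, h2.2]
    norm_num
  have hθm : ∀ n, AEStronglyMeasurable (fun x => (θ n x : ℂ)) surfaceMeasure := fun n =>
    (Complex.continuous_ofReal.comp (hθs n).continuous).aestronglyMeasurable
  have hθm' : ∀ n, AEStronglyMeasurable (fun x => ((deriv (θ n) x : ℝ) : ℂ)) surfaceMeasure := fun n =>
    (Complex.continuous_ofReal.comp ((hθs n).continuous_deriv (by simp))).aestronglyMeasurable
  have l1 : Tendsto (fun n : ℕ => ∫ x, ((θ n x : ℂ) * (deriv χ x * v x)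
      + χ x * ((deriv (θ n) x : ℝ) : ℂ) * v x) ∂surfaceMeasure) atTop
      (𝓝 (∫ x, deriv χ x * v x ∂surfaceMeasure)) := by
    -- The constant 16 = 12 + 4 collects the bounds for the two cut-offs. The derivative of
    -- `innerCut` is of order n near the end points, and the hypothesis ‖χ‖ ≤ C(|x| - 1) is what
    -- absorbs it.
    refine tendsto_integral_filter_of_dominated_convergence
      (fun x => ‖deriv χ x * v x‖ + 16 * M * C * ‖((|x|⁻¹ : ℝ) : ℂ) * v x‖) ?_ ?_ ?_ ?_
    · exact Eventually.of_forall fun n => ((hθm n).mul i1.1).add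
        ((hχm.mul (hθm' n)).mul hvm.aestronglyMeasurable)
    · filter_upwards [eventually_ge_atTop 1] with n hn
      have hn0 : (1 : ℝ) ≤ n := by exact_mod_cast hn
      filter_upwards [hE] with x hx
      have hx1 : 1 < |x| := hx
      refine (norm_add_le _ _).trans (add_le_add ?_ ?_)
      · rw [norm_mul, Complex.norm_real]
        exact mul_le_of_le_one_left (norm_nonneg _) (hθ1 n x)
      · rw [norm_mul, norm_mul, norm_mul, Complex.norm_real, Complex.norm_real, ← mul_assoc]
        refine mul_le_mul_of_nonneg_right ?_ (norm_nonneg _)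
        rw [Real.norm_eq_abs, Real.norm_eq_abs, abs_inv, abs_abs, (hθd n x).deriv]
        have b1 := abs_deriv_innerCut_mul_le hM hn0 hx1
        have b2 := abs_deriv_outerCut_le hM (by linarith : (0 : ℝ) < n) hx1
        have b3 : |deriv (innerCut n) x * outerCut n x + innerCut n x * deriv (outerCut n) x|
            ≤ |deriv (innerCut n) x| + |deriv (outerCut n) x| := by
          refine (abs_add_le _ _).trans (add_le_add ?_ ?_)
          · rw [abs_mul, abs_of_nonneg (outerCut_nonneg _ _)]
            exact mul_le_of_le_one_right (abs_nonneg _) (outerCut_le_one _ _)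
          · rw [abs_mul, abs_of_nonneg (innerCut_nonneg _ _)]
            exact mul_le_of_le_one_left (abs_nonneg _) (innerCut_le_one _ _)
        calc ‖χ x‖ * |deriv (innerCut n) x * outerCut n x + innerCut n x * deriv (outerCut n) x|
            ≤ ‖χ x‖ * (|deriv (innerCut n) x| + |deriv (outerCut n) x|) :=
              mul_le_mul_of_nonneg_left b3 (norm_nonneg _)
          _ = ‖χ x‖ * |deriv (innerCut n) x| + ‖χ x‖ * |deriv (outerCut n) x| := by ring
          _ ≤ C * (|x| - 1) * |deriv (innerCut n) x| + C * |deriv (outerCut n) x| :=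
              add_le_add (mul_le_mul_of_nonneg_right (hC1 x hx) (abs_nonneg _))
                (mul_le_mul_of_nonneg_right (hC x hx) (abs_nonneg _))
          _ = C * (|deriv (innerCut n) x| * (|x| - 1)) + C * |deriv (outerCut n) x| := by ring
          _ ≤ C * (12 * M * |x|⁻¹) + C * (4 * M * |x|⁻¹) :=
              add_le_add (mul_le_mul_of_nonneg_left b1 hC0) (mul_le_mul_of_nonneg_left b2 hC0)
          _ = _ := by ring
    · exact i1.norm.add ((integrable_inv_abs_mul v).norm.const_mul _)
    · filter_upwards [hE] with x hx
      refine tendsto_const_nhds.congr' ?_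
      filter_upwards [hθlim x hx] with n hn
      simp [hn.1, hn.2]
  have l2 : Tendsto (fun n : ℕ => ∫ x, (θ n x : ℂ) * (χ x * d x) ∂surfaceMeasure) atTop
      (𝓝 (∫ x, χ x * d x ∂surfaceMeasure)) := by
    refine tendsto_integral_filter_of_dominated_convergence (fun x => ‖χ x * d x‖) ?_ ?_ i2.norm ?_
    · exact Eventually.of_forall fun n => (hθm n).mul i2.1
    · refine Eventually.of_forall fun n => Eventually.of_forall fun x => ?_
      rw [norm_mul, Complex.norm_real]
      exact mul_le_of_le_one_left (norm_nonneg _) (hθ1 n x)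
    · filter_upwards [hE] with x hx
      refine tendsto_const_nhds.congr' ?_
      filter_upwards [hθlim x hx] with n hn
      simp [hn.1]
  refine tendsto_nhds_unique (l1.congr' ?_) l2.neg
  filter_upwards [eventually_ge_atTop 1] with n h1
  exact hn n h1

/-! ### Weak derivatives of even extensions -/

lemma integrable_schwartz_mul (ψ : SchwartzMap ℝ ℂ) (f : L2R) :
    Integrable (fun x => ψ x * f x) :=
  memLp_one_iff_integrable.1 ((Lp.memLp f).mul (ψ.memLp 2))

lemma integrable_deriv_schwartz_mul (ψ : SchwartzMap ℝ ℂ) (f : L2R) :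
    Integrable (fun x => deriv ψ x * f x) :=
  integrable_schwartz_mul (SchwartzMap.derivCLM ℂ ℂ ψ) f

lemma schwartz_bound (ψ : SchwartzMap ℝ ℂ) :
    ∃ C : ℝ, 0 ≤ C ∧ (∀ x, ‖ψ x‖ ≤ C) ∧ ∀ x y, ‖ψ x - ψ y‖ ≤ C * |x - y| := by
  have hb : ∀ φ : SchwartzMap ℝ ℂ, ∃ C : ℝ, 0 ≤ C ∧ ∀ x, ‖φ x‖ ≤ C := by
    intro φ
    obtain ⟨C, hC0, hC⟩ := φ.decay 0 0
    exact ⟨C, hC0.le, fun x => by simpa using hC x⟩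
  obtain ⟨A, hA0, hA⟩ := hb ψ
  obtain ⟨B, hB0, hB⟩ := hb (SchwartzMap.derivCLM ℂ ℂ ψ)
  refine ⟨A + B, by positivity, fun x => (hA x).trans (by linarith), fun x y => ?_⟩
  have h := Convex.norm_image_sub_le_of_norm_deriv_le (f := ψ) (C := B) (s := Set.univ)
    (fun z _ => ψ.differentiable z) (fun z _ => hB z) convex_univ (Set.mem_univ y) (Set.mem_univ x)
  rw [Real.norm_eq_abs] at h
  exact h.trans (mul_le_mul_of_nonneg_right (by linarith) (abs_nonneg _))

lemma sg_toSurface (b : Bool) (s : ℝ) : sg b * toSurface b s = 1 + s := by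
  rw [toSurface, ← mul_assoc, sg_mul_sg, one_mul]

lemma sg_toSurface_not (b : Bool) (s : ℝ) : sg (!b) * toSurface b s = -(1 + s) := by
  cases b <;> simp [toSurface, sg]

/-- The odd combination of a test function, transported to a component of the free surface. -/
noncomputable def oddTest (ψ : ℝ → ℂ) (b : Bool) (y : ℝ) : ℂ :=
  if 0 < sg b * y then ψ (sg b * y - 1) - ψ (1 - sg b * y) else 0

lemma oddTest_eventuallyEq (ψ : ℝ → ℂ) {b : Bool} {y : ℝ} (hy : 0 < sg b * y) :
    oddTest ψ b =ᶠ[𝓝 y] fun y => ψ (sg b * y - 1) - ψ (1 - sg b * y) := by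
  have : ∀ᶠ z in 𝓝 y, 0 < sg b * z :=
    (continuous_const_mul (sg b)).continuousAt.eventually (lt_mem_nhds hy)
  filter_upwards [this] with z hz
  rw [oddTest, if_pos hz]

lemma oddTest_eventuallyEq_zero (ψ : ℝ → ℂ) {b : Bool} {y : ℝ} (hy : sg b * y < 0) :
    oddTest ψ b =ᶠ[𝓝 y] fun _ => 0 := by
  have : ∀ᶠ z in 𝓝 y, sg b * z < 0 :=
    (continuous_const_mul (sg b)).continuousAt.eventually (gt_mem_nhds hy)
  filter_upwards [this] with z hz
  rw [oddTest, if_neg (not_lt.2 hz.le)]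

lemma sg_mul_cases {y : ℝ} (hy : y ∈ freeSurface) (b : Bool) :
    (0 < sg b * y ∧ sg b * y = |y|) ∨ sg b * y < 0 := by
  have h1 : 1 < |y| := hy
  have h2 : |sg b * y| = |y| := by rw [abs_mul, abs_sg, one_mul]
  rcases lt_or_ge (sg b * y) 0 with h | h
  · exact Or.inr h
  · rw [abs_of_nonneg h] at h2
    exact Or.inl ⟨by linarith, h2⟩

/-- The odd combination ψ(s) - ψ(-s) vanishes at s = 0, so its transport `oddTest` is admissible in
`IsWeakDeriv.integral_of_vanishing` and no trace of v at the end point appears. The factor `sg b` is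
the derivative of `toSurface b`. -/
lemma IsWeakDeriv.integral_evenExt {v d : L2E} (h : IsWeakDeriv v d) (b : Bool)
    (ψ : SchwartzMap ℝ ℂ) :
    ∫ s, (deriv ψ s + deriv ψ (-s)) * v (toSurface b s) ∂posMeasure =
      -∫ s, sg b * (ψ s - ψ (-s)) * d (toSurface b s) ∂posMeasure := by
  obtain ⟨C, hC0, hC1, hC2⟩ := schwartz_bound ψ
  have hψd : ∀ x, HasDerivAt ψ (deriv ψ x) x := ψ.hasDerivAt
  have hval : ∀ s : ℝ, 0 < s → oddTest ψ b (toSurface b s) = ψ s - ψ (-s) := by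
    intro s hs
    rw [oddTest, sg_toSurface, if_pos (by linarith)]
    congr 2 <;> ring
  have hval' : ∀ s : ℝ, 0 < s → oddTest ψ b (toSurface (!b) s) = 0 := by
    intro s hs
    have := sg_toSurface_not (!b) s
    rw [Bool.not_not] at this
    rw [oddTest, this, if_neg (by linarith)]
  have hder : ∀ s : ℝ, 0 < s → deriv (oddTest ψ b) (toSurface b s)
      = sg b * (deriv ψ s + deriv ψ (-s)) := by
    intro s hs
    have hpos : 0 < sg b * toSurface b s := by
      rw [sg_toSurface]
      linarith
    rw [(oddTest_eventuallyEq ψ hpos).deriv_eq]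
    have a1 : HasDerivAt (fun y : ℝ => sg b * y - 1) (sg b) (toSurface b s) := by
      simpa using ((hasDerivAt_id (toSurface b s)).const_mul (sg b)).sub_const 1
    have a2 : HasDerivAt (fun y : ℝ => 1 - sg b * y) (-sg b) (toSurface b s) := by
      simpa using ((hasDerivAt_id (toSurface b s)).const_mul (sg b)).const_sub 1
    have b1 := (hψd (sg b * toSurface b s - 1)).scomp (toSurface b s) a1
    have b2 := (hψd (1 - sg b * toSurface b s)).scomp (toSurface b s) a2
    have b3 : HasDerivAt (fun y => ψ (sg b * y - 1) - ψ (1 - sg b * y)) _ (toSurface b s) :=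
      b1.sub b2
    rw [b3.deriv, sg_toSurface, show 1 + s - 1 = s by ring, show 1 - (1 + s) = -s by ring,
      Complex.real_smul, Complex.real_smul]
    push_cast
    ring
  have hder' : ∀ s : ℝ, 0 < s → deriv (oddTest ψ b) (toSurface (!b) s) = 0 := by
    intro s hs
    have hneg : sg b * toSurface (!b) s < 0 := by
      have := sg_toSurface_not (!b) s
      rw [Bool.not_not] at this
      rw [this]
      linarith
    rw [(oddTest_eventuallyEq_zero ψ hneg).deriv_eq, deriv_const]
  have hcd : ContDiffOn ℝ ∞ (oddTest ψ b) freeSurface := by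
    intro y hy
    refine ContDiffAt.contDiffWithinAt ?_
    rcases sg_mul_cases hy b with ⟨h1, -⟩ | h1
    · refine ContDiffAt.congr_of_eventuallyEq ?_ (oddTest_eventuallyEq ψ h1)
      have hs : ContDiff ℝ ∞ ψ := ψ.smooth ⊤
      have hs1 : ContDiff ℝ ∞ (fun y : ℝ => ψ (sg b * y - 1)) := hs.comp (by fun_prop)
      have hs2 : ContDiff ℝ ∞ (fun y : ℝ => ψ (1 - sg b * y)) := hs.comp (by fun_prop)
      exact (hs1.sub hs2).contDiffAt
    · exact contDiffAt_const.congr_of_eventuallyEq (oddTest_eventuallyEq_zero ψ h1)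
  have hi : ∀ (F : SchwartzMap ℝ ℂ) (u : L2E),
      Integrable (fun s => F s * u (toSurface b s)) posMeasure ∧
      Integrable (fun s => F (-s) * u (toSurface b s)) posMeasure := by
    intro F u
    have h1 := integrable_line_iff.1 (integrable_schwartz_mul F (evenExt b u))
    have h2 := ae_line_iff.1 (coeFn_evenExt b u)
    constructor
    · refine h1.1.congr ?_
      filter_upwards [h2.1, ae_pos] with s e1 e2
      rw [e1, abs_of_pos e2]
    · refine h1.2.congr ?_
      filter_upwards [h2.2, ae_pos] with s e1 e2
      rw [e1, abs_neg, abs_of_pos e2]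
  have j1 : Integrable (fun x => deriv (oddTest ψ b) x * v x) surfaceMeasure := by
    rw [integrable_surface_iff]
    intro c
    by_cases hc : c = b
    · rw [hc]
      obtain ⟨k1, k2⟩ := hi (SchwartzMap.derivCLM ℂ ℂ ψ) v
      refine ((k1.add k2).const_mul (sg b : ℂ)).congr ?_
      filter_upwards [ae_pos] with s hs
      rw [hder s hs]
      simp only [Pi.add_apply, SchwartzMap.derivCLM_apply]
      ring
    · have hc' : c = !b := by cases b <;> cases c <;> simp_all
      rw [hc']
      refine (integrable_zero ℝ ℂ posMeasure).congr ?_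
      filter_upwards [ae_pos] with s hs
      rw [hder' s hs, zero_mul]
      rfl
  have j2 : Integrable (fun x => oddTest ψ b x * d x) surfaceMeasure := by
    rw [integrable_surface_iff]
    intro c
    by_cases hc : c = b
    · rw [hc]
      obtain ⟨k1, k2⟩ := hi ψ d
      refine (k1.sub k2).congr ?_
      filter_upwards [ae_pos] with s hs
      rw [hval s hs]
      simp only [Pi.sub_apply]
      ring
    · have hc' : c = !b := by cases b <;> cases c <;> simp_all
      rw [hc']
      refine (integrable_zero ℝ ℂ posMeasure).congr ?_
      filter_upwards [ae_pos] with s hs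
      rw [hval' s hs, zero_mul]
      rfl
  -- On the component in question ψ is evaluated at ±(|y| - 1), two points at distance 2(|y| - 1);
  -- this accounts for the constant 2C.
  have main := h.integral_of_vanishing hcd (C := 2 * C) ?_ ?_ j1 j2
  · have split : ∀ F : ℝ → ℂ, Integrable F surfaceMeasure →
        (∀ s : ℝ, 0 < s → F (toSurface (!b) s) = 0) →
        ∫ x, F x ∂surfaceMeasure = ∫ s, F (toSurface b s) ∂posMeasure := by
      intro F hF h0
      have hz : ∫ s, F (toSurface (!b) s) ∂posMeasure = 0 := by
        rw [integral_eq_zero_of_ae]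
        filter_upwards [ae_pos] with s hs
        exact h0 s hs
      rw [integral_surface hF]
      cases b
      · rw [Bool.not_false] at hz
        rw [hz, zero_add]
      · rw [Bool.not_true] at hz
        rw [hz, add_zero]
    rw [split _ j1 (fun s hs => by rw [hder' s hs, zero_mul]),
      split _ j2 (fun s hs => by rw [hval' s hs, zero_mul])] at main
    have hsg : ((sg b : ℝ) : ℂ) * (sg b : ℂ) = 1 := by
      rw [← Complex.ofReal_mul, sg_mul_sg, Complex.ofReal_one]
    calc ∫ s, (deriv ψ s + deriv ψ (-s)) * v (toSurface b s) ∂posMeasure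
        = sg b * ∫ s, deriv (oddTest ψ b) (toSurface b s) * v (toSurface b s) ∂posMeasure := by
          rw [← integral_const_mul]
          refine integral_congr_ae ?_
          filter_upwards [ae_pos] with s hs
          rw [hder s hs, ← mul_assoc, ← mul_assoc, hsg, one_mul]
      _ = -(sg b * ∫ s, oddTest ψ b (toSurface b s) * d (toSurface b s) ∂posMeasure) := by
          rw [main]
          ring
      _ = _ := by
          rw [← integral_const_mul]
          congr 1
          refine integral_congr_ae ?_
          filter_upwards [ae_pos] with s hs
          rw [hval s hs, mul_assoc]
  · intro y hy
    rw [oddTest]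
    split_ifs
    · refine (norm_sub_le _ _).trans ?_
      linarith [hC1 (sg b * y - 1), hC1 (1 - sg b * y)]
    · rw [norm_zero]
      positivity
  · intro y hy
    have hy1 : 1 < |y| := hy
    rw [oddTest]
    split_ifs with h0
    · refine (hC2 _ _).trans (le_of_eq ?_)
      rcases sg_mul_cases hy b with ⟨-, h1⟩ | h1
      · rw [h1, abs_of_nonneg (by linarith)]
        ring
      · linarith
    · rw [norm_zero]
      have : 0 ≤ |y| - 1 := by linarith
      positivity

/-- The even extension of a `W^{1,2}` function is weakly differentiable across the origin. -/
lemma IsWeakDeriv.exists_evenExt {v d : L2E} (h : IsWeakDeriv v d) (b : Bool) :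
    ∃ D : L2R, IsLineWeakDeriv (evenExt b v) D ∧ ‖D‖ₑ = ‖evenExt b d‖ₑ := by
  -- The derivative of an even function is odd, hence the sign of x; `sg b` is the orientation of
  -- the component.
  set f : ℝ → ℂ := fun x => ((sg b * SignType.sign x : ℝ) : ℂ) * evenExt b d x with hf
  have hsign : ∀ x : ℝ, ‖((sg b * SignType.sign x : ℝ) : ℂ)‖ ≤ 1 := by
    intro x
    rw [Complex.norm_real, Real.norm_eq_abs, abs_mul, abs_sg, one_mul]
    rcases lt_trichotomy x 0 with hx | hx | hx <;> simp [hx]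
  have hmeas : Measurable f := by
    have h1 := measurable_L2R (evenExt b d)
    have h2 : Measurable (fun x : ℝ => ((SignType.sign x : SignType) : ℝ)) := by
      have e : (fun x : ℝ => ((SignType.sign x : SignType) : ℝ))
          = fun x => if 0 < x then 1 else if x < 0 then -1 else 0 := by
        ext x
        rcases lt_trichotomy x 0 with hx | hx | hx <;> simp [hx, not_lt.2 hx.le]
      rw [e]
      exact Measurable.ite measurableSet_Ioi measurable_const
        (Measurable.ite measurableSet_Iio measurable_const measurable_const)
    fun_prop
  have hml : MemLp f 2 := by
    refine (Lp.memLp (evenExt b d)).mono hmeas.aestronglyMeasurable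
      (Eventually.of_forall fun x => ?_)
    rw [hf, norm_mul]
    exact mul_le_of_le_one_left (norm_nonneg _) (hsign x)
  have h2 := ae_line_iff.1 (coeFn_evenExt b d)
  have hv := ae_line_iff.1 (coeFn_evenExt b v)
  set DD : L2R := hml.toLp f with hDD
  have hD := (ae_line_iff (p := fun x => DD x = f x)).1 hml.coeFn_toLp
  have hDp : ∀ᵐ s ∂posMeasure, DD s = (sg b : ℂ) * d (toSurface b s) := by
    filter_upwards [h2.1, hD.1, ae_pos] with s e1 e2 e3
    rw [e2, hf]
    simp [e1, abs_of_pos e3, sign_pos e3]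
  have hDn : ∀ᵐ s ∂posMeasure, DD (-s) = -((sg b : ℂ) * d (toSurface b s)) := by
    filter_upwards [h2.2, hD.2, ae_pos] with s e1 e2 e3
    rw [e2, hf]
    simp [e1, abs_of_pos e3, Left.sign_neg, sign_pos e3]
  have hsge : ‖((sg b : ℝ) : ℂ)‖ₑ = 1 := by
    rw [← ofReal_norm, Complex.norm_real, Real.norm_eq_abs, abs_sg, ENNReal.ofReal_one]
  refine ⟨DD, ?_, ?_⟩
  · intro ψ
    rw [integral_line (integrable_deriv_schwartz_mul ψ _),
      integral_line (integrable_schwartz_mul ψ _)]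
    have k1 := integrable_line_iff.1 (integrable_deriv_schwartz_mul ψ (evenExt b v))
    have k2 := integrable_line_iff.1 (integrable_schwartz_mul ψ DD)
    rw [← integral_add k1.1 k1.2, ← integral_add k2.1 k2.2]
    refine Eq.trans (integral_congr_ae ?_) ((h.integral_evenExt b ψ).trans (congrArg _
      (integral_congr_ae ?_)))
    · filter_upwards [hv.1, hv.2, ae_pos] with s e1 e2 e3
      rw [e1, e2, abs_neg, abs_of_pos e3]
      ring
    · filter_upwards [hDp, hDn] with s e1 e2
      rw [e1, e2]
      ring
  · have : ‖DD‖ₑ ^ 2 = ‖evenExt b d‖ₑ ^ 2 := by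
      rw [enorm_evenExt, ← lintegral_enorm_sq, lintegral_line, two_mul]
      congr 1 <;> refine lintegral_congr_ae ?_
      · filter_upwards [hDp] with s e1
        rw [e1, enorm_mul, hsge, one_mul]
      · filter_upwards [hDn] with s e1
        rw [e1, enorm_neg, enorm_mul, hsge, one_mul]
    exact (ENNReal.pow_right_strictMono two_ne_zero).injective this

lemma IsWeakDeriv.energy_eq {v d : L2E} (h : IsWeakDeriv v d) :
    energy (fun ξ => ‖2 * Real.pi * ξ‖ₑ ^ 2) v = 2 * ‖d‖ₑ ^ 2 := by
  obtain ⟨D1, h1, e1⟩ := h.exists_evenExt true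
  obtain ⟨D2, h2, e2⟩ := h.exists_evenExt false
  have k1 := h1.lintegral_eq
  have k2 := h2.lintegral_eq
  rw [energy, ← enorm_evenExt_add, ← e1, ← e2, ← k1, ← k2]
  rfl

/-- The restriction of a test function to a component of the free surface, on the line. -/
noncomputable def halfTest (φ : ℝ → ℝ) (b : Bool) (x : ℝ) : ℝ :=
  if 0 < x then φ (toSurface b x) else 0

lemma halfTest_eventuallyEq_zero {φ : ℝ → ℝ} (hs : tsupport φ ⊆ freeSurface) (b : Bool) {x : ℝ}
    (hx : x ≤ 0) : halfTest φ b =ᶠ[𝓝 x] fun _ => 0 := by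
  rcases hx.lt_or_eq with h | h
  · filter_upwards [Iio_mem_nhds h] with z hz
    rw [halfTest, if_neg (not_lt.2 (Set.mem_Iio.1 hz).le)]
  · have h1 : toSurface b x ∉ tsupport φ := by
      intro hmem
      have h2 : 1 < |toSurface b x| := hs hmem
      rw [toSurface, h, abs_mul, abs_sg] at h2
      norm_num at h2
    have h3 : ∀ᶠ z in 𝓝 x, toSurface b z ∈ (tsupport φ)ᶜ :=
      (continuous_toSurface b).continuousAt.eventually
        ((isClosed_tsupport φ).isOpen_compl.mem_nhds h1)
    filter_upwards [h3] with z hz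
    rw [halfTest]
    split_ifs
    · exact image_eq_zero_of_notMem_tsupport hz
    · rfl

lemma halfTest_eventuallyEq (φ : ℝ → ℝ) (b : Bool) {x : ℝ} (hx : 0 < x) :
    halfTest φ b =ᶠ[𝓝 x] fun x => φ (toSurface b x) := by
  filter_upwards [Ioi_mem_nhds hx] with z hz
  rw [halfTest, if_pos (Set.mem_Ioi.1 hz)]

/-- A test function supported in the open free surface, restricted to one component and extended by
zero, is a test function on the line that vanishes for s ≤ 0. Only the values of `D b` on the
positive half-line are seen. -/
lemma isWeakDeriv_of_evenExt {v d : L2E} {D : Bool → L2R}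
    (hD : ∀ b, IsLineWeakDeriv (evenExt b v) (D b))
    (hd : ∀ b, ∀ᵐ s ∂posMeasure, d (toSurface b s) = sg b * D b s) : IsWeakDeriv v d := by
  intro φ hφ hc hs
  have hφd : ∀ x, HasDerivAt φ (deriv φ x) x := fun x =>
    (hφ.differentiable (by simp) x).hasDerivAt
  have hts : ∀ b, ContDiff ℝ ∞ (toSurface b) := fun b => by
    unfold toSurface
    fun_prop
  have hb : ∀ b, ∫ s, deriv φ (toSurface b s) • v (toSurface b s) ∂posMeasure
      = -∫ s, φ (toSurface b s) • d (toSurface b s) ∂posMeasure := by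
    intro b
    have hsm : ContDiff ℝ ∞ (halfTest φ b) := by
      rw [contDiff_iff_contDiffAt]
      intro x
      rcases le_or_gt x 0 with hx | hx
      · exact contDiffAt_const.congr_of_eventuallyEq (halfTest_eventuallyEq_zero hs b hx)
      · exact (hφ.comp (hts b)).contDiffAt.congr_of_eventuallyEq (halfTest_eventuallyEq φ b hx)
    have hcs : HasCompactSupport (halfTest φ b) := by
      obtain ⟨R, hR⟩ := hc.isCompact.isBounded.exists_norm_le
      refine HasCompactSupport.intro (isCompact_Icc (a := 0) (b := R)) fun x hx => ?_
      rw [halfTest]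
      split_ifs with h0
      · refine image_eq_zero_of_notMem_tsupport fun hmem => hx ⟨h0.le, ?_⟩
        have := hR _ hmem
        rw [Real.norm_eq_abs, abs_toSurface h0] at this
        linarith
      · rfl
    obtain ⟨ψ, hψ⟩ := exists_schwartz_mul hsm hcs (m := fun _ => 1) contDiff_const
    have hψ' : ∀ x, ψ x = (halfTest φ b x : ℂ) := fun x => by rw [hψ, one_mul]
    have hψd : ∀ s : ℝ, 0 < s → deriv ψ s = sg b * deriv φ (toSurface b s) := by
      intro s hs0
      have e : (ψ : ℝ → ℂ) =ᶠ[𝓝 s] fun x => (φ (toSurface b x) : ℂ) := by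
        filter_upwards [halfTest_eventuallyEq φ b hs0] with z hz
        rw [hψ', hz]
      rw [e.deriv_eq]
      have h1 : HasDerivAt (toSurface b) (sg b) s := by
        have := ((hasDerivAt_id s).const_add 1).const_mul (sg b)
        rw [mul_one] at this
        exact this
      have h2 := ((hφd (toSurface b s)).comp s h1).ofReal_comp
      rw [show (fun x => (φ (toSurface b x) : ℂ)) = fun y => ((φ ∘ toSurface b) y : ℂ) from rfl,
        h2.deriv]
      push_cast
      ring
    have hψ0 : ∀ s : ℝ, 0 < s → ψ (-s) = 0 ∧ deriv ψ (-s) = 0 := by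
      intro s hs0
      have e : (ψ : ℝ → ℂ) =ᶠ[𝓝 (-s)] fun _ => 0 := by
        filter_upwards [halfTest_eventuallyEq_zero hs b (by linarith : -s ≤ 0)] with z hz
        rw [hψ', hz, Complex.ofReal_zero]
      exact ⟨e.eq_of_nhds, by rw [e.deriv_eq, deriv_const]⟩
    have main := hD b ψ
    rw [integral_line (integrable_deriv_schwartz_mul ψ _),
      integral_line (integrable_schwartz_mul ψ _)] at main
    have z1 : ∫ s, deriv ψ (-s) * evenExt b v (-s) ∂posMeasure = 0 := by
      refine integral_eq_zero_of_ae ?_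
      filter_upwards [ae_pos] with s hs0
      rw [(hψ0 s hs0).2, zero_mul, Pi.zero_apply]
    have z2 : ∫ s, ψ (-s) * D b (-s) ∂posMeasure = 0 := by
      refine integral_eq_zero_of_ae ?_
      filter_upwards [ae_pos] with s hs0
      rw [(hψ0 s hs0).1, zero_mul, Pi.zero_apply]
    rw [z1, z2, add_zero, add_zero] at main
    have hsg : ((sg b : ℝ) : ℂ) * (sg b : ℂ) = 1 := by
      rw [← Complex.ofReal_mul, sg_mul_sg, Complex.ofReal_one]
    calc ∫ s, deriv φ (toSurface b s) • v (toSurface b s) ∂posMeasure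
        = sg b * ∫ s, deriv ψ s * evenExt b v s ∂posMeasure := by
          rw [← integral_const_mul]
          refine integral_congr_ae ?_
          filter_upwards [ae_pos, coeFn_evenExt_pos b v] with s hs0 e1
          rw [hψd s hs0, e1, Complex.real_smul, ← mul_assoc, ← mul_assoc, hsg, one_mul]
      _ = -(sg b * ∫ s, ψ s * D b s ∂posMeasure) := by
          rw [main]
          ring
      _ = _ := by
          rw [← integral_const_mul]
          congr 1
          refine integral_congr_ae ?_
          filter_upwards [ae_pos, hd b] with s hs0 e1
          rw [hψ', e1, halfTest, if_pos hs0, Complex.real_smul]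
          ring
  have i1 := integrable_bdd_smul (hφ.continuous_deriv (by simp)) hc.deriv v
  have i2 := integrable_bdd_smul hφ.continuous hc d
  rw [integral_surface i1, integral_surface i2, hb, hb]
  ring

lemma energy_ne_top_iff {m : ℝ → ℝ≥0∞} {v : L2E} :
    energy m v ≠ ⊤ ↔ ∀ b, ∫⁻ ξ, m ξ * ‖spec b v ξ‖ₑ ^ 2 ≠ ⊤ := by
  rw [energy, ENNReal.add_ne_top, Bool.forall_bool, and_comm]

/-- Spectral characterization of `W^{1,2}`. -/
lemma mem_sobolevOne_iff {v : L2E} :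
    v ∈ sobolevOne ↔ energy (fun ξ => ‖2 * Real.pi * ξ‖ₑ ^ 2) v ≠ ⊤ := by
  constructor
  · rintro ⟨d, hd⟩
    rw [hd.energy_eq]
    finiteness
  · intro h
    rw [energy_ne_top_iff] at h
    choose D hD using fun b => exists_isLineWeakDeriv (h b)
    obtain ⟨d, hd⟩ := exists_glue (fun b => (sg b : ℂ) • D b)
    refine ⟨d, isWeakDeriv_of_evenExt hD fun b => ?_⟩
    filter_upwards [hd b, ae_restrict_of_ae (Lp.coeFn_smul (sg b : ℂ) (D b))] with s e1 e2
    rw [e1, e2]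
    rfl

/-! ### Inversion -/

lemma image_inv_freeSurface : (fun x : ℝ => x⁻¹) '' freeSurface = freeSurfaceᶜ \ ({0, 1, -1} : Set ℝ) := by
  ext x
  constructor
  · rintro ⟨y, hy, rfl⟩
    have hy1 : 1 < |y| := hy
    have h2 : |y⁻¹| < 1 := by
      rw [abs_inv]
      exact inv_lt_one_of_one_lt₀ hy1
    refine ⟨fun h => lt_asymm (show 1 < |y⁻¹| from h) h2, ?_⟩
    rintro (h | h | h)
    · have h0 : y = 0 := inv_eq_zero.1 h
      rw [h0] at hy1
      norm_num at hy1
    · have h0 : y⁻¹ = 1 := h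
      rw [h0] at h2
      norm_num at h2
    · have h0 : y⁻¹ = -1 := h
      rw [h0] at h2
      norm_num at h2
  · rintro ⟨h1, h2⟩
    have h3 : |x| ≤ 1 := not_lt.1 h1
    have h4 : x ≠ 0 := fun h => h2 (Or.inl h)
    have h5 : |x| ≠ 1 := by
      intro h
      rcases (abs_eq one_pos.le).1 h with h | h
      · exact h2 (Or.inr (Or.inl h))
      · exact h2 (Or.inr (Or.inr h))
    refine ⟨x⁻¹, ?_, inv_inv x⟩
    change 1 < |x⁻¹|
    rw [abs_inv]
    exact (one_lt_inv₀ (abs_pos.2 h4)).2 (lt_of_le_of_ne h3 h5)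

lemma restrict_compl_freeSurface : (volume : Measure ℝ).restrict freeSurfaceᶜ =
    volume.restrict ((fun x : ℝ => x⁻¹) '' freeSurface) := by
  rw [image_inv_freeSurface]
  refine Measure.restrict_congr_set ?_
  refine (sdiff_null_ae_eq_self ?_).symm
  exact (Set.toFinite _).measure_zero _

lemma ne_zero_of_mem {x : ℝ} (hx : x ∈ freeSurface) : x ≠ 0 := by
  rintro rfl
  have : (1 : ℝ) < |0| := hx
  norm_num at this

lemma hasDerivWithinAt_inv' : ∀ x ∈ freeSurface,
    HasDerivWithinAt (fun z : ℝ => z⁻¹) (-(x ^ 2)⁻¹) freeSurface x :=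
  fun _ hx => (hasDerivAt_inv (ne_zero_of_mem hx)).hasDerivWithinAt

lemma ae_surface_mem : ∀ᵐ x ∂surfaceMeasure, x ∈ freeSurface :=
  ae_restrict_mem measurableSet_freeSurface

lemma inv_sq_enorm {a : ℝ} (ha : a ≠ 0) : (‖a‖ₑ ^ 2)⁻¹ = ENNReal.ofReal (a ^ 2)⁻¹ := by
  rw [ENNReal.ofReal_inv_of_pos (by positivity), ← sq_abs, ENNReal.ofReal_pow (abs_nonneg _),
    ← Real.norm_eq_abs, ofReal_norm]

/-- Up to the points 0, 1 and -1, inversion maps the free surface onto its complement, with Jacobian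
y⁻². -/
lemma lintegral_inversion {F : ℝ → ℝ≥0∞} (hF : Measurable F) :
    ∫⁻ x, F x = ∫⁻ y, (F y + F y⁻¹ * (‖y‖ₑ ^ 2)⁻¹) ∂surfaceMeasure := by
  rw [← lintegral_add_compl F measurableSet_freeSurface, lintegral_add_left hF]
  congr 1
  rw [restrict_compl_freeSurface, lintegral_image_eq_lintegral_abs_deriv_mul
    measurableSet_freeSurface hasDerivWithinAt_inv' inv_injective.injOn]
  refine lintegral_congr_ae ?_
  filter_upwards [ae_surface_mem] with x hx
  rw [inv_sq_enorm (ne_zero_of_mem hx), mul_comm, abs_neg, abs_of_nonneg (by positivity)]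

lemma integrable_inversion {F : ℝ → ℂ} (hF : Integrable F) :
    Integrable (fun y : ℝ => (((y ^ 2)⁻¹ : ℝ) : ℂ) * F y⁻¹) surfaceMeasure := by
  have h1 : IntegrableOn F ((fun x : ℝ => x⁻¹) '' freeSurface) volume := hF.integrableOn
  rw [integrableOn_image_iff_integrableOn_abs_deriv_smul
    measurableSet_freeSurface hasDerivWithinAt_inv' inv_injective.injOn] at h1
  refine h1.congr (Eventually.of_forall fun x => ?_)
  simp only [abs_neg, abs_of_nonneg (inv_nonneg.2 (sq_nonneg x)), Complex.real_smul]

lemma integral_inversion {F : ℝ → ℂ} (hF : Integrable F) :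
    ∫ x, F x = ∫ y, F y ∂surfaceMeasure +
      ∫ y, (((y ^ 2)⁻¹ : ℝ) : ℂ) * F y⁻¹ ∂surfaceMeasure := by
  rw [← integral_add_compl measurableSet_freeSurface hF]
  congr 1
  rw [restrict_compl_freeSurface, integral_image_eq_integral_abs_deriv_smul
    measurableSet_freeSurface hasDerivWithinAt_inv' inv_injective.injOn]
  refine integral_congr_ae (Eventually.of_forall fun x => ?_)
  simp only [abs_neg, abs_of_nonneg (inv_nonneg.2 (sq_nonneg x)), Complex.real_smul]

/-! ### Quadratic forms with a kernel -/

/-- The quadratic form with kernel `k`, in the coordinates of the two half-lines. -/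
noncomputable def kernelForm (k : Bool → Bool → ℝ → ℝ → ℝ≥0∞) (v : ℝ → ℂ) : ℝ≥0∞ :=
  ∑ b, ∑ c, ∫⁻ s, ∫⁻ t, ‖v (toSurface b s) - v (toSurface c t)‖ₑ ^ 2 * k b c s t
    ∂posMeasure ∂posMeasure

lemma lintegral_lintegral_surface {F : ℝ → ℝ → ℝ≥0∞} (hF : Measurable (Function.uncurry F)) :
    ∫⁻ x, ∫⁻ y, F x y ∂surfaceMeasure ∂surfaceMeasure =
      ∑ b, ∑ c, ∫⁻ s, ∫⁻ t, F (toSurface b s) (toSurface c t) ∂posMeasure ∂posMeasure := by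
  have hb : ∀ b, ∫⁻ s, ∫⁻ y, F (toSurface b s) y ∂surfaceMeasure ∂posMeasure
      = ∑ c, ∫⁻ s, ∫⁻ t, F (toSurface b s) (toSurface c t) ∂posMeasure ∂posMeasure := by
    intro b
    have h1 := measurable_toSurface b
    have h2 := measurable_toSurface true
    simp_rw [lintegral_surface]
    rw [Fintype.sum_bool, lintegral_add_left]
    refine Measurable.lintegral_prod_right ?_
    exact hF.comp (f := fun p : ℝ × ℝ => (toSurface b p.1, toSurface true p.2)) (by fun_prop)
  rw [lintegral_surface, hb, hb, Fintype.sum_bool (fun b => ∑ c, _)]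

lemma kernelForm_mono {k k' : Bool → Bool → ℝ → ℝ → ℝ≥0∞} (v : ℝ → ℂ)
    (h : ∀ b c s t, 0 < s → 0 < t → k b c s t ≤ k' b c s t) : kernelForm k v ≤ kernelForm k' v := by
  refine Finset.sum_le_sum fun b _ => Finset.sum_le_sum fun c _ => lintegral_mono_ae ?_
  filter_upwards [ae_pos] with s hs
  refine lintegral_mono_ae ?_
  filter_upwards [ae_pos] with t ht
  gcongr
  exact h b c s t hs ht

lemma kernelForm_add {k k' : Bool → Bool → ℝ → ℝ → ℝ≥0∞} {v : ℝ → ℂ} (hv : Measurable v)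
    (hk : ∀ b c, Measurable (Function.uncurry (k b c))) :
    kernelForm (fun b c s t => k b c s t + k' b c s t) v = kernelForm k v + kernelForm k' v := by
  unfold kernelForm
  rw [← Finset.sum_add_distrib]
  refine Finset.sum_congr rfl fun b _ => ?_
  rw [← Finset.sum_add_distrib]
  refine Finset.sum_congr rfl fun c _ => ?_
  have h1 := measurable_toSurface b
  have h2 := measurable_toSurface c
  have hm : Measurable (fun p : ℝ × ℝ =>
      ‖v (toSurface b p.1) - v (toSurface c p.2)‖ₑ ^ 2 * k b c p.1 p.2) :=
    Measurable.mul (by fun_prop) (hk b c)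
  rw [← lintegral_add_left hm.lintegral_prod_right']
  refine lintegral_congr fun s => ?_
  simp only [mul_add]
  exact lintegral_add_left (hm.comp measurable_prodMk_left) _

lemma kernelForm_const_mul {k : Bool → Bool → ℝ → ℝ → ℝ≥0∞} {a : ℝ≥0∞} (ha : a ≠ ⊤) (v : ℝ → ℂ) :
    kernelForm (fun b c s t => a * k b c s t) v = a * kernelForm k v := by
  unfold kernelForm
  rw [Finset.mul_sum]
  refine Finset.sum_congr rfl fun b _ => ?_
  rw [Finset.mul_sum]
  refine Finset.sum_congr rfl fun c _ => ?_
  rw [← lintegral_const_mul' _ _ ha]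
  refine lintegral_congr fun s => ?_
  rw [← lintegral_const_mul' _ _ ha]
  refine lintegral_congr fun t => ?_
  ring

/-- The Gagliardo kernel of the free surface. -/
noncomputable def kerE (b c : Bool) (s t : ℝ) : ℝ≥0∞ :=
  (‖toSurface b s - toSurface c t‖ₑ ^ 2)⁻¹

/-- The kernel of the Dirichlet-to-Neumann form. -/
noncomputable def kerD (b c : Bool) (s t : ℝ) : ℝ≥0∞ :=
  kerE b c s t + (‖toSurface b s * toSurface c t - 1‖ₑ ^ 2)⁻¹

/-- The kernel of the Neumann form on the two half-lines. -/
noncomputable def kerN (b c : Bool) (s t : ℝ) : ℝ≥0∞ :=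
  if b = c then (‖s - t‖ₑ ^ 2)⁻¹ + (‖s + t‖ₑ ^ 2)⁻¹ else 0

/-- A kernel which controls the difference of the two forms. -/
noncomputable def kerZ (s t : ℝ) : ℝ≥0∞ :=
  ENNReal.ofReal (2 * s * t * ((s + t) ^ 3)⁻¹ + 2 * ((1 + s + t) ^ 2)⁻¹)

lemma measurable_kerE (b c : Bool) : Measurable (Function.uncurry (kerE b c)) := by
  have h1 := measurable_toSurface b
  have h2 := measurable_toSurface c
  unfold kerE Function.uncurry
  fun_prop

lemma measurable_kerD (b c : Bool) : Measurable (Function.uncurry (kerD b c)) := by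
  have h1 := measurable_toSurface b
  have h2 := measurable_toSurface c
  refine (measurable_kerE b c).add ?_
  fun_prop

lemma measurable_kerN (b c : Bool) : Measurable (Function.uncurry (kerN b c)) := by
  by_cases h : b = c
  · simp only [kerN, if_pos h, Function.uncurry_def]
    fun_prop
  · simp only [kerN, if_neg h, Function.uncurry_def]
    fun_prop

lemma enorm_le_of_abs_le {a b : ℝ} (h : |a| ≤ |b|) : ‖a‖ₑ ≤ ‖b‖ₑ := by
  rw [← ofReal_norm, ← ofReal_norm]
  exact ENNReal.ofReal_le_ofReal h

lemma enorm_sub_toSurface (b : Bool) (s t : ℝ) :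
    ‖toSurface b s - toSurface b t‖ₑ = ‖s - t‖ₑ := by
  have : toSurface b s - toSurface b t = sg b * (s - t) := by
    unfold toSurface
    ring
  rw [this, enorm_mul, ← ofReal_norm, Real.norm_eq_abs, abs_sg, ENNReal.ofReal_one, one_mul]

lemma toSurface_mul (b : Bool) (s t : ℝ) :
    toSurface b s * toSurface b t - 1 = s + t + s * t := by
  unfold toSurface
  linear_combination (1 + s) * (1 + t) * sg_mul_sg b

/-- On one component the second term is (s + t + st)⁻², smaller than the reflected Neumann term (s +
t)⁻². Across components both |x - y| and |xy - 1| are at least 1 + s + t, and `kerZ` alone suffices.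
-/
lemma kerD_le (b c : Bool) {s t : ℝ} (hs : 0 < s) (ht : 0 < t) :
    kerD b c s t ≤ kerN b c s t + kerZ s t := by
  have hst : 0 < s * t := mul_pos hs ht
  by_cases h : b = c
  · subst h
    refine le_trans ?_ le_self_add
    rw [kerD, kerE, kerN, if_pos rfl, enorm_sub_toSurface, toSurface_mul]
    gcongr
    refine enorm_le_of_abs_le ?_
    rw [abs_of_pos (by positivity), abs_of_pos (by positivity)]
    linarith
  · have hc : c = !b := by cases b <;> cases c <;> simp_all
    refine le_trans ?_ le_add_self
    rw [kerD, kerE, hc]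
    have e1 : |toSurface b s - toSurface (!b) t| = 2 + s + t := by
      have : toSurface b s - toSurface (!b) t = sg b * (2 + s + t) := by
        cases b <;> simp [toSurface, sg] <;> ring
      rw [this, abs_mul, abs_sg, one_mul, abs_of_pos (by positivity)]
    have e2 : |toSurface b s * toSurface (!b) t - 1| = 2 + s + t + s * t := by
      have : toSurface b s * toSurface (!b) t - 1 = -(2 + s + t + s * t) := by
        cases b <;> simp [toSurface, sg] <;> ring
      rw [this, abs_neg, abs_of_pos (by positivity)]
    have hp : (1 + s + t : ℝ) ≠ 0 := by positivity
    have b1 : (‖toSurface b s - toSurface (!b) t‖ₑ ^ 2)⁻¹ ≤ ENNReal.ofReal ((1 + s + t) ^ 2)⁻¹ := by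
      rw [← inv_sq_enorm hp]
      gcongr
      refine enorm_le_of_abs_le ?_
      rw [e1, abs_of_pos (by positivity)]
      linarith
    have b2 : (‖toSurface b s * toSurface (!b) t - 1‖ₑ ^ 2)⁻¹
        ≤ ENNReal.ofReal ((1 + s + t) ^ 2)⁻¹ := by
      rw [← inv_sq_enorm hp]
      gcongr
      refine enorm_le_of_abs_le ?_
      rw [e2, abs_of_pos (by positivity)]
      linarith
    refine (add_le_add b1 b2).trans ?_
    rw [← ENNReal.ofReal_add (by positivity) (by positivity), kerZ]
    refine ENNReal.ofReal_le_ofReal ?_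
    have : 0 ≤ 2 * s * t * ((s + t) ^ 3)⁻¹ := by positivity
    linarith

/-- Only the reflected term needs work: replacing s + t by s + t + st lowers it, and the loss must
be integrable in each variable uniformly in the other. -/
lemma kerN_le (b c : Bool) {s t : ℝ} (hs : 0 < s) (ht : 0 < t) :
    kerN b c s t ≤ kerD b c s t + kerZ s t := by
  by_cases h : b = c
  · subst h
    rw [kerD, kerE, kerN, if_pos rfl, enorm_sub_toSurface, toSurface_mul, add_assoc]
    gcongr
    rw [inv_sq_enorm (by positivity), inv_sq_enorm (by positivity), kerZ,
      ← ENNReal.ofReal_add (by positivity) (by positivity)]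
    refine ENNReal.ofReal_le_ofReal ?_
    have h1 : 0 ≤ 2 * ((1 + s + t) ^ 2)⁻¹ := by positivity
    -- Convexity: the graph of r ↦ r⁻² lies above its tangent at s + t, taken with increment st.
    have h2 : ((s + t) ^ 2)⁻¹ ≤ ((s + t + s * t) ^ 2)⁻¹ + 2 * s * t * ((s + t) ^ 3)⁻¹ := by
      have ha : 0 < s + t := by positivity
      have hp : 0 < s * t := by positivity
      rw [mul_assoc 2 s t]
      generalize s + t = a at *
      generalize s * t = p at *
      have h3 : 0 < a + p := by positivity
      have e : ((a + p) ^ 2)⁻¹ + 2 * p * (a ^ 3)⁻¹ - (a ^ 2)⁻¹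
          = (3 * a * p ^ 2 + 2 * p ^ 3) / (a ^ 3 * (a + p) ^ 2) := by
        field_simp
        ring
      have : 0 ≤ (3 * a * p ^ 2 + 2 * p ^ 3) / (a ^ 3 * (a + p) ^ 2) := by positivity
      linarith
    linarith
  · rw [kerN, if_neg h]
    exact zero_le

lemma kerN_le_kerE (b c : Bool) {s t : ℝ} (hs : 0 < s) (ht : 0 < t) :
    kerN b c s t ≤ 2 * kerE b c s t := by
  by_cases h : b = c
  · subst h
    rw [kerN, if_pos rfl, kerE, enorm_sub_toSurface, two_mul]
    gcongr
    refine enorm_le_of_abs_le ?_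
    rw [abs_of_pos (by positivity : 0 < s + t), abs_le]
    constructor <;> linarith
  · rw [kerN, if_neg h]
    exact zero_le

lemma lintegral_inv_sq {a : ℝ} (ha : 0 < a) :
    ∫⁻ t, ENNReal.ofReal (a * ((a + t) ^ 2)⁻¹) ∂posMeasure = 1 := by
  have hd : ∀ t ∈ Set.Ici (0 : ℝ), HasDerivAt (fun t : ℝ => -(a * (a + t)⁻¹))
      (a * ((a + t) ^ 2)⁻¹) t := by
    intro t ht
    have h0 : a + t ≠ 0 := by
      have : (0 : ℝ) ≤ t := ht
      positivity
    have h1 := (((hasDerivAt_id t).const_add a).inv h0).const_mul a |>.neg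
    refine h1.congr_deriv ?_
    simp only [id]
    field_simp
  have hl : Tendsto (fun t : ℝ => -(a * (a + t)⁻¹)) atTop (𝓝 0) := by
    have : Tendsto (fun t : ℝ => (a + t)⁻¹) atTop (𝓝 0) :=
      (tendsto_atTop_add_const_left _ a tendsto_id).inv_tendsto_atTop
    simpa using (this.const_mul a).neg
  have hnn : ∀ t ∈ Set.Ioi (0 : ℝ), 0 ≤ a * ((a + t) ^ 2)⁻¹ := fun t _ => by positivity
  have hi := integrableOn_Ioi_deriv_of_nonneg' hd hnn hl
  rw [← ofReal_integral_eq_lintegral_ofReal hi (Eventually.of_forall fun t => by positivity),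
    integral_Ioi_of_hasDerivAt_of_nonneg' hd hnn hl]
  rw [add_zero, mul_inv_cancel₀ ha.ne']
  simp

/-- Both terms are dominated by 2a(a + t)⁻², with a = s for the first (as t ≤ s + t) and a = 1 + s
for the second; each has integral 2, whatever s is. -/
lemma lintegral_kerZ_le {s : ℝ} (hs : 0 < s) : ∫⁻ t, kerZ s t ∂posMeasure ≤ 4 := by
  calc ∫⁻ t, kerZ s t ∂posMeasure
      ≤ ∫⁻ t, (2 * ENNReal.ofReal (s * ((s + t) ^ 2)⁻¹)
          + 2 * ENNReal.ofReal ((1 + s) * ((1 + s + t) ^ 2)⁻¹)) ∂posMeasure := by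
        refine lintegral_mono_ae ?_
        filter_upwards [ae_pos] with t ht
        have h2 : (2 : ℝ≥0∞) = ENNReal.ofReal 2 := by simp
        rw [kerZ, h2, ← ENNReal.ofReal_mul (by norm_num), ← ENNReal.ofReal_mul (by norm_num),
          ← ENNReal.ofReal_add (by positivity) (by positivity)]
        refine ENNReal.ofReal_le_ofReal (add_le_add ?_ ?_)
        · have e : 2 * (s * ((s + t) ^ 2)⁻¹) - 2 * s * t * ((s + t) ^ 3)⁻¹
              = 2 * s ^ 2 * ((s + t) ^ 3)⁻¹ := by
            field_simp
            ring
          have : 0 ≤ 2 * s ^ 2 * ((s + t) ^ 3)⁻¹ := by positivity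
          linarith
        · have : 0 ≤ ((1 + s + t) ^ 2)⁻¹ := by positivity
          nlinarith
    _ = 4 := by
        rw [lintegral_add_left (by fun_prop), lintegral_const_mul _ (by fun_prop),
          lintegral_const_mul _ (by fun_prop), lintegral_inv_sq hs,
          lintegral_inv_sq (by linarith)]
        norm_num

lemma kerZ_comm (s t : ℝ) : kerZ s t = kerZ t s := by
  unfold kerZ
  congr 1
  rw [add_comm s t, show 1 + s + t = 1 + t + s by ring]
  ring

lemma measurable_kerZ : Measurable (Function.uncurry kerZ) := by
  unfold kerZ Function.uncurry
  fun_prop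

lemma enorm_sub_sq_le (a b : ℂ) : ‖a - b‖ₑ ^ 2 ≤ 2 * (‖a‖ₑ ^ 2 + ‖b‖ₑ ^ 2) := by
  have h : ‖a - b‖ ^ 2 ≤ 2 * (‖a‖ ^ 2 + ‖b‖ ^ 2) := by
    have h1 := norm_sub_le a b
    have h2 := norm_nonneg (a - b)
    nlinarith [sq_nonneg (‖a‖ - ‖b‖)]
  rw [← ofReal_norm, ← ofReal_norm, ← ofReal_norm, ← ENNReal.ofReal_pow (norm_nonneg _),
    ← ENNReal.ofReal_pow (norm_nonneg _), ← ENNReal.ofReal_pow (norm_nonneg _),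
    ← ENNReal.ofReal_add (by positivity) (by positivity), show (2 : ℝ≥0∞) = ENNReal.ofReal 2 by simp,
    ← ENNReal.ofReal_mul (by norm_num)]
  exact ENNReal.ofReal_le_ofReal h

/-- Schur's test. Splitting |a - b|² ≤ 2|a|² + 2|b|² and using the row bound 4 and symmetry gives 16
for each pair of components, and there are four pairs. -/
lemma kernelForm_kerZ_le (v : L2E) : kernelForm (fun _ _ => kerZ) v ≤ 64 * ‖v‖ₑ ^ 2 := by
  have hv := measurable_L2E v
  have hk : ∀ s : ℝ, Measurable (fun t => kerZ s t) := fun s =>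
    measurable_kerZ.comp measurable_prodMk_left
  have hA : ∀ b : Bool, ∫⁻ s, ∫⁻ t, ‖v (toSurface b s)‖ₑ ^ 2 * kerZ s t ∂posMeasure ∂posMeasure
      ≤ 4 * ‖v‖ₑ ^ 2 := by
    intro b
    have h1 := measurable_toSurface b
    calc _ ≤ ∫⁻ s, ‖v (toSurface b s)‖ₑ ^ 2 * 4 ∂posMeasure := by
          refine lintegral_mono_ae ?_
          filter_upwards [ae_pos] with s hs
          rw [lintegral_const_mul _ (hk s)]
          gcongr
          exact lintegral_kerZ_le hs
      _ = 4 * ∫⁻ s, ‖v (toSurface b s)‖ₑ ^ 2 ∂posMeasure := by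
          rw [lintegral_mul_const _ (by fun_prop), mul_comm]
      _ ≤ _ := by
          gcongr
          exact lintegral_L2E_le v b
  have hbc : ∀ b c : Bool, ∫⁻ s, ∫⁻ t, ‖v (toSurface b s) - v (toSurface c t)‖ₑ ^ 2 * kerZ s t
      ∂posMeasure ∂posMeasure ≤ 16 * ‖v‖ₑ ^ 2 := by
    intro b c
    have h1 := measurable_toSurface b
    have h2 := measurable_toSurface c
    have hm1 : Measurable (fun p : ℝ × ℝ => 2 * (‖v (toSurface b p.1)‖ₑ ^ 2 * kerZ p.1 p.2)) :=
      Measurable.const_mul (Measurable.mul (by fun_prop) measurable_kerZ) _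
    have hm2 : Measurable (fun p : ℝ × ℝ => (‖v (toSurface c p.2)‖ₑ ^ 2 * kerZ p.1 p.2)) :=
      Measurable.mul (by fun_prop) measurable_kerZ
    calc _ ≤ ∫⁻ s, ∫⁻ t, (2 * (‖v (toSurface b s)‖ₑ ^ 2 * kerZ s t)
          + 2 * (‖v (toSurface c t)‖ₑ ^ 2 * kerZ s t)) ∂posMeasure ∂posMeasure := by
          refine lintegral_mono fun s => lintegral_mono fun t => ?_
          rw [← mul_add, ← add_mul, ← mul_assoc]
          gcongr
          exact enorm_sub_sq_le _ _
      _ = 2 * ∫⁻ s, ∫⁻ t, ‖v (toSurface b s)‖ₑ ^ 2 * kerZ s t ∂posMeasure ∂posMeasure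
          + 2 * ∫⁻ s, ∫⁻ t, ‖v (toSurface c t)‖ₑ ^ 2 * kerZ s t ∂posMeasure ∂posMeasure := by
          simp_rw [← lintegral_const_mul' 2 _ (by simp)]
          rw [← lintegral_add_left hm1.lintegral_prod_right']
          refine lintegral_congr fun s => ?_
          exact lintegral_add_left (hm1.comp measurable_prodMk_left) _
      _ ≤ 2 * (4 * ‖v‖ₑ ^ 2) + 2 * (4 * ‖v‖ₑ ^ 2) := by
          gcongr
          · exact hA b
          · rw [lintegral_lintegral_swap hm2.aemeasurable]
            simp_rw [kerZ_comm]
            exact hA c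
      _ = _ := by ring
  unfold kernelForm
  simp only [Fintype.sum_bool]
  refine (add_le_add (add_le_add (hbc _ _) (hbc _ _)) (add_le_add (hbc _ _) (hbc _ _))).trans ?_
  rw [← add_mul, ← add_mul]
  norm_num

/-! ### Comparison of the three quadratic forms -/

lemma gagliardo_surface_eq (v : L2E) :
    ∫⁻ x, ∫⁻ y, ‖v x - v y‖ₑ ^ 2 / ‖x - y‖ₑ ^ 2 ∂surfaceMeasure ∂surfaceMeasure
      = kernelForm kerE v := by
  have hv := measurable_L2E v
  rw [lintegral_lintegral_surface (by unfold Function.uncurry; fun_prop)]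
  rfl

lemma kernelForm_kerE_le (v : L2E) :
    kernelForm kerE v ≤ kernelForm kerN v + 64 * ‖v‖ₑ ^ 2 := by
  refine (kernelForm_mono v (k' := fun b c s t => kerN b c s t + kerZ s t)
    fun b c s t hs ht => ?_).trans ?_
  · exact le_trans le_self_add (kerD_le b c hs ht)
  · rw [kernelForm_add (measurable_L2E v) measurable_kerN]
    gcongr
    exact kernelForm_kerZ_le v

lemma kernelForm_kerN_le_kerE (v : L2E) : kernelForm kerN v ≤ 2 * kernelForm kerE v := by
  rw [← kernelForm_const_mul (by simp)]
  exact kernelForm_mono v fun b c s t hs ht => kerN_le_kerE b c hs ht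

lemma kernelForm_kerD_le (v : L2E) :
    kernelForm kerD v ≤ kernelForm kerN v + 64 * ‖v‖ₑ ^ 2 := by
  refine (kernelForm_mono v (k' := fun b c s t => kerN b c s t + kerZ s t)
    fun b c s t hs ht => kerD_le b c hs ht).trans ?_
  rw [kernelForm_add (measurable_L2E v) measurable_kerN]
  gcongr
  exact kernelForm_kerZ_le v

lemma kernelForm_kerN_le (v : L2E) :
    kernelForm kerN v ≤ kernelForm kerD v + 64 * ‖v‖ₑ ^ 2 := by
  refine (kernelForm_mono v (k' := fun b c s t => kerD b c s t + kerZ s t)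
    fun b c s t hs ht => kerN_le b c hs ht).trans ?_
  rw [kernelForm_add (measurable_L2E v) measurable_kerD]
  gcongr
  exact kernelForm_kerZ_le v

/-! ### Gagliardo seminorms of even extensions and of reflections -/

lemma gagl_congr {f g : ℝ → ℂ} (h : ∀ᵐ x : ℝ, f x = g x) : gagl f = gagl g := by
  refine lintegral_congr_ae ?_
  filter_upwards [h] with x hx
  refine lintegral_congr_ae ?_
  filter_upwards [h] with y hy
  rw [hx, hy]

/-- Folding the inner variable onto the positive half-line produces the two terms of `kerN`. Folding
the outer one gives the same value twice. -/
lemma gagl_evenExt (b : Bool) (v : L2E) : gagl (evenExt b v) =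
    2 * ∫⁻ s, ∫⁻ t, ‖v (toSurface b s) - v (toSurface b t)‖ₑ ^ 2 * kerN b b s t
      ∂posMeasure ∂posMeasure := by
  have hv := measurable_L2E v
  have hts := measurable_toSurface b
  rw [gagl_congr (coeFn_evenExt b v), gagl, lintegral_line, two_mul]
  have key : ∀ s : ℝ, 0 < s → ∀ σ : ℝ, |σ| = s →
      ∫⁻ y, ‖v (toSurface b |σ|) - v (toSurface b |y|)‖ₑ ^ 2 / ‖σ - y‖ₑ ^ 2
      = ∫⁻ t, ‖v (toSurface b s) - v (toSurface b t)‖ₑ ^ 2 * kerN b b s t ∂posMeasure := by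
    intro s hs σ hσ
    rw [lintegral_line, ← lintegral_add_left (by fun_prop)]
    refine lintegral_congr_ae ?_
    filter_upwards [ae_pos] with t ht
    rw [abs_neg, abs_of_pos ht, hσ, kerN, if_pos rfl, mul_add, ← div_eq_mul_inv, ← div_eq_mul_inv]
    rcases (abs_eq hs.le).1 hσ with h | h
    · rw [h, sub_neg_eq_add]
    · rw [h, add_comm, show -s - -t = -(s - t) by ring, show -s - t = -(s + t) by ring, enorm_neg,
        enorm_neg]
  congr 1
  · refine lintegral_congr_ae ?_
    filter_upwards [ae_pos] with s hs
    exact key s hs s (abs_of_pos hs)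
  · refine lintegral_congr_ae ?_
    filter_upwards [ae_pos] with s hs
    exact key s hs (-s) (by rw [abs_neg, abs_of_pos hs])

lemma gagl_evenExt_add (v : L2E) :
    gagl (evenExt true v) + gagl (evenExt false v) = 2 * kernelForm kerN v := by
  rw [gagl_evenExt, gagl_evenExt, ← mul_add]
  unfold kernelForm
  simp [kerN]

/-- Both variables are split at modulus one and the inner parts inverted. The Jacobians combine with
the kernel exactly: (1/x - 1/y)xy = y - x and (x - 1/y)y = xy - 1. The result is visibly unchanged
when f is replaced by f(1/x). -/
lemma gagl_inversion_form {f : ℝ → ℂ} (hf : Measurable f) : gagl f =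
    ∫⁻ x, ∫⁻ y, ((‖f x - f y‖ₑ ^ 2 + ‖f x⁻¹ - f y⁻¹‖ₑ ^ 2) * (‖x - y‖ₑ ^ 2)⁻¹
      + (‖f x - f y⁻¹‖ₑ ^ 2 + ‖f x⁻¹ - f y‖ₑ ^ 2) * (‖x * y - 1‖ₑ ^ 2)⁻¹)
      ∂surfaceMeasure ∂surfaceMeasure := by
  have hm : Measurable (fun p : ℝ × ℝ => ‖f p.1 - f p.2‖ₑ ^ 2 / ‖p.1 - p.2‖ₑ ^ 2) := by
    fun_prop
  rw [gagl, lintegral_inversion hm.lintegral_prod_right']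
  refine lintegral_congr_ae ?_
  filter_upwards [ae_surface_mem] with x hx
  have hx0 := ne_zero_of_mem hx
  rw [lintegral_inversion (by fun_prop), lintegral_inversion (by fun_prop),
    ← lintegral_mul_const _ (by fun_prop), ← lintegral_add_left (by fun_prop)]
  refine lintegral_congr_ae ?_
  filter_upwards [ae_surface_mem] with y hy
  have hy0 := ne_zero_of_mem hy
  have inv_mul : ∀ a b : ℝ, b ≠ 0 →
      (‖a‖ₑ ^ 2)⁻¹ * (‖b‖ₑ ^ 2)⁻¹ = (‖a * b‖ₑ ^ 2)⁻¹ := by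
    intro a b hb
    rw [enorm_mul, mul_pow, ENNReal.mul_inv (Or.inr (by simp)) (Or.inr (by simpa using hb))]
  have e1 : (‖x - y⁻¹‖ₑ ^ 2)⁻¹ * (‖y‖ₑ ^ 2)⁻¹ = (‖x * y - 1‖ₑ ^ 2)⁻¹ := by
    rw [inv_mul _ _ hy0, sub_mul, inv_mul_cancel₀ hy0]
  have e2 : (‖x⁻¹ - y‖ₑ ^ 2)⁻¹ * (‖x‖ₑ ^ 2)⁻¹ = (‖x * y - 1‖ₑ ^ 2)⁻¹ := by
    rw [inv_mul _ _ hx0, sub_mul, inv_mul_cancel₀ hx0, ← enorm_neg]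
    congr 3
    ring
  have e3 : (‖x⁻¹ - y⁻¹‖ₑ ^ 2)⁻¹ * (‖y‖ₑ ^ 2)⁻¹ * (‖x‖ₑ ^ 2)⁻¹ = (‖x - y‖ₑ ^ 2)⁻¹ := by
    rw [inv_mul _ _ hy0, inv_mul _ _ hx0, ← enorm_neg]
    congr 3
    field_simp
    ring
  simp only [div_eq_mul_inv]
  rw [add_mul, mul_assoc _ _ (‖y‖ₑ ^ 2)⁻¹, e1, mul_assoc _ _ (‖x‖ₑ ^ 2)⁻¹, e2,
    mul_assoc _ _ (‖y‖ₑ ^ 2)⁻¹, mul_assoc _ (_ * _) (‖x‖ₑ ^ 2)⁻¹, e3]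
  ring

/-- The Gagliardo seminorm is invariant under inversion. -/
lemma gagl_comp_inv {f : ℝ → ℂ} (hf : Measurable f) : gagl (fun x => f x⁻¹) = gagl f := by
  rw [gagl_inversion_form hf, gagl_inversion_form (by fun_prop : Measurable fun x => f x⁻¹)]
  refine lintegral_congr fun x => lintegral_congr fun y => ?_
  simp only [inv_inv]
  ring

lemma ae_surface_inv {p : ℝ → Prop} (h : ∀ᵐ x : ℝ, p x) : ∀ᵐ y ∂surfaceMeasure, p y⁻¹ := by
  set N := toMeasurable volume {x : ℝ | ¬ p x} with hN
  have hNm : MeasurableSet N := measurableSet_toMeasurable _ _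
  have hN0 : volume N = 0 := by
    rw [hN, measure_toMeasurable]
    exact h
  have hm : Measurable (N.indicator (1 : ℝ → ℝ≥0∞)) := measurable_one.indicator hNm
  have h1 := lintegral_inversion hm
  rw [lintegral_indicator_one hNm, hN0, eq_comm, lintegral_eq_zero_iff (by fun_prop)] at h1
  filter_upwards [h1, ae_surface_mem] with y hy hyE
  by_contra hcon
  have hmem : y⁻¹ ∈ N := subset_toMeasurable _ _ hcon
  rw [Pi.zero_apply, add_eq_zero, Set.indicator_of_mem hmem, Pi.one_apply, one_mul] at hy
  exact ENNReal.inv_ne_zero.2 (by simp) hy.2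

lemma abs_inv_lt_one {y : ℝ} (hy : y ∈ freeSurface) : |y⁻¹| < 1 := by
  rw [abs_inv]
  exact inv_lt_one_of_one_lt₀ hy

lemma IsReflection.ae_eq {v : L2E} {η : L2R} (h : IsReflection v η) :
    ∀ᵐ x ∂surfaceMeasure, η x = v x ∧ η x⁻¹ = v x := by
  filter_upwards [ae_restrict_of_ae h.1, ae_surface_inv h.2, ae_surface_mem] with y h1 h2 hy
  refine ⟨h1 hy, ?_⟩
  rw [h2 (abs_inv_lt_one hy), inv_inv]

/-- For a reflection the values at x and 1/x coincide, so the four differences in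
`gagl_inversion_form` are all v(x) - v(y). -/
lemma IsReflection.gagl_eq {v : L2E} {η : L2R} (h : IsReflection v η) :
    gagl η = 2 * kernelForm kerD v := by
  have hv := measurable_L2E v
  rw [gagl_inversion_form (measurable_L2R η), ← kernelForm_const_mul (by simp)]
  have e : ∫⁻ x, ∫⁻ y, ((‖η x - η y‖ₑ ^ 2 + ‖η x⁻¹ - η y⁻¹‖ₑ ^ 2) * (‖x - y‖ₑ ^ 2)⁻¹
      + (‖η x - η y⁻¹‖ₑ ^ 2 + ‖η x⁻¹ - η y‖ₑ ^ 2) * (‖x * y - 1‖ₑ ^ 2)⁻¹)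
      ∂surfaceMeasure ∂surfaceMeasure =
      ∫⁻ x, ∫⁻ y, ‖v x - v y‖ₑ ^ 2 * (2 * ((‖x - y‖ₑ ^ 2)⁻¹ + (‖x * y - 1‖ₑ ^ 2)⁻¹))
      ∂surfaceMeasure ∂surfaceMeasure := by
    refine lintegral_congr_ae ?_
    filter_upwards [h.ae_eq] with x hx
    refine lintegral_congr_ae ?_
    filter_upwards [h.ae_eq] with y hy
    rw [hx.1, hx.2, hy.1, hy.2]
    ring
  rw [e, lintegral_lintegral_surface (by unfold Function.uncurry; fun_prop)]
  rfl

lemma exists_isReflection (v : L2E) : ∃ η : L2R, IsReflection v η := by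
  set f : ℝ → ℂ := fun x => if 1 < |x| then v x else v x⁻¹ with hf
  have hv := measurable_L2E v
  have hfm : Measurable f := Measurable.ite measurableSet_freeSurface hv (by fun_prop)
  have hml : MemLp f 2 := by
    rw [memLp_iff_lintegral hfm, lintegral_inversion (by fun_prop)]
    refine lt_of_le_of_lt (b := ∫⁻ y, 2 * ‖v y‖ₑ ^ 2 ∂surfaceMeasure) (lintegral_mono_ae ?_) ?_
    · filter_upwards [ae_surface_mem] with y hy
      have hy1 : 1 < |y| := hy
      have h1 : (‖y‖ₑ ^ 2)⁻¹ ≤ 1 := by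
        rw [ENNReal.inv_le_one, ← ofReal_norm, ← ENNReal.ofReal_pow (norm_nonneg _),
          ← ENNReal.ofReal_one]
        refine ENNReal.ofReal_le_ofReal ?_
        rw [Real.norm_eq_abs]
        nlinarith
      simp only [hf]
      rw [if_pos hy1, if_neg (not_lt.2 (abs_inv_lt_one hy).le), inv_inv, two_mul]
      gcongr
      exact mul_le_of_le_one_right' h1
    · rw [lintegral_const_mul _ (by fun_prop), lintegral_enorm_sq]
      finiteness
  refine ⟨hml.toLp f, ?_, ?_⟩
  · filter_upwards [hml.coeFn_toLp] with x hx h1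
    rw [hx, hf]
    simp only [if_pos h1]
  · filter_upwards [hml.coeFn_toLp] with x hx h1
    rw [hx, hf]
    simp only [if_neg (not_lt.2 h1.le)]

/-! ### Equivariance of the half-plane operator under inversion -/

/-- Equality of seminorms becomes equality of forms because `gaglConst` is neither zero nor
infinite. -/
lemma IsHalfPlaneDtN.gagl_inj {η w η' w' : L2R} (h : IsHalfPlaneDtN η w)
    (h' : IsHalfPlaneDtN η' w') (e : gagl η = gagl η') :
    (inner ℂ w η : ℂ).re = (inner ℂ w' η' : ℂ).re := by
  rw [h.gagl_eq, h'.gagl_eq, ENNReal.mul_right_inj gaglConst_ne_zero gaglConst_ne_top,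
    ENNReal.ofReal_eq_ofReal_iff (mul_nonneg (by positivity) h.re_inner_nonneg)
      (mul_nonneg (by positivity) h'.re_inner_nonneg)] at e
  exact mul_left_cancel₀ (by positivity) e

lemma IsReflection.comp_inv {v : L2E} {η : L2R} (h : IsReflection v η) :
    ∀ᵐ x : ℝ, η x⁻¹ = η x := by
  have h1 : ∀ᵐ x ∂surfaceMeasure, η x = v x := h.ae_eq.mono fun x hx => hx.1
  have h2 : ∀ᵐ x ∂surfaceMeasure, η x⁻¹ = η x := h.ae_eq.mono fun x hx => hx.2.trans hx.1.symm
  have h3 : ∀ᵐ x : ℝ, x ∉ ({1, -1} : Set ℝ) :=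
    measure_eq_zero_iff_ae_notMem.1 ((Set.toFinite _).measure_zero _)
  filter_upwards [h.2, ae_inv_of_ae h1, ae_of_ae_surface h2, h3] with x e1 e2 e3 e4
  rcases lt_trichotomy |x| 1 with hx | hx | hx
  · rw [e1 hx, e2 hx]
  · rcases (abs_eq one_pos.le).1 hx with h | h
    · exact absurd (Or.inl h) e4
    · exact absurd (Or.inr h) e4
  · exact e3 hx

/-- Inversion carries η + ψ to η - ψ, so the invariant form takes the same value on both.
Polarization gives a vanishing real part of ⟨w, ψ⟩, and Iψ, which is odd as well, gives the
imaginary part. -/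
lemma IsHalfPlaneDtN.inner_eq_zero_of_odd {η w ψ z : L2R} (h : IsHalfPlaneDtN η w)
    (hψ : IsHalfPlaneDtN ψ z) (hη : ∀ᵐ x : ℝ, η x⁻¹ = η x) (hodd : ∀ᵐ x : ℝ, ψ x⁻¹ = -ψ x) :
    (inner ℂ w ψ : ℂ) = 0 := by
  have key : ∀ {ψ z : L2R}, IsHalfPlaneDtN ψ z → (∀ᵐ x : ℝ, ψ x⁻¹ = -ψ x) →
      (inner ℂ w ψ : ℂ).re = 0 := by
    intro ψ z hψ hodd
    have hneg := hψ.smul (-1)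
    have e : gagl (η + ψ : L2R) = gagl (η + (-1 : ℂ) • ψ : L2R) := by
      rw [← gagl_comp_inv (measurable_L2R (η + ψ))]
      refine gagl_congr ?_
      have hinv : ∀ᵐ x : ℝ, (η + ψ : L2R) x⁻¹ = η x⁻¹ + ψ x⁻¹ := by
        have hs := Lp.coeFn_add η ψ
        have h1 := ae_surface_inv hs
        have h2 := ae_inv_of_ae (ae_restrict_of_ae (s := freeSurface) hs)
        have h3 : ∀ᵐ x : ℝ, x ∉ ({1, -1} : Set ℝ) :=
          measure_eq_zero_iff_ae_notMem.1 ((Set.toFinite _).measure_zero _)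
        filter_upwards [ae_of_ae_surface h1, h2, h3] with x e1 e2 e4
        rcases lt_trichotomy |x| 1 with hx | hx | hx
        · exact e2 hx
        · rcases (abs_eq one_pos.le).1 hx with h | h
          · exact absurd (Or.inl h) e4
          · exact absurd (Or.inr h) e4
        · exact e1 hx
      filter_upwards [hinv, hη, hodd, Lp.coeFn_add η ((-1 : ℂ) • ψ),
        Lp.coeFn_smul (-1 : ℂ) ψ] with x e1 e2 e3 e4 e5
      rw [e1, e2, e3, e4, Pi.add_apply, e5, Pi.smul_apply, neg_one_smul]
    have h1 := (h.add hψ).gagl_inj (h.add hneg) e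
    have h2 : (inner ℂ z η : ℂ).re = (inner ℂ w ψ : ℂ).re := by
      rw [hψ.inner_symm h, ← inner_conj_symm, Complex.conj_re]
    simp only [inner_add_left, inner_add_right, inner_smul_left, inner_smul_right,
      Complex.add_re, map_neg, map_one, Complex.neg_re, neg_mul, one_mul] at h1
    linarith
  refine Complex.ext (key hψ hodd) ?_
  have hI := key (hψ.smul Complex.I) (by
    have hs := Lp.coeFn_smul Complex.I ψ
    have h1 := ae_surface_inv hs
    have h2 := ae_inv_of_ae (ae_restrict_of_ae (s := freeSurface) hs)
    have h3 : ∀ᵐ x : ℝ, x ∉ ({1, -1} : Set ℝ) :=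
      measure_eq_zero_iff_ae_notMem.1 ((Set.toFinite _).measure_zero _)
    filter_upwards [ae_of_ae_surface h1, h2, h3, hodd, hs] with x e1 e2 e4 e5 e6
    have e7 : (Complex.I • ψ : L2R) x⁻¹ = Complex.I * ψ x⁻¹ := by
      rcases lt_trichotomy |x| 1 with hx | hx | hx
      · exact e2 hx
      · rcases (abs_eq one_pos.le).1 hx with h | h
        · exact absurd (Or.inl h) e4
        · exact absurd (Or.inr h) e4
      · exact e1 hx
    rw [e7, e5, e6, Pi.smul_apply, smul_eq_mul, mul_neg])
  rw [inner_smul_right, Complex.mul_re, Complex.I_re, Complex.I_im] at hI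
  simpa using hI

lemma memLp_inv_sq_mul (w : L2R) :
    MemLp (fun y : ℝ => (((y ^ 2)⁻¹ : ℝ) : ℂ) * w y⁻¹) 2 surfaceMeasure := by
  have hw := measurable_L2R w
  rw [memLp_iff_lintegral (by fun_prop)]
  have h2 : ∫⁻ x, ‖w x‖ₑ ^ 2 < ⊤ := by
    rw [lintegral_enorm_sq]
    finiteness
  rw [lintegral_inversion (by fun_prop)] at h2
  refine lt_of_le_of_lt (lintegral_mono_ae ?_) h2
  filter_upwards [ae_surface_mem] with y hy
  have hy1 : 1 < |y| := hy
  refine le_trans ?_ le_add_self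
  rw [enorm_mul, mul_pow, mul_comm]
  gcongr
  rw [inv_sq_enorm (ne_zero_of_mem hy), ← ofReal_norm, ← ENNReal.ofReal_pow (norm_nonneg _)]
  refine ENNReal.ofReal_le_ofReal ?_
  rw [Complex.norm_real, Real.norm_of_nonneg (by positivity), sq]
  refine mul_le_of_le_one_left (by positivity) (inv_le_one_of_one_le₀ ?_)
  rw [← sq_abs]
  nlinarith

/-- The function φ - φ(1/x) is odd under inversion, so w is orthogonal to it by
`inner_eq_zero_of_odd`. Changing variables inside the unit interval, this says that w(y) - y⁻²w(1/y)
annihilates every test φ supported in the free surface. -/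
lemma IsHalfPlaneDtN.equivariant {v : L2E} {η w : L2R} (hη : IsReflection v η)
    (h : IsHalfPlaneDtN η w) :
    ∀ᵐ y ∂surfaceMeasure, (((y ^ 2)⁻¹ : ℝ) : ℂ) * w y⁻¹ = w y := by
  have hz : MemLp (fun y : ℝ => w y - (((y ^ 2)⁻¹ : ℝ) : ℂ) * w y⁻¹) 2 surfaceMeasure :=
    ((Lp.memLp w).restrict _).sub (memLp_inv_sq_mul w)
  have main := isOpen_freeSurface.ae_eq_zero_of_integral_contDiff_smul_eq_zero
    (μ := surfaceMeasure) (f := fun y : ℝ => w y - (((y ^ 2)⁻¹ : ℝ) : ℂ) * w y⁻¹)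
    ((hz.locallyIntegrable (by norm_num)).locallyIntegrableOn _) ?_
  · filter_upwards [main, ae_surface_mem] with y h1 h2
    exact (sub_eq_zero.1 (h1 h2)).symm
  intro φ hφ hc hs
  obtain ⟨R, hR⟩ := hc.isCompact.isBounded.exists_norm_le
  have hR0 : ∀ x : ℝ, R < |x| → φ x = 0 := fun x hx =>
    image_eq_zero_of_notMem_tsupport fun hmem => not_lt.2 (hR x hmem) hx
  have hE0 : ∀ x : ℝ, x ∉ freeSurface → φ x = 0 := fun x hx =>
    image_eq_zero_of_notMem_tsupport fun hmem => hx (hs hmem)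
  have hE0' : ∀ x : ℝ, |x| ≤ 1 → φ x = 0 := fun x hx => hE0 x (not_lt.2 hx)
  have hsm : ContDiff ℝ ∞ (fun x => φ x - φ x⁻¹) := by
    -- Smoothness at the origin comes from compact support: φ(1/x) vanishes for small x, including x
    -- = 0, where 1/x is read as 0.
    refine hφ.sub (contDiff_iff_contDiffAt.2 fun x => ?_)
    by_cases hx : x = 0
    · have : (fun x => φ x⁻¹) =ᶠ[𝓝 x] fun _ => 0 := by
        have hr : 0 < (|R| + 1)⁻¹ := by positivity
        filter_upwards [Metric.ball_mem_nhds x hr] with z hz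
        rw [hx, mem_ball_zero_iff, Real.norm_eq_abs] at hz
        by_cases hz0 : z = 0
        · rw [hz0, inv_zero]
          exact hE0' 0 (by norm_num)
        · refine hR0 _ ?_
          rw [abs_inv]
          have := (lt_inv_comm₀ (abs_pos.2 hz0) (by positivity)).1 hz
          linarith [le_abs_self R]
      exact contDiffAt_const.congr_of_eventuallyEq this
    · exact hφ.contDiffAt.comp x (contDiffAt_inv ℝ hx)
  have hcs : HasCompactSupport (fun x => φ x - φ x⁻¹) := by
    refine hc.sub (HasCompactSupport.intro (isCompact_Icc (a := (-1 : ℝ)) (b := 1)) fun x hx => ?_)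
    refine hE0' _ ?_
    have h1 : 1 < |x| := by
      by_contra hcon
      exact hx (abs_le.1 (not_lt.1 hcon))
    rw [abs_inv]
    exact inv_le_one_of_one_le₀ h1.le
  obtain ⟨ψ, hψ⟩ := exists_schwartz_mul hsm hcs (m := fun _ => 1) contDiff_const
  have hψ' : ∀ x, ψ x = ((φ x - φ x⁻¹ : ℝ) : ℂ) := fun x => by rw [hψ, one_mul]
  obtain ⟨z, hzψ⟩ := exists_isHalfPlaneDtN_schwartz ψ
  have eψ : ∀ᵐ x : ℝ, (ψ.toLp 2 : L2R) x = ψ x := ψ.coeFn_toLp 2 volume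
  have hodd : ∀ᵐ x : ℝ, (ψ.toLp 2 : L2R) x⁻¹ = -(ψ.toLp 2 : L2R) x := by
    have h1 := ae_surface_inv eψ
    have h2 := ae_inv_of_ae (ae_restrict_of_ae (s := freeSurface) eψ)
    have h3 : ∀ᵐ x : ℝ, x ∉ ({1, -1} : Set ℝ) :=
      measure_eq_zero_iff_ae_notMem.1 ((Set.toFinite _).measure_zero _)
    filter_upwards [ae_of_ae_surface h1, h2, h3, eψ] with x e1 e2 e4 e6
    have e7 : (ψ.toLp 2 : L2R) x⁻¹ = ψ x⁻¹ := by
      rcases lt_trichotomy |x| 1 with hx | hx | hx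
      · exact e2 hx
      · rcases (abs_eq one_pos.le).1 hx with h | h
        · exact absurd (Or.inl h) e4
        · exact absurd (Or.inr h) e4
      · exact e1 hx
    rw [e7, e6, hψ', hψ', inv_inv]
    push_cast
    ring
  have h0 := h.inner_eq_zero_of_odd hzψ hη.comp_inv hodd
  rw [← inner_conj_symm, map_eq_zero, inner_eq_integral] at h0
  have hint := integrable_schwartz_mul ψ w
  have e1 : ∫ x, (starRingEnd ℂ ((ψ.toLp 2 : L2R) x)) * w x = ∫ x, ψ x * w x := by
    refine integral_congr_ae ?_
    filter_upwards [eψ] with x hx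
    rw [hx, hψ', Complex.conj_ofReal]
  rw [e1, integral_inversion hint, ← integral_add hint.integrableOn (integrable_inversion hint)] at h0
  rw [← h0]
  refine integral_congr_ae ?_
  filter_upwards [ae_surface_mem] with y hy
  rw [hψ', hψ', inv_inv, hE0' y⁻¹ (abs_inv_lt_one hy).le, Complex.real_smul]
  push_cast
  ring

/-- The quadratic form of the half-plane operator on reflections is twice the form on the free
surface. -/
lemma inner_reflection {v u r : L2E} {η w ζ : L2R} (hη : IsReflection v η)
    (h : IsHalfPlaneDtN η w) (hr : r =ᵐ[surfaceMeasure] w) (hζ : IsReflection u ζ) :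
    (inner ℂ ζ w : ℂ) = 2 * inner ℂ u r := by
  have hint : Integrable (fun x => (starRingEnd ℂ (ζ x)) * w x) := by
    refine (L2.integrable_inner (𝕜 := ℂ) ζ w).congr (Eventually.of_forall fun x => ?_)
    simp only [RCLike.inner_apply, mul_comm]
  rw [inner_eq_integral, integral_inversion hint, inner_eq_integral, two_mul]
  congr 1
  · refine integral_congr_ae ?_
    filter_upwards [hζ.ae_eq, hr] with y e1 e2
    rw [e1.1, e2]
  · refine integral_congr_ae ?_
    filter_upwards [hζ.ae_eq, hr, h.equivariant hη] with y e1 e2 e3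
    rw [e1.2, e2, ← e3]
    ring

/-! ### Symmetry and form of the Dirichlet-to-Neumann map on bounded supports -/

lemma dtnCore_symm {p q : L2E × L2E × L2E} (hp : p ∈ dtnCore) (hq : q ∈ dtnCore) :
    (inner ℂ p.2.2 q.1 : ℂ) = inner ℂ p.1 q.2.2 := by
  obtain ⟨-, -, η, w, h1, h2, h3⟩ := hp
  obtain ⟨-, -, η', w', h1', h2', h3'⟩ := hq
  have e1 := inner_reflection h1 h2 h3 h1'
  have e2 := inner_reflection h1' h2' h3' h1
  have e3 := h2.inner_symm h2'
  have e4 : (inner ℂ w η' : ℂ) = 2 * inner ℂ p.2.2 q.1 := by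
    rw [← inner_conj_symm, e1, map_mul, inner_conj_symm, Complex.conj_ofNat]
  rw [← e3, e4] at e2
  exact mul_left_cancel₀ two_ne_zero e2

/-- The factor 2 in `IsReflection.gagl_eq` cancels against the one in `inner_reflection`. -/
lemma dtnCore_re {p : L2E × L2E × L2E} (hp : p ∈ dtnCore) :
    0 ≤ (inner ℂ p.2.2 p.1 : ℂ).re ∧ kernelForm kerD p.1 =
      gaglConst * ENNReal.ofReal ((2 * Real.pi)⁻¹ * (inner ℂ p.2.2 p.1 : ℂ).re) := by
  obtain ⟨-, -, η, w, h1, h2, h3⟩ := hp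
  have e1 := inner_reflection h1 h2 h3 h1
  have e4 : (inner ℂ w η : ℂ).re = 2 * (inner ℂ p.2.2 p.1 : ℂ).re := by
    have : (inner ℂ w η : ℂ) = 2 * inner ℂ p.2.2 p.1 := by
      rw [← inner_conj_symm, e1, map_mul, inner_conj_symm, Complex.conj_ofNat]
    rw [this]
    simp
  have h5 := h2.re_inner_nonneg
  refine ⟨by linarith, ?_⟩
  have h6 := h2.gagl_eq
  rw [h1.gagl_eq, e4, show (2 * Real.pi)⁻¹ * (2 * (inner ℂ p.2.2 p.1 : ℂ).re)
    = 2 * ((2 * Real.pi)⁻¹ * (inner ℂ p.2.2 p.1 : ℂ).re) by ring,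
    ENNReal.ofReal_mul (by norm_num), ← mul_assoc, mul_comm gaglConst, mul_assoc,
    ENNReal.ofReal_ofNat] at h6
  exact (ENNReal.mul_right_inj (by simp) (by simp)).1 h6

/-! ### The Neumann operator on the two half-lines -/

/-- `n` is the image of `v` under the square root of the Neumann Laplacian of the two half-lines. -/
def IsNeumann (v n : L2E) : Prop := ∀ b, IsHalfPlaneDtN (evenExt b v) (evenExt b n)

lemma IsNeumann.add {v n v' n' : L2E} (h : IsNeumann v n) (h' : IsNeumann v' n') :
    IsNeumann (v + v') (n + n') := fun b => by
  rw [map_add, map_add]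
  exact (h b).add (h' b)

lemma IsNeumann.smul {v n : L2E} (c : ℂ) (h : IsNeumann v n) : IsNeumann (c • v) (c • n) :=
  fun b => by
    rw [map_smul, map_smul]
    exact (h b).smul c

lemma IsNeumann.symm {v n v' n' : L2E} (h : IsNeumann v n) (h' : IsNeumann v' n') :
    (inner ℂ n v' : ℂ) = inner ℂ v n' := by
  have e1 := inner_evenExt_add n v'
  have e2 := inner_evenExt_add v n'
  rw [(h true).inner_symm (h' true), (h false).inner_symm (h' false), e2] at e1
  exact (mul_left_cancel₀ two_ne_zero e1).symm

lemma IsNeumann.re {v n : L2E} (h : IsNeumann v n) :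
    0 ≤ (inner ℂ n v : ℂ).re ∧ kernelForm kerN v =
      gaglConst * ENNReal.ofReal ((2 * Real.pi)⁻¹ * (inner ℂ n v : ℂ).re) := by
  have e1 := congrArg Complex.re (inner_evenExt_add n v)
  rw [Complex.add_re] at e1
  simp only [Complex.mul_re, Complex.re_ofNat, Complex.im_ofNat, zero_mul, sub_zero] at e1
  have h1 := (h true).re_inner_nonneg
  have h2 := (h false).re_inner_nonneg
  refine ⟨by linarith, ?_⟩
  have h3 := gagl_evenExt_add v
  rw [(h true).gagl_eq, (h false).gagl_eq, ← mul_add,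
    ← ENNReal.ofReal_add (by positivity) (by positivity), ← mul_add, e1,
    show (2 * Real.pi)⁻¹ * (2 * (inner ℂ n v : ℂ).re)
    = 2 * ((2 * Real.pi)⁻¹ * (inner ℂ n v : ℂ).re) by ring,
    ENNReal.ofReal_mul (by norm_num), ← mul_assoc, mul_comm gaglConst, mul_assoc,
    ENNReal.ofReal_ofNat] at h3
  exact ((ENNReal.mul_right_inj (by simp) (by simp)).1 h3).symm

lemma enorm_frequency (ξ : ℝ) : ‖((2 * Real.pi * |ξ| : ℝ) : ℂ)‖ₑ = ‖2 * Real.pi * ξ‖ₑ := by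
  rw [← ofReal_norm (Complex.ofReal _), ← ofReal_norm (2 * Real.pi * ξ), Complex.norm_real]
  simp

lemma IsNeumann.energy_eq {v n : L2E} (h : IsNeumann v n) :
    energy (fun ξ => ‖2 * Real.pi * ξ‖ₑ ^ 2) v = 2 * ‖n‖ₑ ^ 2 := by
  rw [← energy_one, energy, energy]
  congr 1 <;>
  · refine lintegral_congr_ae ?_
    filter_upwards [h _] with ξ hξ
    simp only [spec]
    rw [hξ, one_mul, enorm_mul (Complex.ofReal _), mul_pow, enorm_frequency]

lemma IsNeumann.mem_sobolevOne {v n : L2E} (h : IsNeumann v n) : v ∈ sobolevOne := by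
  rw [mem_sobolevOne_iff, h.energy_eq]
  finiteness

/-- Both are the energy of weight |2πξ|². In particular, convergence of weak derivatives is
convergence of the images under N. -/
lemma IsNeumann.norm_eq {v n d : L2E} (h : IsNeumann v n) (hd : IsWeakDeriv v d) : ‖n‖ = ‖d‖ := by
  have h1 := h.energy_eq
  rw [hd.energy_eq, ENNReal.mul_right_inj (by simp) (by simp)] at h1
  have h2 := (ENNReal.pow_right_strictMono two_ne_zero).injective h1
  rw [← toReal_enorm, ← toReal_enorm, h2]

/-- The symbol 2π|ξ| is even, so the product is again the spectrum of an even extension. -/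
lemma exists_isNeumann {v : L2E} (hv : v ∈ sobolevOne) : ∃ n, IsNeumann v n := by
  rw [mem_sobolevOne_iff, energy_ne_top_iff] at hv
  obtain ⟨n, hn⟩ := exists_spec_mul (m := fun ξ => ((2 * Real.pi * |ξ| : ℝ) : ℂ)) (v := v)
    (by
      have : Measurable (fun x : ℝ => |x|) := measurable_norm
      fun_prop) (fun ξ => by rw [abs_neg]) (fun b => by
      refine ne_of_eq_of_ne (lintegral_congr fun ξ => ?_) (hv b)
      rw [enorm_frequency])
  exact ⟨n, fun b => hn b⟩

/-! ### Approximation by functions with bounded support -/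

lemma exists_L2E_mul {m : ℝ → ℂ} (hm : Measurable m) {C : ℝ} (hC : ∀ᵐ x ∂surfaceMeasure, ‖m x‖ ≤ C)
    (v : L2E) : ∃ u : L2E, u =ᵐ[surfaceMeasure] fun x => m x * v x := by
  have h : MemLp (fun x => m x * v x) 2 surfaceMeasure := by
    refine (Lp.memLp v).of_le_mul (c := C)
      (hm.aestronglyMeasurable.mul (Lp.aestronglyMeasurable v)) ?_
    filter_upwards [hC] with x hx
    rw [norm_mul]
    gcongr
  exact ⟨h.toLp _, h.coeFn_toLp⟩

lemma tendsto_L2E_of_dominated {f : ℕ → L2E} {f₀ v : L2E} {C : ℝ}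
    (hb : ∀ n, ∀ᵐ x ∂surfaceMeasure, ‖f n x - f₀ x‖ ≤ C * ‖v x‖)
    (hl : ∀ᵐ x ∂surfaceMeasure, Tendsto (fun n => f n x) atTop (𝓝 (f₀ x))) :
    Tendsto f atTop (𝓝 f₀) := by
  have h1 : Tendsto (fun n => ∫⁻ x, ‖f n x - f₀ x‖ₑ ^ 2 ∂surfaceMeasure) atTop
      (𝓝 (∫⁻ x, 0 ∂surfaceMeasure)) := by
    refine tendsto_lintegral_of_dominated_convergence
      (fun x => (ENNReal.ofReal C * ‖v x‖ₑ) ^ 2) (fun n => ?_) (fun n => ?_) ?_ ?_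
    · have := measurable_L2E (f n)
      have := measurable_L2E f₀
      fun_prop
    · filter_upwards [hb n] with x hx
      gcongr
      rcases le_total 0 C with h0 | h0
      · rw [← ofReal_norm, ← ofReal_norm, ← ENNReal.ofReal_mul h0]
        exact ENNReal.ofReal_le_ofReal hx
      · have h2 : ‖f n x - f₀ x‖ = 0 := le_antisymm
          (hx.trans (mul_nonpos_of_nonpos_of_nonneg h0 (norm_nonneg _))) (norm_nonneg _)
        rw [← ofReal_norm, h2, ENNReal.ofReal_zero]
        exact zero_le
    · have := measurable_L2E v
      simp only [mul_pow]
      rw [lintegral_const_mul _ (by fun_prop), lintegral_enorm_sq]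
      finiteness
    · filter_upwards [hl] with x hx
      have h3 : Tendsto (fun n => ‖f n x - f₀ x‖ₑ ^ 2) atTop (𝓝 (‖f₀ x - f₀ x‖ₑ ^ 2)) :=
        ((ENNReal.continuous_pow 2).tendsto _).comp
          ((continuous_enorm.tendsto _).comp (hx.sub_const (f₀ x)))
      simpa using h3
  have h2 : ∀ n, ∫⁻ x, ‖f n x - f₀ x‖ₑ ^ 2 ∂surfaceMeasure = ENNReal.ofReal (‖f n - f₀‖ ^ 2) := by
    intro n
    rw [ENNReal.ofReal_pow (norm_nonneg _), ofReal_norm, ← lintegral_enorm_sq]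
    refine lintegral_congr_ae ?_
    filter_upwards [Lp.coeFn_sub (f n) f₀] with x hx
    rw [hx, Pi.sub_apply]
  simp only [h2, lintegral_zero] at h1
  have h3 := (ENNReal.tendsto_toReal ENNReal.zero_ne_top).comp h1
  rw [tendsto_iff_norm_sub_tendsto_zero]
  have h4 : Tendsto (fun n => ‖f n - f₀‖ ^ 2) atTop (𝓝 0) := by
    refine h3.congr fun n => ?_
    rw [Function.comp_apply, ENNReal.toReal_ofReal (by positivity)]
  have h5 := h4.sqrt
  rw [Real.sqrt_zero] at h5
  exact h5.congr fun n => Real.sqrt_sq (norm_nonneg _)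

lemma IsWeakDeriv.mul_smooth {v d v' d' : L2E} (h : IsWeakDeriv v d) {χ : ℝ → ℝ}
    (hχ : ContDiff ℝ ∞ χ) (hv : v' =ᵐ[surfaceMeasure] fun x => χ x • v x)
    (hd : d' =ᵐ[surfaceMeasure] fun x => χ x • d x + deriv χ x • v x) : IsWeakDeriv v' d' := by
  intro φ hφ hc hs
  have hφ' : Continuous (deriv φ) := hφ.continuous_deriv (by simp)
  have hχ' : Continuous (deriv χ) := hχ.continuous_deriv (by simp)
  have key := h (fun x => φ x * χ x) (hφ.mul hχ) hc.mul_right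
    ((tsupport_mul_subset_left).trans hs)
  have hder : ∀ x, deriv (fun x => φ x * χ x) x = deriv φ x * χ x + φ x * deriv χ x := by
    intro x
    have h2 : HasDerivAt (fun x => φ x * χ x) _ x :=
      ((hφ.differentiable (by simp) x).hasDerivAt).mul ((hχ.differentiable (by simp) x).hasDerivAt)
    rw [h2.deriv]
  have i1 := integrable_bdd_smul (hφ'.mul hχ.continuous) (hc.deriv.mul_right (f' := χ)) v
  have i2 := integrable_bdd_smul (hφ.continuous.mul hχ') (hc.mul_right (f' := deriv χ)) v
  have i3 := integrable_bdd_smul (hφ.continuous.mul hχ.continuous) (hc.mul_right (f' := χ)) d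
  simp only [hder, add_smul] at key
  simp only [Pi.mul_apply] at i1 i2 i3
  rw [integral_add i1 i2] at key
  have e1 : ∫ x, deriv φ x • v' x ∂surfaceMeasure
      = ∫ x, (deriv φ x * χ x) • v x ∂surfaceMeasure := by
    refine integral_congr_ae ?_
    filter_upwards [hv] with x hx
    rw [hx, smul_smul]
  have e2 : ∫ x, φ x • d' x ∂surfaceMeasure = ∫ x, (φ x * χ x) • d x ∂surfaceMeasure
      + ∫ x, (φ x * deriv χ x) • v x ∂surfaceMeasure := by
    rw [← integral_add i3 i2]
    refine integral_congr_ae ?_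
    filter_upwards [hd] with x hx
    rw [hx, smul_add, smul_smul, smul_smul]
  rw [e1, e2, neg_add, ← key]
  ring

/-- The reflection of an element of `W^{1,2}` with bounded support belongs to `W^{1,2}(ℝ)`. -/
lemma IsReflection.exists_isLineWeakDeriv {v d : L2E} {η : L2R} (hη : IsReflection v η)
    (h : IsWeakDeriv v d) (hd : ∃ a : ℝ, ∀ᵐ x ∂surfaceMeasure, a < |x| → d x = 0) :
    ∃ D : L2R, IsLineWeakDeriv η D := by
  obtain ⟨a, ha⟩ := hd
  have hdm := measurable_L2E d
  -- Inside the unit interval the derivative of v(1/x) is -x⁻²v'(1/x). After inversion its square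
  -- carries the weight y², bounded by a² because d has bounded support.
  set f : ℝ → ℂ := fun x => if 1 < |x| then d x else -(((x ^ 2)⁻¹ : ℝ) : ℂ) * d x⁻¹ with hf
  have hfm : Measurable f := Measurable.ite measurableSet_freeSurface hdm (by fun_prop)
  have hf1 : ∀ y ∈ freeSurface, f y = d y := fun y hy => if_pos hy
  have hf2 : ∀ y ∈ freeSurface, f y⁻¹ = -((y ^ 2 : ℝ) : ℂ) * d y := fun y hy => by
    simp only [hf]
    rw [if_neg (not_lt.2 (abs_inv_lt_one hy).le), inv_inv, inv_pow, inv_inv]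
  have hml : MemLp f 2 := by
    rw [memLp_iff_lintegral hfm, lintegral_inversion (by fun_prop)]
    refine lt_of_le_of_lt (b := ∫⁻ y, (1 + ENNReal.ofReal (a ^ 2)) * ‖d y‖ₑ ^ 2 ∂surfaceMeasure)
      (lintegral_mono_ae ?_) ?_
    · filter_upwards [ae_surface_mem, ha] with y hy hay
      have hy0 := ne_zero_of_mem hy
      rw [hf1 y hy, hf2 y hy, add_mul, one_mul, inv_sq_enorm hy0]
      refine add_le_add le_rfl ?_
      by_cases hlt : a < |y|
      · rw [hay hlt]
        simp
      · rw [enorm_mul, mul_pow, mul_right_comm]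
        gcongr
        rw [enorm_neg, ← ofReal_norm, Complex.norm_real, Real.norm_eq_abs, abs_sq,
          ← ENNReal.ofReal_pow (by positivity), ← ENNReal.ofReal_mul (by positivity)]
        refine ENNReal.ofReal_le_ofReal ?_
        rw [pow_two (y ^ 2), mul_inv_cancel_right₀ (by positivity)]
        exact sq_le_sq.2 ((not_lt.1 hlt).trans (le_abs_self a))
    · rw [lintegral_const_mul _ (by fun_prop), lintegral_enorm_sq]
      finiteness
  have hD := hml.coeFn_toLp
  refine ⟨hml.toLp f, fun ψ => ?_⟩
  obtain ⟨C, hC0, hC1, hC2⟩ := schwartz_bound ψ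
  have hψd : ∀ x, HasDerivAt ψ (deriv ψ x) x := fun x => ψ.differentiableAt.hasDerivAt
  have hχd : ∀ y ∈ freeSurface, HasDerivAt (fun y => ψ y - ψ y⁻¹)
      (deriv ψ y + (((y ^ 2)⁻¹ : ℝ) : ℂ) * deriv ψ y⁻¹) y := by
    intro y hy
    have h1 := (hψd y⁻¹).scomp y (hasDerivAt_inv (ne_zero_of_mem hy))
    have h2 : HasDerivAt (fun y => ψ y - ψ y⁻¹) _ y := (hψd y).sub h1
    convert h2 using 1
    rw [Complex.real_smul]
    push_cast
    ring
  have hi1 := integrable_deriv_schwartz_mul ψ η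
  have hi2 := integrable_schwartz_mul ψ (hml.toLp f)
  have j1 := integrable_inversion hi1
  have j2 := integrable_inversion hi2
  have eD1 : ∀ᵐ y ∂surfaceMeasure, (hml.toLp f : L2R) y = d y := by
    filter_upwards [ae_restrict_of_ae hD, ae_surface_mem] with y h1 hy
    rw [h1, hf1 y hy]
  have eD2 : ∀ᵐ y ∂surfaceMeasure, (hml.toLp f : L2R) y⁻¹ = -((y ^ 2 : ℝ) : ℂ) * d y := by
    filter_upwards [ae_surface_inv hD, ae_surface_mem] with y h1 hy
    rw [h1, hf2 y hy]
  have c1 : (fun y => deriv (fun y => ψ y - ψ y⁻¹) y * v y) =ᵐ[surfaceMeasure] fun y =>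
      deriv ψ y * η y + (((y ^ 2)⁻¹ : ℝ) : ℂ) * (deriv ψ y⁻¹ * η y⁻¹) := by
    filter_upwards [hη.ae_eq, ae_surface_mem] with y h1 hy
    rw [(hχd y hy).deriv, h1.1, h1.2]
    ring
  have c2 : (fun y => (ψ y - ψ y⁻¹) * d y) =ᵐ[surfaceMeasure] fun y =>
      ψ y * hml.toLp f y + (((y ^ 2)⁻¹ : ℝ) : ℂ) * (ψ y⁻¹ * hml.toLp f y⁻¹) := by
    filter_upwards [eD1, eD2, ae_surface_mem] with y h1 h2 hy
    have hy0 : (y : ℂ) ≠ 0 := Complex.ofReal_ne_zero.2 (ne_zero_of_mem hy)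
    rw [h1, h2]
    push_cast
    field_simp
    ring
  rw [integral_inversion hi1, integral_inversion hi2, ← integral_add hi1.integrableOn j1,
    ← integral_add hi2.integrableOn j2, ← integral_congr_ae c1, ← integral_congr_ae c2]
  -- The combination ψ(y) - ψ(1/y) vanishes at |y| = 1, and |y - 1/y| ≤ 2(|y| - 1). The
  -- contributions of the two sides of an end point thus cancel.
  refine h.integral_of_vanishing (C := 2 * C) ?_ ?_ ?_ ?_ ?_
  · intro y hy
    exact ((ψ.smooth ⊤).contDiffAt.sub ((ψ.smooth ⊤).contDiffAt.comp y
      (contDiffAt_inv ℝ (ne_zero_of_mem hy)))).contDiffWithinAt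
  · intro y _
    exact (norm_sub_le _ _).trans (by linarith [hC1 y, hC1 y⁻¹])
  · intro y hy
    have hy1 : 1 < |y| := hy
    refine (hC2 _ _).trans ?_
    have hy0 := ne_zero_of_mem hy
    have e : |y - y⁻¹| ≤ 2 * (|y| - 1) := by
      have e1 : y - y⁻¹ = (y ^ 2 - 1) / y := by field_simp
      rw [e1, abs_div, div_le_iff₀ (by positivity), ← sq_abs, abs_of_nonneg (by nlinarith)]
      nlinarith
    calc C * |y - y⁻¹| ≤ C * (2 * (|y| - 1)) := by gcongr
      _ = _ := by ring
  · exact (hi1.integrableOn.add j1).congr c1.symm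
  · exact (hi2.integrableOn.add j2).congr c2.symm

lemma exists_mem_dtnCore {v d : L2E} (h : IsWeakDeriv v d)
    (hv : ∃ a : ℝ, ∀ᵐ x ∂surfaceMeasure, a < |x| → v x = 0)
    (hd : ∃ a : ℝ, ∀ᵐ x ∂surfaceMeasure, a < |x| → d x = 0) : ∃ w, (v, d, w) ∈ dtnCore := by
  obtain ⟨η, hη⟩ := exists_isReflection v
  obtain ⟨D, hD⟩ := hη.exists_isLineWeakDeriv h hd
  obtain ⟨w, hw⟩ := exists_isHalfPlaneDtN (η := η) (by
    rw [hD.lintegral_eq]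
    finiteness)
  have hwm : MemLp w 2 surfaceMeasure := (Lp.memLp w).restrict _
  exact ⟨hwm.toLp w, h, hv, η, w, hη, hw, hwm.coeFn_toLp⟩

lemma outerCut_of_lt {n x : ℝ} (hn : 0 < n) (hx : 2 * n + 1 < |x|) :
    outerCut n x = 0 ∧ deriv (outerCut n) x = 0 := by
  have key : ∀ z : ℝ, 2 * n + 1 < |z| → outerCut n z = 0 := by
    intro z hz
    refine Real.smoothTransition.zero_of_nonpos ?_
    rw [sub_nonpos, le_div_iff₀ hn, ← sq_abs]
    nlinarith
  refine ⟨key x hx, ?_⟩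
  have : outerCut n =ᶠ[𝓝 x] fun _ => 0 := by
    filter_upwards [(isOpen_lt continuous_const continuous_abs).mem_nhds hx] with z hz
    exact key z hz
  rw [this.deriv_eq, deriv_const]

/-- Elements of `W^{1,2}` are approximated by elements with bounded support. -/
lemma exists_dtnCore_tendsto {v d : L2E} (h : IsWeakDeriv v d) :
    ∃ p : ℕ → L2E × L2E × L2E, (∀ n, p n ∈ dtnCore) ∧
      Tendsto (fun n => (p n).1) atTop (𝓝 v) ∧ Tendsto (fun n => (p n).2.1) atTop (𝓝 d) := by
  obtain ⟨M, hM0, hM⟩ := exists_deriv_smoothTransition_bound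
  have hcm : ∀ n : ℕ, Measurable fun x => ((outerCut (n + 1 : ℕ) x : ℝ) : ℂ) := fun n =>
    Complex.measurable_ofReal.comp (contDiff_outerCut _).continuous.measurable
  have hdm : ∀ n : ℕ, Measurable fun x => ((deriv (outerCut (n + 1 : ℕ)) x : ℝ) : ℂ) := fun n =>
    Complex.measurable_ofReal.comp
      ((contDiff_outerCut _).continuous_deriv (by simp)).measurable
  have hn0 : ∀ n : ℕ, (0 : ℝ) < ((n + 1 : ℕ) : ℝ) := fun n => by positivity
  have hcb : ∀ (n : ℕ) (x : ℝ), ‖((outerCut (n + 1 : ℕ) x : ℝ) : ℂ)‖ ≤ 1 := fun n x => by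
    rw [Complex.norm_real, Real.norm_eq_abs, abs_of_nonneg (outerCut_nonneg _ _)]
    exact outerCut_le_one _ _
  have hdb : ∀ n : ℕ, ∀ᵐ x ∂surfaceMeasure,
      ‖((deriv (outerCut (n + 1 : ℕ)) x : ℝ) : ℂ)‖ ≤ 4 * M := fun n => by
    filter_upwards [ae_surface_mem] with x hx
    have hx1 : 1 < |x| := hx
    rw [Complex.norm_real, Real.norm_eq_abs]
    refine (abs_deriv_outerCut_le hM (hn0 n) hx).trans (mul_le_of_le_one_right (by positivity) ?_)
    exact inv_le_one_of_one_le₀ hx1.le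
  choose V hV using fun n => exists_L2E_mul (hcm n) (Eventually.of_forall (hcb n)) v
  choose D hD using fun n => exists_L2E_mul (hcm n) (Eventually.of_forall (hcb n)) d
  choose E hE using fun n => exists_L2E_mul (hdm n) (hdb n) v
  have hlim : ∀ (u : L2E) (U : ℕ → L2E), (∀ n, U n =ᵐ[surfaceMeasure]
      fun x => ((outerCut (n + 1 : ℕ) x : ℝ) : ℂ) * u x) → Tendsto U atTop (𝓝 u) := by
    intro u U hU
    refine tendsto_L2E_of_dominated (v := u) (C := 2) (fun n => ?_) ?_
    · filter_upwards [hU n] with x hx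
      rw [hx]
      refine (norm_sub_le _ _).trans ?_
      rw [norm_mul]
      nlinarith [hcb n x, norm_nonneg (u x)]
    · filter_upwards [ae_all_iff.2 hU] with x hx
      refine tendsto_const_nhds.congr' ?_
      filter_upwards [(tendsto_add_atTop_nat 1).eventually (outerCut_eventually x)] with n hn
      rw [hx n, hn.1, Complex.ofReal_one, one_mul]
  -- The term in which the cut-off is differentiated: dominated by 4M|v|, and pointwise eventually
  -- zero.
  have hElim : Tendsto E atTop (𝓝 0) := by
    refine tendsto_L2E_of_dominated (v := v) (C := 4 * M) (fun n => ?_) ?_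
    · filter_upwards [hE n, hdb n, Lp.coeFn_zero ℂ 2 surfaceMeasure] with x hx h1 h2
      rw [hx, h2, Pi.zero_apply, sub_zero, norm_mul]
      gcongr
    · filter_upwards [ae_all_iff.2 hE, Lp.coeFn_zero ℂ 2 surfaceMeasure] with x hx h2
      rw [h2]
      refine tendsto_const_nhds.congr' ?_
      filter_upwards [(tendsto_add_atTop_nat 1).eventually (outerCut_eventually x)] with n hn
      rw [hx n, hn.2, Complex.ofReal_zero, zero_mul, Pi.zero_apply]
  have hw : ∀ n, IsWeakDeriv (V n) (D n + E n) := fun n => by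
    refine h.mul_smooth (contDiff_outerCut (n + 1 : ℕ)) ?_ ?_
    · filter_upwards [hV n] with x hx
      rw [hx, Complex.real_smul]
    · filter_upwards [hD n, hE n, Lp.coeFn_add (D n) (E n)] with x h1 h2 h3
      rw [h3, Pi.add_apply, h1, h2, Complex.real_smul, Complex.real_smul]
  have hcore : ∀ n, ∃ w, (V n, D n + E n, w) ∈ dtnCore := fun n => by
    refine exists_mem_dtnCore (hw n) ⟨2 * (n + 1 : ℕ) + 1, ?_⟩ ⟨2 * (n + 1 : ℕ) + 1, ?_⟩
    · filter_upwards [hV n] with x hx hlt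
      rw [hx, (outerCut_of_lt (hn0 n) hlt).1, Complex.ofReal_zero, zero_mul]
    · filter_upwards [hD n, hE n, Lp.coeFn_add (D n) (E n)] with x h1 h2 h3 hlt
      rw [h3, Pi.add_apply, h1, h2, (outerCut_of_lt (hn0 n) hlt).1,
        (outerCut_of_lt (hn0 n) hlt).2, Complex.ofReal_zero, zero_mul, zero_mul, add_zero]
  choose W hW using hcore
  refine ⟨fun n => (V n, D n + E n, W n), hW, hlim v V hV, ?_⟩
  simpa using (hlim d D hD).add hElim

/-! ### Spectral cut-offs -/

lemma energy_mul {m : ℝ → ℂ} {u v : L2E} (h : ∀ b, ∀ᵐ ξ : ℝ, spec b u ξ = m ξ * spec b v ξ)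
    (k : ℝ → ℝ≥0∞) : energy k u = energy (fun ξ => k ξ * ‖m ξ‖ₑ ^ 2) v := by
  have hb : ∀ b, ∫⁻ ξ, k ξ * ‖spec b u ξ‖ₑ ^ 2
      = ∫⁻ ξ, k ξ * ‖m ξ‖ₑ ^ 2 * ‖spec b v ξ‖ₑ ^ 2 := fun b => by
    refine lintegral_congr_ae ?_
    filter_upwards [h b] with ξ hξ
    rw [hξ, enorm_mul, mul_pow, mul_assoc]
  rw [energy, energy, hb, hb]

lemma energy_mono {k m : ℝ → ℝ≥0∞} (h : ∀ ξ, k ξ ≤ m ξ) (v : L2E) : energy k v ≤ energy m v :=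
  add_le_add (lintegral_mono fun ξ => by gcongr; exact h ξ)
    (lintegral_mono fun ξ => by gcongr; exact h ξ)

lemma measurable_spec (b : Bool) (v : L2E) : Measurable (spec b v) := measurable_L2R _

lemma energy_const_mul {c : ℝ≥0∞} {m : ℝ → ℝ≥0∞} (hm : Measurable m) (v : L2E) :
    energy (fun ξ => c * m ξ) v = c * energy m v := by
  have h1 := measurable_spec true v
  have h2 := measurable_spec false v
  simp only [energy, mul_assoc]
  rw [lintegral_const_mul _ (by fun_prop), lintegral_const_mul _ (by fun_prop), mul_add]

lemma exists_spec_indicator {S : Set ℝ} (hS : MeasurableSet S) (he : ∀ ξ, -ξ ∈ S ↔ ξ ∈ S)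
    (v : L2E) : ∃ u : L2E, ∀ b, ∀ᵐ ξ : ℝ, spec b u ξ = S.indicator 1 ξ * spec b v ξ := by
  refine exists_spec_mul (measurable_one.indicator hS) (fun ξ => ?_) (energy_ne_top_iff.1 ?_)
  · by_cases h : ξ ∈ S
    · rw [Set.indicator_of_mem h, Set.indicator_of_mem ((he ξ).2 h)]
      rfl
    · rw [Set.indicator_of_notMem h, Set.indicator_of_notMem (mt (he ξ).1 h)]
  · refine ne_top_of_le_ne_top ?_ (energy_mono (m := fun _ => 1) (fun ξ => ?_) v)
    · rw [energy_one]
      finiteness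
    · by_cases h : ξ ∈ S
      · simp [h]
      · simp [h]

lemma enorm_indicator_one_sq (S : Set ℝ) (ξ : ℝ) :
    ‖S.indicator (1 : ℝ → ℂ) ξ‖ₑ ^ 2 = S.indicator 1 ξ := by
  by_cases h : ξ ∈ S
  · simp [h]
  · simp [h]

lemma spec_sub_indicator {S : Set ℝ} {u v : L2E}
    (h : ∀ b, ∀ᵐ ξ : ℝ, spec b u ξ = S.indicator 1 ξ * spec b v ξ) (b : Bool) :
    ∀ᵐ ξ : ℝ, spec b (v - u) ξ = Sᶜ.indicator 1 ξ * spec b v ξ := by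
  rw [spec_sub]
  filter_upwards [h b, Lp.coeFn_sub (spec b v) (spec b u)] with ξ h1 h2
  rw [h2, Pi.sub_apply, h1]
  by_cases hξ : ξ ∈ S
  · simp [hξ]
  · simp [hξ]

lemma energy_tendsto_zero {v : L2E} {m : ℝ → ℝ≥0∞} (hv : energy m v ≠ ⊤)
    {k : ℕ → ℝ → ℝ≥0∞} (hk : ∀ n, Measurable (k n)) (hle : ∀ n ξ, k n ξ ≤ m ξ)
    (hl : ∀ ξ, ∀ᶠ n in atTop, k n ξ = 0) : Tendsto (fun n => energy (k n) v) atTop (𝓝 0) := by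
  have hb : ∀ b, Tendsto (fun n => ∫⁻ ξ, k n ξ * ‖spec b v ξ‖ₑ ^ 2) atTop
      (𝓝 (∫⁻ ξ : ℝ, 0)) := fun b => by
    have h1 := measurable_spec b v
    refine tendsto_lintegral_of_dominated_convergence (fun ξ => m ξ * ‖spec b v ξ‖ₑ ^ 2)
      (fun n => ?_) (fun n => ?_) (energy_ne_top_iff.1 hv b) (Eventually.of_forall fun ξ => ?_)
    · have := hk n
      fun_prop
    · refine Eventually.of_forall fun ξ => ?_
      have := hle n ξ
      dsimp only
      gcongr
    · refine tendsto_const_nhds.congr' ?_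
      filter_upwards [hl ξ] with n hn
      rw [hn, zero_mul]
  have := (hb true).add (hb false)
  simpa [energy] using this

/-- The spectral cut-offs of `v` to the frequencies of modulus at most `n`. -/
lemma exists_cutoff (v : L2E) : ∃ u : ℕ → L2E, ∀ (n : ℕ) b, ∀ᵐ ξ : ℝ,
    spec b (u n) ξ = {ξ : ℝ | |ξ| ≤ n}.indicator 1 ξ * spec b v ξ := by
  have h := fun n : ℕ => exists_spec_indicator (S := {ξ : ℝ | |ξ| ≤ n})
    (measurableSet_le (measurable_norm (α := ℝ)) measurable_const)
    (fun ξ => by rw [Set.mem_ofPred_eq, Set.mem_ofPred_eq, abs_neg]) v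
  choose u hu using h
  exact ⟨u, hu⟩

lemma measurableSet_cutoff (n : ℕ) : MeasurableSet {ξ : ℝ | |ξ| ≤ n} :=
  measurableSet_le (measurable_norm (α := ℝ)) measurable_const

lemma cutoff_energy_tendsto {v : L2E} {u : ℕ → L2E} (hu : ∀ (n : ℕ) b, ∀ᵐ ξ : ℝ,
      spec b (u n) ξ = {ξ : ℝ | |ξ| ≤ n}.indicator 1 ξ * spec b v ξ)
    {m : ℝ → ℝ≥0∞} (hm : Measurable m) (hv : energy m v ≠ ⊤) :
    Tendsto (fun n => energy m (v - u n)) atTop (𝓝 0) := by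
  have h : ∀ n, energy m (v - u n)
      = energy (fun ξ => m ξ * {ξ : ℝ | |ξ| ≤ n}ᶜ.indicator 1 ξ) v := fun n => by
    rw [energy_mul (spec_sub_indicator (hu n))]
    simp only [enorm_indicator_one_sq]
  simp only [h]
  refine energy_tendsto_zero hv
    (fun n => hm.mul (measurable_one.indicator (measurableSet_cutoff n).compl)) (fun n ξ => ?_)
    (fun ξ => ?_)
  · refine mul_le_of_le_one_right' ?_
    exact Set.indicator_le_self' (fun _ _ => zero_le) ξ
  · obtain ⟨N, hN⟩ := exists_nat_ge |ξ|
    filter_upwards [eventually_ge_atTop N] with n hn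
    have : ξ ∈ {ξ : ℝ | |ξ| ≤ n} := hN.trans (by exact_mod_cast hn)
    rw [Set.indicator_of_notMem (by simpa using this), mul_zero]

lemma tendsto_of_energy_one {v : L2E} {u : ℕ → L2E}
    (h : Tendsto (fun n => energy (fun _ => 1) (v - u n)) atTop (𝓝 0)) :
    Tendsto u atTop (𝓝 v) := by
  simp only [energy_one] at h
  rw [tendsto_iff_norm_sub_tendsto_zero]
  have h3 := (ENNReal.tendsto_toReal ENNReal.zero_ne_top).comp h
  have h4 := h3.sqrt
  rw [ENNReal.toReal_zero, Real.sqrt_zero] at h4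
  refine squeeze_zero (fun _ => norm_nonneg _) (fun n => ?_) h4
  rw [Function.comp_apply, ENNReal.toReal_mul, ENNReal.toReal_pow, toReal_enorm,
    ENNReal.toReal_ofNat, norm_sub_rev]
  refine Real.le_sqrt_of_sq_le ?_
  nlinarith [sq_nonneg ‖v - u n‖]

lemma cutoff_mem_sobolevOne {v : L2E} {u : ℕ → L2E} (hu : ∀ (n : ℕ) b, ∀ᵐ ξ : ℝ,
      spec b (u n) ξ = {ξ : ℝ | |ξ| ≤ n}.indicator 1 ξ * spec b v ξ) (n : ℕ) :
    u n ∈ sobolevOne := by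
  rw [mem_sobolevOne_iff, energy_mul (hu n)]
  refine ne_top_of_le_ne_top (b := ENNReal.ofReal (2 * Real.pi * n) ^ 2 * energy (fun _ => 1) v)
    ?_ ?_
  · rw [energy_one]
    finiteness
  · rw [← energy_const_mul measurable_const]
    refine energy_mono (fun ξ => ?_) v
    rw [enorm_indicator_one_sq]
    by_cases h : ξ ∈ {ξ : ℝ | |ξ| ≤ n}
    · rw [Set.indicator_of_mem h, Pi.one_apply, mul_one, mul_one, ← ofReal_norm]
      gcongr
      rw [norm_mul, Real.norm_of_nonneg (by positivity)]
      gcongr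
      exact h
    · rw [Set.indicator_of_notMem h, mul_zero]
      exact zero_le

/-- Spectral cut-offs have bounded frequencies, hence lie in W^{1,2}, and they converge in L². -/
lemma dense_sobolevOne : Dense sobolevOne := by
  intro v
  obtain ⟨u, hu⟩ := exists_cutoff v
  refine mem_closure_of_tendsto (tendsto_of_energy_one (cutoff_energy_tendsto hu measurable_const ?_))
    (Eventually.of_forall (cutoff_mem_sobolevOne hu))
  rw [energy_one]
  finiteness

lemma dense_fst_dtnCore : Dense {v : L2E | ∃ p ∈ dtnCore, p.1 = v} := by
  refine Dense.of_closure (dense_sobolevOne.mono fun v hv => ?_)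
  obtain ⟨d, hd⟩ := hv
  obtain ⟨p, hp, h1, -⟩ := exists_dtnCore_tendsto hd
  exact mem_closure_of_tendsto h1 (Eventually.of_forall fun n => ⟨p n, hp n, rfl⟩)

section Abstract

variable {H : Type*} [NormedAddCommGroup H] [InnerProductSpace ℂ H]

/-- A symmetric relation with dense domain and bounded quadratic form is bounded. -/
lemma norm_le_of_form_le {P : Submodule ℂ (H × H)}
    (hs : ∀ p ∈ P, ∀ q ∈ P, (inner ℂ p.2 q.1 : ℂ) = inner ℂ p.1 q.2) {C : ℝ} (hC0 : 0 < C)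
    (hC : ∀ p ∈ P, |(inner ℂ p.2 p.1 : ℂ).re| ≤ C * ‖p.1‖ ^ 2)
    (hd : Dense {x : H | ∃ p ∈ P, p.1 = x}) {p : H × H} (hp : p ∈ P) : ‖p.2‖ ≤ C * ‖p.1‖ := by
  have key : ∀ y : H, (inner ℂ p.2 y : ℂ).re ≤ C / 2 * (‖p.1‖ ^ 2 + ‖y‖ ^ 2) := by
    intro y
    refine hd.induction (P := fun y => (inner ℂ p.2 y : ℂ).re ≤ C / 2 * (‖p.1‖ ^ 2 + ‖y‖ ^ 2))
      ?_ (isClosed_le (by fun_prop) (by fun_prop)) y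
    rintro _ ⟨q, hq, rfl⟩
    -- Polarization: 4 Re⟨p.2, q.1⟩ is the form at p + q minus the form at p - q, and the
    -- parallelogram law turns the bound into 2C(‖p.1‖² + ‖q.1‖²).
    have h1 := (abs_le.1 (hC _ (P.add_mem hp hq))).2
    have h2 := (abs_le.1 (hC _ (P.sub_mem hp hq))).1
    have h3 : (inner ℂ q.2 p.1 : ℂ).re = (inner ℂ p.2 q.1 : ℂ).re := by
      rw [hs p hp q hq, ← inner_conj_symm, Complex.conj_re]
    have h4 := parallelogram_law_with_norm ℂ p.1 q.1
    simp only [Prod.fst_add, Prod.snd_add, Prod.fst_sub, Prod.snd_sub, inner_add_left,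
      inner_add_right, inner_sub_left, inner_sub_right, Complex.add_re, Complex.sub_re, h3]
      at h1 h2
    nlinarith
  -- By density any vector may be inserted. The choice y = C⁻¹ p.2 balances the two sides and leaves
  -- ‖p.2‖² ≤ C²‖p.1‖².
  have h := key (((C⁻¹ : ℝ) : ℂ) • p.2)
  rw [inner_smul_right, Complex.re_ofReal_mul, norm_smul, Complex.norm_real,
    Real.norm_of_nonneg (by positivity),
    show (inner ℂ p.2 p.2 : ℂ).re = ‖p.2‖ ^ 2 from (norm_sq_eq_re_inner (𝕜 := ℂ) p.2).symm] at h
  have e : C / 2 * (‖p.1‖ ^ 2 + (C⁻¹ * ‖p.2‖) ^ 2)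
      = C⁻¹ * ((C ^ 2 * ‖p.1‖ ^ 2 + ‖p.2‖ ^ 2) / 2) := by
    field_simp
  rw [e] at h
  have h2 := le_of_mul_le_mul_left h (inv_pos.2 hC0)
  refine le_of_sq_le_sq ?_ (by positivity)
  rw [mul_pow]
  linarith

end Abstract

/-! ### The Neumann operator as the principal part -/

lemma IsNeumann.unique {v n n' : L2E} (h : IsNeumann v n) (h' : IsNeumann v n') : n = n' := by
  refine spec_injective fun b => Lp.ext ?_
  filter_upwards [h b, h' b] with ξ h1 h2
  exact h1.trans h2.symm

lemma IsNeumann.sub {v n v' n' : L2E} (h : IsNeumann v n) (h' : IsNeumann v' n') :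
    IsNeumann (v - v') (n - n') := by
  have := h.add (h'.smul (-1))
  simpa [sub_eq_add_neg] using this

lemma IsWeakDeriv.sub {v d v' d' : L2E} (h : IsWeakDeriv v d) (h' : IsWeakDeriv v' d') :
    IsWeakDeriv (v - v') (d - d') := by
  have := h.add (h'.smul (-1))
  simpa [sub_eq_add_neg] using this

/-- Multiplied by c = `gaglConst` / 2π, the forms of Λ and N are the kernel forms of `kerD` and
`kerN`, and these differ by at most 64‖v‖². -/
lemma exists_form_bound : ∃ C : ℝ, 0 < C ∧ ∀ p ∈ dtnCore, ∀ n, IsNeumann p.1 n →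
    |(inner ℂ (p.2.2 - n) p.1 : ℂ).re| ≤ C * ‖p.1‖ ^ 2 := by
  have hκ0 : 0 < gaglConst.toReal := ENNReal.toReal_pos gaglConst_ne_zero gaglConst_ne_top
  have hκ : ENNReal.ofReal gaglConst.toReal = gaglConst := ENNReal.ofReal_toReal gaglConst_ne_top
  set c : ℝ := gaglConst.toReal * (2 * Real.pi)⁻¹ with hc
  have hc0 : 0 < c := by positivity
  refine ⟨64 / c, by positivity, fun p hp n hn => ?_⟩
  obtain ⟨h1, h2⟩ := dtnCore_re hp
  obtain ⟨h3, h4⟩ := hn.re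
  have h5 := kernelForm_kerD_le p.1
  have h6 := kernelForm_kerN_le p.1
  have e : ∀ x : ℝ, gaglConst * ENNReal.ofReal ((2 * Real.pi)⁻¹ * x) = ENNReal.ofReal (c * x) := by
    intro x
    rw [hc, mul_assoc, ENNReal.ofReal_mul hκ0.le, hκ]
  have e2 : 64 * ‖p.1‖ₑ ^ 2 = ENNReal.ofReal (64 * ‖p.1‖ ^ 2) := by
    rw [ENNReal.ofReal_mul (by norm_num), ENNReal.ofReal_pow (norm_nonneg _), ofReal_norm,
      ENNReal.ofReal_ofNat]
  rw [h2, h4, e, e, e2, ← ENNReal.ofReal_add (by positivity) (by positivity),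
    ENNReal.ofReal_le_ofReal_iff (by positivity)] at h5 h6
  rw [inner_sub_left, Complex.sub_re, div_mul_eq_mul_div, abs_le, ← neg_div, div_le_iff₀ hc0,
    le_div_iff₀ hc0]
  constructor <;> linarith

/-- The pairs `(v, Λ v - N v)` with `v` of bounded support, `Λ` the Dirichlet-to-Neumann map and
`N` the Neumann operator. -/
def diffCore : Submodule ℂ (L2E × L2E) where
  carrier := {q | ∃ p ∈ dtnCore, ∃ n, IsNeumann p.1 n ∧ q = (p.1, p.2.2 - n)}
  zero_mem' := ⟨0, dtnCore.zero_mem, 0, by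
    intro b
    rw [Prod.fst_zero, map_zero]
    obtain ⟨-, -, η, w, -, h, -⟩ := dtnCore.zero_mem
    simpa using h.smul 0, by
    rw [Prod.fst_zero, Prod.snd_zero, Prod.snd_zero, sub_zero]
    rfl⟩
  add_mem' := by
    rintro _ _ ⟨p, hp, n, hn, rfl⟩ ⟨p', hp', n', hn', rfl⟩
    refine ⟨p + p', dtnCore.add_mem hp hp', n + n', hn.add hn', ?_⟩
    rw [Prod.mk_add_mk, ← add_sub_add_comm]
    rfl
  smul_mem' := by
    rintro c _ ⟨p, hp, n, hn, rfl⟩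
    refine ⟨c • p, dtnCore.smul_mem c hp, c • n, hn.smul c, ?_⟩
    rw [Prod.smul_mk, smul_sub]
    rfl

lemma diffCore_symm {p q : L2E × L2E} (hp : p ∈ diffCore) (hq : q ∈ diffCore) :
    (inner ℂ p.2 q.1 : ℂ) = inner ℂ p.1 q.2 := by
  obtain ⟨p, hp, n, hn, rfl⟩ := hp
  obtain ⟨q, hq, m, hm, rfl⟩ := hq
  rw [inner_sub_left, inner_sub_right, dtnCore_symm hp hq, hn.symm hm]

lemma exists_mem_diffCore {p : L2E × L2E × L2E} (hp : p ∈ dtnCore) :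
    ∃ n, IsNeumann p.1 n ∧ (p.1, p.2.2 - n) ∈ diffCore := by
  obtain ⟨n, hn⟩ := exists_isNeumann ⟨p.2.1, hp.1⟩
  exact ⟨n, hn, p, hp, n, hn, rfl⟩

lemma dense_fst_diffCore : Dense {v : L2E | ∃ q ∈ diffCore, q.1 = v} := by
  refine dense_fst_dtnCore.mono ?_
  rintro _ ⟨p, hp, rfl⟩
  obtain ⟨n, -, h⟩ := exists_mem_diffCore hp
  exact ⟨_, h, rfl⟩

/-- The Dirichlet-to-Neumann map is a bounded symmetric perturbation of the Neumann operator. -/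
lemma exists_perturbation : ∃ B : L2E →L[ℂ] L2E,
    (∀ v w, (inner ℂ (B v) w : ℂ) = inner ℂ v (B w)) ∧
    ∀ p ∈ dtnCore, ∀ n, IsNeumann p.1 n → p.2.2 = n + B p.1 := by
  obtain ⟨C, hC0, hC⟩ := exists_form_bound
  have hb : ∀ q ∈ diffCore, ‖q.2‖ ≤ C * ‖q.1‖ := fun q hq => by
    refine norm_le_of_form_le (fun p hp q hq => diffCore_symm hp hq) hC0 ?_ dense_fst_diffCore hq
    rintro _ ⟨p, hp, n, hn, rfl⟩
    exact hC p hp n hn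
  set e : diffCore →ₗ[ℂ] L2E := (LinearMap.fst ℂ L2E L2E).comp diffCore.subtype with he
  set f : diffCore →ₗ[ℂ] L2E := (LinearMap.snd ℂ L2E L2E).comp diffCore.subtype with hf
  have hd : DenseRange e := by
    refine dense_fst_diffCore.mono ?_
    rintro _ ⟨q, hq, rfl⟩
    exact ⟨⟨q, hq⟩, rfl⟩
  have hext : ∀ q ∈ diffCore, f.extendOfNorm e q.1 = q.2 := fun q hq =>
    LinearMap.extendOfNorm_eq (f := f) (e := e) hd ⟨C, fun x => hb x.1 x.2⟩ ⟨q, hq⟩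
  refine ⟨f.extendOfNorm e, fun v w => ?_, fun p hp n hn => ?_⟩
  · refine hd.induction_on₂ (p := fun v w => (inner ℂ (f.extendOfNorm e v) w : ℂ)
      = inner ℂ v (f.extendOfNorm e w)) ?_ ?_ v w
    · exact isClosed_eq (by fun_prop) (by fun_prop)
    · rintro ⟨p, hp⟩ ⟨q, hq⟩
      change (inner ℂ (f.extendOfNorm e p.1) q.1 : ℂ) = inner ℂ p.1 (f.extendOfNorm e q.1)
      rw [hext p hp, hext q hq]
      exact diffCore_symm hp hq
  · have := hext _ ⟨p, hp, n, hn, rfl⟩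
    rw [this, add_sub_cancel]

/-! ### The graph of the Dirichlet-to-Neumann map -/

lemma continuous_integral_smul {ψ : ℝ → ℝ} (hψ : Continuous ψ) (hc : HasCompactSupport ψ) :
    Continuous fun v : L2E => ∫ x, ψ x • v x ∂surfaceMeasure := by
  have hm : MemLp (fun x => (ψ x : ℂ)) 2 surfaceMeasure :=
    (hψ.memLp_of_hasCompactSupport (p := 2) (μ := surfaceMeasure) hc).ofReal
  have e : ∀ v : L2E, ∫ x, ψ x • v x ∂surfaceMeasure = inner ℂ (hm.toLp _ : L2E) v := by
    intro v
    rw [L2.inner_def]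
    refine integral_congr_ae ?_
    filter_upwards [hm.coeFn_toLp] with x hx
    rw [hx, RCLike.inner_apply, Complex.conj_ofReal, Complex.real_smul, mul_comm]
  simp only [e]
  fun_prop

lemma isClosed_isWeakDeriv : IsClosed {p : L2E × L2E | IsWeakDeriv p.1 p.2} := by
  simp only [IsWeakDeriv, Set.ofPred_forall]
  refine isClosed_iInter fun φ => isClosed_iInter fun hφ => isClosed_iInter fun hc =>
    isClosed_iInter fun _ => isClosed_eq ?_ ?_
  · exact (continuous_integral_smul (hφ.continuous_deriv (by simp)) hc.deriv).comp continuous_fst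
  · exact ((continuous_integral_smul hφ.continuous hc).comp continuous_snd).neg

lemma IsNeumann.tendsto {v d n : L2E} {V D N : ℕ → L2E} (h : IsNeumann v n)
    (hd : IsWeakDeriv v d) (hV : ∀ k, IsNeumann (V k) (N k)) (hD : ∀ k, IsWeakDeriv (V k) (D k))
    (ht : Tendsto D atTop (𝓝 d)) : Tendsto N atTop (𝓝 n) := by
  rw [tendsto_iff_norm_sub_tendsto_zero] at ht ⊢
  exact ht.congr fun k => (((hV k).sub h).norm_eq ((hD k).sub hd)).symm

/-- The Dirichlet-to-Neumann map is the sum of the Neumann operator and a bounded symmetric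
operator, and is nonnegative. -/
lemma exists_mem_dtnGraph_iff : ∃ B : L2E →L[ℂ] L2E,
    (∀ v w, (inner ℂ (B v) w : ℂ) = inner ℂ v (B w)) ∧
    (∀ v w, (v, w) ∈ dtnGraph ↔ ∃ n, IsNeumann v n ∧ w = n + B v) ∧
    ∀ v w, (v, w) ∈ dtnGraph → 0 ≤ (inner ℂ w v : ℂ).re := by
  obtain ⟨B, hB, hN⟩ := exists_perturbation
  refine ⟨B, hB, fun v w => ⟨?_, ?_⟩, ?_⟩
  · rintro ⟨⟨v', d, w'⟩, hp, h⟩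
    obtain ⟨rfl, rfl⟩ : v' = v ∧ w' = w := Prod.mk.inj h
    obtain ⟨p, hp, ht⟩ := mem_closure_iff_seq_limit.1 hp
    have t1 : Tendsto (fun k => (p k).1) atTop (𝓝 v') := (continuous_fst.tendsto _).comp ht
    have t2 : Tendsto (fun k => (p k).2.1) atTop (𝓝 d) :=
      ((continuous_fst.comp continuous_snd).tendsto _).comp ht
    have t3 : Tendsto (fun k => (p k).2.2) atTop (𝓝 w') :=
      ((continuous_snd.comp continuous_snd).tendsto _).comp ht
    have hd : IsWeakDeriv v' d := isClosed_isWeakDeriv.mem_of_tendsto (t1.prodMk_nhds t2)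
      (Eventually.of_forall fun k => (hp k).1)
    obtain ⟨n, hn⟩ := exists_isNeumann ⟨d, hd⟩
    -- Along the core Λ equals N + B. Convergence of the weak derivatives forces convergence of the
    -- Neumann images, hence of the third component, so the limit depends on v alone.
    choose N hNk using fun k => exists_isNeumann ⟨_, (hp k).1⟩
    have t4 := hn.tendsto hd hNk (fun k => (hp k).1) t2
    refine ⟨n, hn, tendsto_nhds_unique t3 ?_⟩
    simp only [fun k => hN _ (hp k) _ (hNk k)]
    exact t4.add ((B.continuous.tendsto _).comp t1)
  · rintro ⟨n, hn, rfl⟩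
    obtain ⟨d, hd⟩ := hn.mem_sobolevOne
    obtain ⟨p, hp, t1, t2⟩ := exists_dtnCore_tendsto hd
    choose N hNk using fun k => exists_isNeumann ⟨_, (hp k).1⟩
    have t4 := hn.tendsto hd hNk (fun k => (hp k).1) t2
    refine ⟨(v, d, n + B v), mem_closure_of_tendsto (f := p) (b := atTop) ?_ (Eventually.of_forall hp), rfl⟩
    have e : p = fun k => ((p k).1, (p k).2.1, N k + B (p k).1) := by
      funext k
      rw [← hN _ (hp k) _ (hNk k)]
    rw [e]
    exact t1.prodMk_nhds (t2.prodMk_nhds (t4.add ((B.continuous.tendsto _).comp t1)))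
  · rintro v w ⟨⟨v', d, w'⟩, hp, h⟩
    obtain ⟨rfl, rfl⟩ : v' = v ∧ w' = w := Prod.mk.inj h
    have hcl : IsClosed {p : L2E × L2E × L2E | 0 ≤ (inner ℂ p.2.2 p.1 : ℂ).re} :=
      isClosed_le continuous_const (by fun_prop)
    exact closure_minimal (fun p hp => (dtnCore_re hp).1) hcl hp

/-- The content is single-valuedness: a pair (0, w) in the closure has w = n + B 0 with n the
Neumann image of 0. -/
lemma dtn_graph : dtn.graph = dtnGraph := by
  obtain ⟨B, -, hB, -⟩ := exists_mem_dtnGraph_iff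
  refine Submodule.toLinearPMap_graph_eq _ ?_
  rintro ⟨v, w⟩ h (rfl : v = 0)
  obtain ⟨n, hn, rfl⟩ := (hB _ _).1 h
  have h0 : IsNeumann 0 0 := by simpa using hn.smul 0
  change n + B 0 = 0
  rw [hn.unique h0, map_zero, add_zero]

lemma dtn_domain : (dtn.domain : Set L2E) = sobolevOne := by
  obtain ⟨B, -, hB, -⟩ := exists_mem_dtnGraph_iff
  ext v
  constructor
  · rintro ⟨⟨v', w⟩, h, rfl⟩
    obtain ⟨n, hn, -⟩ := (hB _ _).1 h
    exact hn.mem_sobolevOne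
  · intro h
    obtain ⟨n, hn⟩ := exists_isNeumann h
    exact ⟨(v, n + B v), (hB _ _).2 ⟨n, hn, rfl⟩, rfl⟩

lemma mem_idAddDtn_graph {g : ℝ} {v u : L2E} :
    (v, u) ∈ (idAddDtn g).graph ↔ ∃ w, (v, w) ∈ dtnGraph ∧ u = v + (g : ℂ) • w := by
  rw [← dtn_graph, LinearPMap.mem_graph_iff]
  constructor
  · rintro ⟨x, rfl, rfl⟩
    exact ⟨dtn x, LinearPMap.mem_graph _ _, rfl⟩
  · rintro ⟨w, hw, rfl⟩
    obtain ⟨x, rfl, rfl⟩ := (LinearPMap.mem_graph_iff _).1 hw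
    exact ⟨x, rfl, rfl⟩

/-! ### Surjectivity -/

section Abstract

variable {H : Type*} [NormedAddCommGroup H] [InnerProductSpace ℂ H]

/-- Neumann series for I + PT. With T a resolvent, T x solves the equation perturbed by P. -/
lemma exists_add_comp_eq [CompleteSpace H] {T P : H →L[ℂ] H} (h : ‖P‖ * ‖T‖ < 1) (f : H) : ∃ x, x + P (T x) = f := by
  have h1 : ‖-(P.comp T)‖ < 1 := by
    rw [norm_neg]
    exact (ContinuousLinearMap.opNorm_comp_le P T).trans_lt h
  have h2 : IsUnit (1 - -(P.comp T)) := isUnit_one_sub_of_norm_lt_one h1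
  rw [sub_neg_eq_add] at h2
  obtain ⟨u, hu⟩ := h2
  refine ⟨(↑u⁻¹ : H →L[ℂ] H) f, ?_⟩
  have h3 : (u : H →L[ℂ] H) ((↑u⁻¹ : H →L[ℂ] H) f) = f := by
    rw [← mul_apply_eq_comp, Units.mul_inv, one_apply_eq_self]
  rw [hu] at h3
  exact h3

/-- The resolvent of a nonnegative linear relation. -/
lemma exists_resolvent {N : Submodule ℂ (H × H)} (hN : ∀ p ∈ N, 0 ≤ (inner ℂ p.2 p.1 : ℂ).re)
    {K : ℝ} (hK : 0 < K) (hs : ∀ f : H, ∃ p ∈ N, p.2 + (K : ℂ) • p.1 = f) :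
    ∃ T : H →L[ℂ] H, ‖T‖ ≤ K⁻¹ ∧ ∀ f, (T f, f - (K : ℂ) • T f) ∈ N := by
  -- Nonnegativity gives K‖p.1‖² ≤ Re⟨p.2 + K p.1, p.1⟩. Uniqueness of solutions and the bound 1/K
  -- both follow.
  have hb : ∀ p ∈ N, K * ‖p.1‖ ≤ ‖p.2 + (K : ℂ) • p.1‖ := by
    intro p hp
    rcases (norm_nonneg p.1).eq_or_lt with h0 | h0
    · rw [← h0, mul_zero]
      exact norm_nonneg _
    · have h1 := re_inner_le_norm (𝕜 := ℂ) (p.2 + (K : ℂ) • p.1) p.1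
      rw [inner_add_left, inner_smul_left, Complex.conj_ofReal] at h1
      change ((inner ℂ p.2 p.1 : ℂ) + (K : ℂ) * inner ℂ p.1 p.1).re ≤ _ at h1
      rw [Complex.add_re, Complex.re_ofReal_mul,
        show (inner ℂ p.1 p.1 : ℂ).re = ‖p.1‖ ^ 2 from (norm_sq_eq_re_inner (𝕜 := ℂ) p.1).symm] at h1
      have h2 := hN p hp
      refine le_of_mul_le_mul_right ?_ h0
      nlinarith
  choose p hp hpf using hs
  have huniq : ∀ q ∈ N, ∀ f, q.2 + (K : ℂ) • q.1 = f → q.1 = (p f).1 := by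
    intro q hq f hf
    have h1 := hb _ (N.sub_mem hq (hp f))
    have h2 : (q - p f).2 + (K : ℂ) • (q - p f).1 = 0 := by
      rw [Prod.snd_sub, Prod.fst_sub, smul_sub, sub_add_sub_comm, hf, hpf, sub_self]
    rw [h2, norm_zero] at h1
    have h3 : ‖(q - p f).1‖ = 0 :=
      le_antisymm (by nlinarith [norm_nonneg (q - p f).1]) (norm_nonneg _)
    exact sub_eq_zero.1 (norm_eq_zero.1 h3)
  let T₀ : H →ₗ[ℂ] H :=
    { toFun := fun f => (p f).1
      map_add' := fun f f' => (huniq _ (N.add_mem (hp f) (hp f')) _ (by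
        rw [Prod.snd_add, Prod.fst_add, smul_add, add_add_add_comm, hpf, hpf])).symm
      map_smul' := fun c f => (huniq _ (N.smul_mem c (hp f)) _ (by
        rw [Prod.smul_snd, Prod.smul_fst, smul_comm, ← smul_add, hpf])).symm }
  have hT : ∀ f, ‖T₀ f‖ ≤ K⁻¹ * ‖f‖ := fun f => by
    rw [← div_eq_inv_mul, le_div_iff₀' hK]
    have := hb _ (hp f)
    rwa [hpf] at this
  refine ⟨T₀.mkContinuous _ hT, T₀.mkContinuous_norm_le (by positivity) hT, fun f => ?_⟩
  have : f - (K : ℂ) • (p f).1 = (p f).2 := by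
    rw [sub_eq_iff_eq_add, hpf]
  change ((p f).1, f - (K : ℂ) • (p f).1) ∈ N
  rw [this]
  exact hp f

end Abstract

/-- The graph of the Neumann operator. -/
def neumannGraph : Submodule ℂ (L2E × L2E) where
  carrier := {p | IsNeumann p.1 p.2}
  zero_mem' := fun b => by
    rw [Prod.fst_zero, Prod.snd_zero, map_zero]
    obtain ⟨-, -, η, w, -, h, -⟩ := dtnCore.zero_mem
    simpa using h.smul 0
  add_mem' := fun h h' => h.add h'
  smul_mem' := fun c _ h => h.smul c

/-- The resolvent is the even multiplier (K + 2π|ξ|)⁻¹, bounded by 1/K. -/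
lemma neumann_surjective {K : ℝ} (hK : 0 < K) (f : L2E) :
    ∃ p ∈ neumannGraph, p.2 + (K : ℂ) • p.1 = f := by
  obtain ⟨v, hv⟩ := exists_spec_mul (m := fun ξ => (((K + 2 * Real.pi * |ξ|)⁻¹ : ℝ) : ℂ)) (v := f)
    (by
      have : Measurable (fun x : ℝ => |x|) := measurable_norm
      fun_prop) (fun ξ => by rw [abs_neg]) (energy_ne_top_iff.1
    (ne_top_of_le_ne_top (b := energy (fun _ => ENNReal.ofReal K⁻¹ ^ 2 * 1) f) (by
      rw [energy_const_mul measurable_const, energy_one]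
      finiteness) (energy_mono (fun ξ => by
        rw [mul_one, ← ofReal_norm, Complex.norm_real, Real.norm_of_nonneg (by positivity)]
        gcongr
        exact le_add_of_nonneg_right (by positivity)) f)))
  refine ⟨(v, f - (K : ℂ) • v), fun b => ?_, sub_add_cancel _ _⟩
  have h1 : spec b (f - (K : ℂ) • v) = spec b f - (K : ℂ) • spec b v := by
    rw [spec_sub, spec_smul]
  change ∀ᵐ ξ : ℝ, spec b (f - (K : ℂ) • v) ξ = ((2 * Real.pi * |ξ| : ℝ) : ℂ) * spec b v ξ
  rw [h1]
  filter_upwards [hv b, Lp.coeFn_sub (spec b f) ((K : ℂ) • spec b v),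
    Lp.coeFn_smul (K : ℂ) (spec b v)] with ξ e1 e2 e3
  rw [e2, Pi.sub_apply, e3, Pi.smul_apply, e1, smul_eq_mul]
  have h0 : ((K + 2 * Real.pi * |ξ| : ℝ) : ℂ) ≠ 0 := Complex.ofReal_ne_zero.2 (by positivity)
  rw [Complex.ofReal_inv]
  field_simp
  push_cast
  ring

/-- Two perturbations. Since K exceeds ‖B‖, the operator B(N + K)⁻¹ has norm below one, which
settles the shift K. Nonnegativity of Λ then gives ‖(Λ + K)⁻¹‖ ≤ 1/K, and (K - k)/K < 1 brings the
shift down to k. -/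
lemma dtn_surjective {k : ℝ} (hk : 0 < k) (f : L2E) :
    ∃ p ∈ dtnGraph, p.2 + (k : ℂ) • p.1 = f := by
  obtain ⟨B, -, hB, hpos⟩ := exists_mem_dtnGraph_iff
  set K : ℝ := ‖B‖ + k + 1 with hK
  have hK0 : 0 < K := by positivity
  have h1 : ∀ f : L2E, ∃ p ∈ dtnGraph, p.2 + (K : ℂ) • p.1 = f := by
    intro f
    obtain ⟨T, hT, hTN⟩ := exists_resolvent (N := neumannGraph) (fun p hp => (IsNeumann.re hp).1)
      hK0 (neumann_surjective hK0)
    obtain ⟨x, hx⟩ := exists_add_comp_eq (T := T) (P := B) (by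
      calc ‖B‖ * ‖T‖ ≤ ‖B‖ * K⁻¹ := by gcongr
        _ < 1 := by
          rw [← div_eq_mul_inv, div_lt_one hK0]
          linarith) f
    refine ⟨(T x, x - (K : ℂ) • T x + B (T x)), (hB _ _).2 ⟨_, hTN x, rfl⟩, ?_⟩
    change x - (K : ℂ) • T x + B (T x) + (K : ℂ) • T x = f
    rw [add_right_comm, sub_add_cancel, hx]
  obtain ⟨T, hT, hTN⟩ := exists_resolvent (N := dtnGraph) (fun p hp => hpos _ _ hp) hK0 h1
  obtain ⟨x, hx⟩ := exists_add_comp_eq (T := T)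
    (P := ((k - K : ℝ) : ℂ) • ContinuousLinearMap.id ℂ L2E) (by
      have h2 : ‖((k - K : ℝ) : ℂ) • ContinuousLinearMap.id ℂ L2E‖ ≤ K - k := by
        rw [norm_smul, Complex.norm_real, Real.norm_eq_abs, abs_sub_comm,
          abs_of_nonneg (by linarith [norm_nonneg B])]
        exact mul_le_of_le_one_right (by linarith [norm_nonneg B])
          ContinuousLinearMap.norm_id_le
      calc _ ≤ (K - k) * K⁻¹ := by
            gcongr
            linarith [norm_nonneg B]
        _ < 1 := by
          rw [← div_eq_mul_inv, div_lt_one hK0]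
          linarith) f
  refine ⟨_, hTN x, ?_⟩
  rw [← hx]
  change x - (K : ℂ) • T x + (k : ℂ) • T x = x + ((k - K : ℝ) : ℂ) • T x
  rw [Complex.ofReal_sub, sub_smul]
  abel

/-- I + gΛ = g(Λ + g⁻¹). -/
lemma idAddDtn_surjective {g : ℝ} (hg : 0 < g) (f : L2E) : ∃ v, (v, f) ∈ (idAddDtn g).graph := by
  obtain ⟨⟨v, w⟩, hp, h⟩ := dtn_surjective (inv_pos.2 hg) ((g : ℂ)⁻¹ • f)
  refine ⟨v, mem_idAddDtn_graph.2 ⟨w, hp, ?_⟩⟩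
  have hg' : (g : ℂ) ≠ 0 := Complex.ofReal_ne_zero.2 hg.ne'
  have h2 := congrArg (fun z => (g : ℂ) • z) h
  simp only [smul_add] at h2
  rw [Complex.ofReal_inv, smul_inv_smul₀ hg', smul_inv_smul₀ hg'] at h2
  rw [← h2, add_comm]

lemma idAddDtn_symm {g : ℝ} {v u v' u' : L2E} (h : (v, u) ∈ (idAddDtn g).graph)
    (h' : (v', u') ∈ (idAddDtn g).graph) : (inner ℂ u v' : ℂ) = inner ℂ v u' := by
  obtain ⟨B, hs, hB, -⟩ := exists_mem_dtnGraph_iff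
  obtain ⟨w, hw, rfl⟩ := mem_idAddDtn_graph.1 h
  obtain ⟨w', hw', rfl⟩ := mem_idAddDtn_graph.1 h'
  obtain ⟨n, hn, rfl⟩ := (hB _ _).1 hw
  obtain ⟨n', hn', rfl⟩ := (hB _ _).1 hw'
  simp only [inner_add_left, inner_add_right, inner_smul_left, inner_smul_right,
    Complex.conj_ofReal, hn.symm hn', hs]

lemma norm_sq_le_idAddDtn {g : ℝ} (hg : 0 < g) {v u : L2E} (h : (v, u) ∈ (idAddDtn g).graph) :
    ‖v‖ ^ 2 ≤ (inner ℂ u v : ℂ).re := by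
  obtain ⟨B, -, -, hpos⟩ := exists_mem_dtnGraph_iff
  obtain ⟨w, hw, rfl⟩ := mem_idAddDtn_graph.1 h
  rw [inner_add_left, inner_smul_left, Complex.conj_ofReal, Complex.add_re, Complex.re_ofReal_mul,
    show (inner ℂ v v : ℂ).re = ‖v‖ ^ 2 from (norm_sq_eq_re_inner (𝕜 := ℂ) v).symm]
  have := hpos _ _ hw
  nlinarith

/-! ### Square roots of symmetric surjective operators -/

section Abstract

variable {H : Type*} [NormedAddCommGroup H] [InnerProductSpace ℂ H]

/-- A symmetric, nonnegative, injective and surjective linear relation is the inverse of a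
nonnegative bounded operator. -/
lemma exists_inverse [CompleteSpace H] {G : Submodule ℂ (H × H)}
    (hs : ∀ p ∈ G, ∀ q ∈ G, (inner ℂ p.2 q.1 : ℂ) = inner ℂ p.1 q.2)
    (hp : ∀ p ∈ G, 0 ≤ (inner ℂ p.2 p.1 : ℂ).re)
    (hi : ∀ v, (v, 0) ∈ G → v = 0) (hr : ∀ f, ∃ v, (v, f) ∈ G) :
    ∃ T : H →L[ℂ] H, 0 ≤ T ∧ ∀ v f, (v, f) ∈ G ↔ v = T f := by
  choose t ht using hr
  have huniq : ∀ v f, (v, f) ∈ G → v = t f := by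
    intro v f h
    have h1 := G.sub_mem h (ht f)
    rw [Prod.mk_sub_mk, sub_self] at h1
    exact sub_eq_zero.1 (hi _ h1)
  let T₀ : H →ₗ[ℂ] H :=
    { toFun := t
      map_add' := fun f f' => (huniq _ _ (G.add_mem (ht f) (ht f'))).symm
      map_smul' := fun c f => (huniq _ _ (G.smul_mem c (ht f))).symm }
  have hsym : T₀.IsSymmetric := fun f f' => (hs _ (ht f) _ (ht f')).symm
  -- Hellinger–Toeplitz: a symmetric operator defined everywhere is continuous.
  refine ⟨⟨T₀, hsym.continuous⟩, ?_, fun v f => ⟨huniq v f, ?_⟩⟩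
  · rw [ContinuousLinearMap.nonneg_iff_isPositive]
    refine ⟨hsym, fun x => ?_⟩
    have h1 := hp _ (ht x)
    rw [← inner_conj_symm, Complex.conj_re] at h1
    exact h1
  · rintro rfl
    exact ht f

lemma inner_symm_of_nonneg {R : H →L[ℂ] H} (hR : 0 ≤ R) (x y : H) :
    (inner ℂ (R x) y : ℂ) = inner ℂ x (R y) :=
  ((ContinuousLinearMap.nonneg_iff_isPositive R).1 hR).1 x y

/-- R is symmetric, so the orthogonal complement of its range is its kernel. -/
lemma denseRange_of_injective [CompleteSpace H] {R : H →L[ℂ] H} (hR : 0 ≤ R) (hinj : ∀ u, R u = 0 → u = 0) :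
    DenseRange R := by
  have h1 : (LinearMap.range R.toLinearMap).topologicalClosure = ⊤ := by
    rw [Submodule.topologicalClosure_eq_top_iff, Submodule.eq_bot_iff]
    intro z hz
    refine hinj z (ext_inner_left ℂ fun u => ?_)
    rw [inner_zero_right, ← inner_symm_of_nonneg hR]
    exact (Submodule.mem_orthogonal _ _).1 hz _ ⟨u, rfl⟩
  have h2 := Submodule.dense_iff_topologicalClosure_eq_top.2 h1
  exact h2

/-- The inverse of a nonnegative injective bounded operator is self-adjoint. -/
lemma exists_selfAdjoint_inverse [CompleteSpace H] {R : H →L[ℂ] H} (hR : 0 ≤ R) (hinj : ∀ u, R u = 0 → u = 0) :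
    ∃ S : H →ₗ.[ℂ] H, IsSelfAdjoint S ∧ ∀ v u, (v, u) ∈ S.graph ↔ v = R u := by
  set G : Submodule ℂ (H × H) := LinearMap.range (R.toLinearMap.prod LinearMap.id) with hG
  have hmem : ∀ v u, (v, u) ∈ G ↔ v = R u := by
    intro v u
    constructor
    · rintro ⟨x, hx⟩
      obtain ⟨rfl, rfl⟩ := Prod.mk.inj hx
      rfl
    · rintro rfl
      exact ⟨u, rfl⟩
  have hgr : G.toLinearPMap.graph = G := by
    refine Submodule.toLinearPMap_graph_eq _ ?_
    rintro ⟨v, u⟩ h (rfl : v = 0)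
    exact hinj u ((hmem _ _).1 h).symm
  have hd : Dense (G.toLinearPMap.domain : Set H) := by
    refine (denseRange_of_injective hR hinj).mono ?_
    rintro _ ⟨u, rfl⟩
    exact ⟨(R u, u), (hmem _ _).2 rfl, rfl⟩
  refine ⟨G.toLinearPMap, ?_, fun v u => by rw [hgr, hmem]⟩
  rw [LinearPMap.isSelfAdjoint_def]
  refine LinearPMap.eq_of_eq_graph ?_
  rw [LinearPMap.adjoint_graph_eq_graph_adjoint hd, hgr]
  ext ⟨y, z⟩
  -- Membership of (y, z) in the adjoint graph says ⟨u, y⟩ = ⟨R u, z⟩ = ⟨u, R z⟩ for all u, that is,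
  -- y = R z.
  rw [Submodule.mem_adjoint_iff, hmem]
  constructor
  · intro h
    refine ext_inner_left ℂ fun u => ?_
    have := h (R u) u ((hmem _ _).2 rfl)
    rw [sub_eq_zero] at this
    rw [← inner_symm_of_nonneg hR]
    exact this
  · rintro rfl a b hab
    rw [(hmem _ _).1 hab]
    dsimp only
    rw [inner_symm_of_nonneg hR, sub_self]

lemma graph_symm_of_isSelfAdjoint [CompleteSpace H] {S : H →ₗ.[ℂ] H} (hS : IsSelfAdjoint S) {p q : H × H}
    (hp : p ∈ S.graph) (hq : q ∈ S.graph) : (inner ℂ p.2 q.1 : ℂ) = inner ℂ p.1 q.2 := by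
  have h1 := LinearPMap.adjoint_graph_eq_graph_adjoint hS.dense_domain
  rw [LinearPMap.isSelfAdjoint_def.1 hS] at h1
  rw [h1] at hq
  exact sub_eq_zero.1 ((Submodule.mem_adjoint_iff _ _).1 hq _ _ hp)

/-- Continuous functional calculus. Uniqueness among bounded nonnegative operators is what yields
uniqueness of the unbounded root, through inverses. -/
lemma exists_unique_sqrt [CompleteSpace H] {T : H →L[ℂ] H} (hT : 0 ≤ T) :
    ∃ R : H →L[ℂ] H, 0 ≤ R ∧ (∀ f, R (R f) = T f) ∧
      ∀ Q : H →L[ℂ] H, 0 ≤ Q → (∀ f, Q (Q f) = T f) → R = Q := by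
  refine ⟨CFC.sqrt T, CFC.sqrt_nonneg T, fun f => ?_, fun Q hQ h => CFC.sqrt_unique ?_ hQ⟩
  · exact congrArg (fun L : H →L[ℂ] H => L f) (CFC.sqrt_mul_sqrt_self T hT)
  · ext1 f
    exact h f

end Abstract

/-- The unique square root of an operator with bounded inverse. -/
lemma exists_sqrt {A : L2E →ₗ.[ℂ] L2E}
    (hs : ∀ p ∈ A.graph, ∀ q ∈ A.graph, (inner ℂ p.2 q.1 : ℂ) = inner ℂ p.1 q.2)
    (hp : ∀ p ∈ A.graph, ‖p.1‖ ^ 2 ≤ (inner ℂ p.2 p.1 : ℂ).re)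
    (hr : ∀ f, ∃ v, (v, f) ∈ A.graph) :
    ∃ R : L2E →L[ℂ] L2E, 0 ≤ R ∧ (∀ u, R u = 0 → u = 0) ∧
      (∀ v f, (v, f) ∈ A.graph ↔ v = R (R f)) ∧
      ∀ S : L2E →ₗ.[ℂ] L2E, IsPosSqrt S A ↔ ∀ v u, (v, u) ∈ S.graph ↔ v = R u := by
  have hA0 : ∀ v, (v, 0) ∈ A.graph → v = 0 := by
    intro v h
    have h1 := hp _ h
    rw [inner_zero_left, Complex.zero_re] at h1
    exact norm_eq_zero.1 (pow_eq_zero_iff two_ne_zero |>.1 (le_antisymm h1 (sq_nonneg _)))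
  obtain ⟨T, hT0, hT⟩ := exists_inverse hs (fun p h => (sq_nonneg _).trans (hp p h)) hA0 hr
  obtain ⟨R, hR0, hRR, hRu⟩ := exists_unique_sqrt hT0
  have hTinj : ∀ u, T u = 0 → u = 0 := by
    intro u hu
    have h1 : ((0 : L2E), u) ∈ A.graph := (hT _ _).2 hu.symm
    exact A.graph_fst_eq_zero_snd h1 rfl
  have hRinj : ∀ u, R u = 0 → u = 0 := by
    intro u hu
    refine hTinj u ?_
    rw [← hRR, hu, map_zero]
  refine ⟨R, hR0, hRinj, fun v f => by rw [hT, hRR], fun S => ⟨fun h => ?_, fun h => ?_⟩⟩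
  -- Since S ∘ S = A is injective and onto, so is S. Its inverse Q is bounded and nonnegative with
  -- Q² = T, hence equal to R.
  · obtain ⟨h1, h2, h3⟩ := h
    have hS0 : ∀ v, (v, 0) ∈ S.graph → v = 0 := fun v hv =>
      hA0 v ((h3 v 0).2 ⟨0, hv, S.graph.zero_mem⟩)
    have hSr : ∀ f, ∃ v, (v, f) ∈ S.graph := fun f => by
      obtain ⟨v, hv⟩ := hr f
      obtain ⟨u, -, hu⟩ := (h3 v f).1 hv
      exact ⟨u, hu⟩
    obtain ⟨Q, hQ0, hQ⟩ := exists_inverse (G := S.graph)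
      (fun p hp q hq => graph_symm_of_isSelfAdjoint h1 hp hq)
      (fun p hp => by
        obtain ⟨x, hx1, hx2⟩ := (LinearPMap.mem_graph_iff _).1 hp
        rw [← hx1, ← hx2]
        exact h2 x) hS0 hSr
    have : R = Q := hRu Q hQ0 fun f =>
      (hT _ _).1 ((h3 _ _).2 ⟨Q f, (hQ _ _).2 rfl, (hQ _ _).2 rfl⟩)
    rw [this]
    exact hQ
  · obtain ⟨S', h1, h2⟩ := exists_selfAdjoint_inverse hR0 hRinj
    have e : S = S' := LinearPMap.eq_of_eq_graph (by
      ext ⟨v, u⟩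
      rw [h, h2])
    refine ⟨e ▸ h1, fun v => ?_, fun v w => ?_⟩
    · have h4 := (h _ _).1 (S.mem_graph v)
      rw [h4, ← inner_conj_symm, Complex.conj_re]
      exact ((ContinuousLinearMap.nonneg_iff_isPositive R).1 hR0).2 (S v)
    · rw [hT, ← hRR]
      constructor
      · rintro rfl
        exact ⟨R w, (h _ _).2 rfl, (h _ _).2 rfl⟩
      · rintro ⟨u, hu1, hu2⟩
        rw [(h _ _).1 hu1, (h _ _).1 hu2]

section FormDomain

variable {A S : L2E →ₗ.[ℂ] L2E} {R : L2E →L[ℂ] L2E}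

lemma mem_domain_iff_exists_graph {v : L2E} : v ∈ S.domain ↔ ∃ u, (v, u) ∈ S.graph :=
  LinearPMap.mem_domain_iff

/-- In terms of R a form-Cauchy sequence is R s with s Cauchy, so its limit stays in the range of R.
Conversely s can be taken in the dense range of R, and then R s lies in the domain of A, the range
of R². -/
lemma formCompletion_eq_domain (hR0 : 0 ≤ R) (hinj : ∀ u, R u = 0 → u = 0)
    (hA : ∀ v f, (v, f) ∈ A.graph ↔ v = R (R f)) (hS : ∀ v u, (v, u) ∈ S.graph ↔ v = R u) :
    formCompletion S A = S.domain := by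
  ext v
  constructor
  · rintro ⟨u, s, h1, h2, h3⟩
    obtain ⟨s₀, hs⟩ := cauchySeq_tendsto_of_complete h3
    refine mem_domain_iff_exists_graph.2 ⟨s₀, (hS _ _).2 (tendsto_nhds_unique h2 ?_)⟩
    have e : u = fun n => R (s n) := funext fun n => (hS _ _).1 (h1 n).2
    rw [e]
    exact (R.continuous.tendsto _).comp hs
  · intro h
    obtain ⟨u, hu⟩ := mem_domain_iff_exists_graph.1 h
    obtain ⟨s, hs1, hs2⟩ := mem_closure_iff_seq_limit.1 (denseRange_of_injective hR0 hinj u)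
    choose f hf using hs1
    refine ⟨fun n => R (s n), s, fun n => ⟨?_, (hS _ _).2 rfl⟩, ?_, hs2.cauchySeq⟩
    · exact mem_domain_iff_exists_graph.2 ⟨f n, (hA _ _).2 (by rw [hf])⟩
    · rw [(hS _ _).1 hu]
      exact (R.continuous.tendsto _).comp hs2

end FormDomain

/-! ### The `W^{1/2,2}` norm and the energy -/

lemma energy_add {k m : ℝ → ℝ≥0∞} (hk : Measurable k) (v : L2E) :
    energy (fun ξ => k ξ + m ξ) v = energy k v + energy m v := by
  have h1 := measurable_spec true v
  have h2 := measurable_spec false v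
  simp only [energy, add_mul]
  rw [lintegral_add_left (by fun_prop), lintegral_add_left (by fun_prop)]
  ring

lemma energy_sub_le {m : ℝ → ℝ≥0∞} (hm : Measurable m) (v w : L2E) :
    energy m (v - w) ≤ 2 * energy m v + 2 * energy m w := by
  have hb : ∀ b, ∫⁻ ξ, m ξ * ‖spec b (v - w) ξ‖ₑ ^ 2
      ≤ 2 * (∫⁻ ξ, m ξ * ‖spec b v ξ‖ₑ ^ 2) + 2 * ∫⁻ ξ, m ξ * ‖spec b w ξ‖ₑ ^ 2 := fun b => by
    have h1 := measurable_spec b v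
    have h2 := measurable_spec b w
    rw [← lintegral_const_mul _ (by fun_prop), ← lintegral_const_mul _ (by fun_prop),
      ← lintegral_add_left (by fun_prop), spec_sub]
    refine lintegral_mono_ae ?_
    filter_upwards [Lp.coeFn_sub (spec b v) (spec b w)] with ξ h
    rw [h, Pi.sub_apply]
    calc m ξ * ‖spec b v ξ - spec b w ξ‖ₑ ^ 2
        ≤ m ξ * (2 * ‖spec b v ξ‖ₑ ^ 2 + 2 * ‖spec b w ξ‖ₑ ^ 2) := by
          rw [← mul_add]
          gcongr
          exact enorm_sub_sq_le _ _
      _ = _ := by ring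
  refine (add_le_add (hb true) (hb false)).trans (le_of_eq ?_)
  simp only [energy]
  ring

/-- The spectral form of the square of the `W^{1/2,2}` norm. -/
noncomputable def halfEnergy (v : L2E) : ℝ≥0∞ := energy (fun ξ => 1 + ‖ξ‖ₑ) v

lemma halfEnergy_eq (v : L2E) : halfEnergy v = 2 * ‖v‖ₑ ^ 2 + energy (fun ξ => ‖ξ‖ₑ) v := by
  rw [halfEnergy, energy_add measurable_const, energy_one]

lemma kernelForm_kerN_eq (v : L2E) :
    2 * kernelForm kerN v = gaglConst * energy (fun ξ => ‖ξ‖ₑ) v := by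
  rw [← gagl_evenExt_add, gagl_eq_lintegral, gagl_eq_lintegral, ← mul_add]
  rfl

lemma halfNorm_sq (v : L2E) : halfNorm v ^ 2 = ‖v‖ₑ ^ 2 + kernelForm kerE v := by
  rw [halfNorm, ← ENNReal.rpow_natCast, ← ENNReal.rpow_mul, gagliardo_surface_eq]
  norm_num

/-- `kerN` is diagonal in the spectrum and comparable with `kerE`: `kerN` ≤ 2 `kerE`, and `kerE` ≤
`kerN` + `kerZ` with `kerZ` bounded on L². The constant simply sums those of both directions. -/
lemma exists_halfNorm_equiv : ∃ C : ℝ≥0∞, C ≠ ⊤ ∧ ∀ v : L2E,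
    halfNorm v ^ 2 ≤ C * halfEnergy v ∧ halfEnergy v ≤ C * halfNorm v ^ 2 := by
  have hk := gaglConst_ne_top
  have hk0 := gaglConst_ne_zero
  refine ⟨65 + gaglConst + 2 + 4 * gaglConst⁻¹, by finiteness, fun v => ?_⟩
  have h1 := kernelForm_kerE_le v
  have h2 := kernelForm_kerN_le_kerE v
  have h3 := kernelForm_kerN_eq v
  rw [halfNorm_sq, halfEnergy_eq]
  set a := ‖v‖ₑ ^ 2
  set e := energy (fun ξ => ‖ξ‖ₑ) v
  have h4 : kernelForm kerN v ≤ gaglConst * e := by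
    rw [← h3, two_mul]
    exact le_add_self
  have h5 : e ≤ 4 * gaglConst⁻¹ * kernelForm kerE v := by
    calc e = gaglConst⁻¹ * (gaglConst * e) := by
          rw [← mul_assoc, ENNReal.inv_mul_cancel hk0 hk, one_mul]
      _ ≤ gaglConst⁻¹ * (2 * (2 * kernelForm kerE v)) := by
          rw [← h3]
          gcongr
      _ = _ := by ring
  constructor
  · calc a + kernelForm kerE v ≤ a + (gaglConst * e + 64 * a) := by
          gcongr
          exact h1.trans (by gcongr)
      _ = 65 * a + gaglConst * e := by ring
      _ ≤ (65 + gaglConst + 2 + 4 * gaglConst⁻¹) * (2 * a)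
          + (65 + gaglConst + 2 + 4 * gaglConst⁻¹) * e := by
          gcongr
          · rw [add_assoc, add_assoc]
            exact le_self_add
          · rw [two_mul]
            exact le_self_add
          · rw [add_assoc, add_comm 65, add_assoc]
            exact le_self_add
      _ = _ := by ring
  · calc 2 * a + e ≤ 2 * a + 4 * gaglConst⁻¹ * kernelForm kerE v := by gcongr
      _ ≤ (65 + gaglConst + 2 + 4 * gaglConst⁻¹) * a
          + (65 + gaglConst + 2 + 4 * gaglConst⁻¹) * kernelForm kerE v := by
          gcongr
          · rw [add_right_comm]
            exact le_add_self
          · exact le_add_self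
      _ = _ := by ring

lemma halfNorm_lt_top_iff {v : L2E} : halfNorm v < ⊤ ↔ halfEnergy v < ⊤ := by
  obtain ⟨C, hC, h⟩ := exists_halfNorm_equiv
  constructor
  · intro hv
    refine (h v).2.trans_lt ?_
    finiteness
  · intro hv
    have : halfNorm v ^ 2 < ⊤ := (h v).1.trans_lt (by finiteness)
    exact (ENNReal.pow_lt_top_iff.1 this).resolve_right two_ne_zero

/-- With q = ‖v‖², x the form of N and b that of B, the form is y = q + g(x + b), while `halfEnergy`
is 2q + x/π. The upper bound uses |b| ≤ ‖B‖q. In the lower one, q ≤ y, which comes from Λ ≥ 0,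
absorbs b and gives gx ≤ (1 + g‖B‖)y. -/
lemma exists_form_equiv {g : ℝ} (hg : 0 < g) : ∃ C : ℝ≥0∞, C ≠ ⊤ ∧
    ∀ p ∈ (idAddDtn g).graph,
      ENNReal.ofReal (inner ℂ p.2 p.1 : ℂ).re ≤ C * halfEnergy p.1 ∧
      halfEnergy p.1 ≤ C * ENNReal.ofReal (inner ℂ p.2 p.1 : ℂ).re := by
  obtain ⟨B, -, hB, -⟩ := exists_mem_dtnGraph_iff
  set c : ℝ := 1 + g * ‖B‖ with hc
  have hc0 : 0 < c := by positivity
  have hπ := Real.pi_pos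
  set C : ℝ := c + g * Real.pi + 2 + Real.pi⁻¹ * g⁻¹ * c with hC
  refine ⟨ENNReal.ofReal C, ENNReal.ofReal_ne_top, ?_⟩
  rintro ⟨v, f⟩ hp
  have hq := norm_sq_le_idAddDtn hg hp
  obtain ⟨w, hw, rfl⟩ := mem_idAddDtn_graph.1 hp
  obtain ⟨n, hn, rfl⟩ := (hB _ _).1 hw
  dsimp only
  obtain ⟨hx, hx2⟩ := hn.re
  have hE : halfEnergy v
      = ENNReal.ofReal (2 * ‖v‖ ^ 2 + Real.pi⁻¹ * (inner ℂ n v : ℂ).re) := by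
    have h1 := kernelForm_kerN_eq v
    rw [hx2, mul_left_comm, ENNReal.mul_right_inj gaglConst_ne_zero gaglConst_ne_top] at h1
    rw [halfEnergy_eq, ← h1, ENNReal.ofReal_add (by positivity) (by positivity),
      ENNReal.ofReal_mul (p := 2) (by norm_num), ENNReal.ofReal_pow (norm_nonneg _), ofReal_norm,
      ENNReal.ofReal_ofNat]
    congr 1
    rw [← ENNReal.ofReal_ofNat 2, ← ENNReal.ofReal_mul (by norm_num)]
    congr 1
    field_simp
  have hb : |(inner ℂ (B v) v : ℂ).re| ≤ ‖B‖ * ‖v‖ ^ 2 := by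
    refine (Complex.abs_re_le_norm _).trans ((norm_inner_le_norm _ _).trans ?_)
    rw [pow_two, ← mul_assoc]
    gcongr
    exact B.le_opNorm v
  have hf : (inner ℂ (v + (g : ℂ) • (n + B v)) v : ℂ).re
      = ‖v‖ ^ 2 + g * ((inner ℂ n v : ℂ).re + (inner ℂ (B v) v : ℂ).re) := by
    rw [inner_add_left, inner_smul_left, Complex.conj_ofReal, Complex.add_re,
      Complex.re_ofReal_mul, inner_add_left, Complex.add_re,
      show (inner ℂ v v : ℂ).re = ‖v‖ ^ 2 from (norm_sq_eq_re_inner (𝕜 := ℂ) v).symm]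
  rw [hE]
  set y := (inner ℂ (v + (g : ℂ) • (n + B v)) v : ℂ).re
  set x := (inner ℂ n v : ℂ).re
  set b := (inner ℂ (B v) v : ℂ).re
  set q := ‖v‖ ^ 2
  have hq0 : 0 ≤ q := sq_nonneg _
  obtain ⟨hb1, hb2⟩ := abs_le.1 hb
  have hgb1 : -(g * (‖B‖ * q)) ≤ g * b := by nlinarith
  have hgb2 : g * b ≤ g * (‖B‖ * q) := by nlinarith
  have hB0 := norm_nonneg B
  have hi : 0 < Real.pi⁻¹ * g⁻¹ := by positivity
  rw [← ENNReal.ofReal_mul (by positivity), ← ENNReal.ofReal_mul (by positivity)]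
  constructor
  · refine ENNReal.ofReal_le_ofReal ?_
    calc y ≤ c * q + (g * Real.pi) * (Real.pi⁻¹ * x) := by
          rw [mul_assoc, mul_inv_cancel_left₀ hπ.ne', hf, hc]
          linarith
      _ ≤ C * (2 * q) + C * (Real.pi⁻¹ * x) := by
          have h1 : c ≤ C := by
            rw [hC]
            have : 0 ≤ Real.pi⁻¹ * g⁻¹ * c := by positivity
            nlinarith
          have h2 : g * Real.pi ≤ C := by
            rw [hC]
            have : 0 ≤ Real.pi⁻¹ * g⁻¹ * c := by positivity
            linarith
          gcongr
          linarith
      _ = _ := by ring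
  · refine ENNReal.ofReal_le_ofReal ?_
    have h1 : g * x ≤ c * y := by
      have : g * (‖B‖ * q) ≤ g * (‖B‖ * y) := by gcongr
      rw [hc]
      linarith
    calc 2 * q + Real.pi⁻¹ * x = 2 * q + Real.pi⁻¹ * g⁻¹ * (g * x) := by
          field_simp
      _ ≤ 2 * y + Real.pi⁻¹ * g⁻¹ * (c * y) := by gcongr
      _ ≤ C * y := by
          rw [hC]
          have : 0 ≤ y := hq0.trans hq
          have : 0 ≤ (c + g * Real.pi) * y := by positivity
          linarith

/-! ### The domain of the square root -/

lemma measurable_cutoff (n : ℕ) : Measurable ({ξ : ℝ | |ξ| ≤ n}.indicator (1 : ℝ → ℝ≥0∞)) :=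
  measurable_one.indicator (measurableSet_cutoff n)

lemma energy_le_of_cutoff {m : ℝ → ℝ≥0∞} (hm : Measurable m) {v : L2E} {c : ℝ≥0∞}
    (h : ∀ n : ℕ, energy (fun ξ => m ξ * {ξ : ℝ | |ξ| ≤ n}.indicator 1 ξ) v ≤ c) :
    energy m v ≤ c := by
  have hb : ∀ b, Tendsto (fun n : ℕ => ∫⁻ ξ, m ξ * {ξ : ℝ | |ξ| ≤ n}.indicator 1 ξ
      * ‖spec b v ξ‖ₑ ^ 2) atTop (𝓝 (∫⁻ ξ, m ξ * ‖spec b v ξ‖ₑ ^ 2)) := fun b => by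
    have h1 := measurable_spec b v
    refine lintegral_tendsto_of_tendsto_of_monotone (fun n => ?_)
      (Eventually.of_forall fun ξ => ?_) (Eventually.of_forall fun ξ => ?_)
    · have := measurable_cutoff n
      fun_prop
    · intro n k hnk
      dsimp only
      gcongr
    · refine tendsto_const_nhds.congr' ?_
      obtain ⟨N, hN⟩ := exists_nat_ge |ξ|
      filter_upwards [eventually_ge_atTop N] with n hn
      have : ξ ∈ {ξ : ℝ | |ξ| ≤ n} := hN.trans (by exact_mod_cast hn)
      rw [Set.indicator_of_mem this, Pi.one_apply, mul_one]
  exact le_of_tendsto' ((hb true).add (hb false)) h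

/-- The energy is lower semicontinuous up to a constant. -/
lemma halfEnergy_le_of_tendsto {v : L2E} {u : ℕ → L2E} (hu : Tendsto u atTop (𝓝 v))
    {c : ℕ → ℝ≥0∞} {c₀ : ℝ≥0∞} (hc : Tendsto c atTop (𝓝 c₀)) (h : ∀ n, halfEnergy (u n) ≤ c n) :
    halfEnergy v ≤ 2 * c₀ := by
  have hm : Measurable fun ξ : ℝ => 1 + ‖ξ‖ₑ := by fun_prop
  refine energy_le_of_cutoff hm fun N => ?_
  -- The truncated weight is at most 1 + N, so its energy is controlled in L² and passes to the
  -- limit. The cut-off is removed afterwards by monotone convergence.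
  set k : ℝ → ℝ≥0∞ := fun ξ => (1 + ‖ξ‖ₑ) * {ξ : ℝ | |ξ| ≤ N}.indicator 1 ξ with hk
  have hkm : Measurable k := hm.mul (measurable_cutoff N)
  have hk1 : ∀ ξ, k ξ ≤ 1 + ‖ξ‖ₑ := fun ξ =>
    mul_le_of_le_one_right' (Set.indicator_le_self' (fun _ _ => zero_le) ξ)
  have hk2 : ∀ ξ, k ξ ≤ (1 + N) * 1 := fun ξ => by
    rw [mul_one, hk]
    dsimp only
    by_cases h : ξ ∈ {ξ : ℝ | |ξ| ≤ N}
    · rw [Set.indicator_of_mem h, Pi.one_apply, mul_one]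
      gcongr
      rw [← ofReal_norm, ← ENNReal.ofReal_natCast]
      exact ENNReal.ofReal_le_ofReal h
    · rw [Set.indicator_of_notMem h, mul_zero]
      exact zero_le
  have h1 : ∀ n, energy k v ≤ 2 * c n + 2 * ((1 + N) * (2 * ‖u n - v‖ₑ ^ 2)) := fun n => by
    have e : v = u n - (u n - v) := by abel
    calc energy k v = energy k (u n - (u n - v)) := by rw [← e]
      _ ≤ 2 * energy k (u n) + 2 * energy k (u n - v) := energy_sub_le hkm _ _
      _ ≤ 2 * c n + 2 * ((1 + N) * (2 * ‖u n - v‖ₑ ^ 2)) := by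
        gcongr
        · exact (energy_mono hk1 _).trans (h n)
        · rw [← energy_one, ← energy_const_mul measurable_const]
          exact energy_mono hk2 _
  have h2 : Tendsto (fun n => ‖u n - v‖ₑ ^ 2) atTop (𝓝 0) := by
    have h3 : Tendsto (fun n => ‖u n - v‖ₑ ^ 2) atTop (𝓝 (‖v - v‖ₑ ^ 2)) :=
      ((ENNReal.continuous_pow 2).tendsto _).comp
        ((continuous_enorm.tendsto _).comp (hu.sub_const v))
    simpa using h3
  have h4 : Tendsto (fun n => 2 * c n + 2 * ((1 + N) * (2 * ‖u n - v‖ₑ ^ 2))) atTop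
      (𝓝 (2 * c₀ + 2 * ((1 + N) * (2 * 0)))) := by
    refine (ENNReal.Tendsto.const_mul hc (Or.inr (by simp))).add ?_
    refine ENNReal.Tendsto.const_mul (ENNReal.Tendsto.const_mul
      (ENNReal.Tendsto.const_mul h2 (Or.inr (by simp))) (Or.inr (by finiteness))) (Or.inr (by simp))
  simp only [mul_zero, add_zero] at h4
  exact ge_of_tendsto' h4 h1

lemma halfEnergy_cutoff_le {v : L2E} {u : ℕ → L2E} (hu : ∀ (n : ℕ) b, ∀ᵐ ξ : ℝ,
      spec b (u n) ξ = {ξ : ℝ | |ξ| ≤ n}.indicator 1 ξ * spec b v ξ) (n : ℕ) :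
    halfEnergy (u n) ≤ halfEnergy v := by
  rw [halfEnergy, energy_mul (hu n)]
  refine energy_mono (fun ξ => ?_) v
  rw [enorm_indicator_one_sq]
  exact mul_le_of_le_one_right' (Set.indicator_le_self' (fun _ _ => zero_le) ξ)

lemma mem_idAddDtn_domain {g : ℝ} {v : L2E} (hv : v ∈ sobolevOne) :
    ∃ f, (v, f) ∈ (idAddDtn g).graph := by
  rw [← dtn_domain] at hv
  obtain ⟨w, hw⟩ := LinearPMap.mem_domain_iff.1 hv
  rw [dtn_graph] at hw
  exact ⟨_, mem_idAddDtn_graph.2 ⟨w, hw, rfl⟩⟩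

section Root

variable {g : ℝ} {R : L2E →L[ℂ] L2E}

/-- If v = R(R f), then R f is the image of v under the root R⁻¹, and ‖R f‖² = ⟨f, v⟩ by symmetry of
R. -/
lemma enorm_sq_eq_form (hR0 : 0 ≤ R)
    (hA : ∀ v f, (v, f) ∈ (idAddDtn g).graph ↔ v = R (R f)) {v f : L2E}
    (h : (v, f) ∈ (idAddDtn g).graph) :
    ‖R f‖ₑ ^ 2 = ENNReal.ofReal (inner ℂ f v : ℂ).re := by
  rw [(hA _ _).1 h, ← inner_symm_of_nonneg hR0,
    show (inner ℂ (R f) (R f) : ℂ).re = ‖R f‖ ^ 2 from (norm_sq_eq_re_inner (𝕜 := ℂ) (R f)).symm,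
    ENNReal.ofReal_pow (norm_nonneg _), ofReal_norm]

/-- The range of `R` is the space of finite energy, with equivalent norms. -/
lemma exists_root_equiv (hg : 0 < g) (hR0 : 0 ≤ R) (hinj : ∀ u, R u = 0 → u = 0)
    (hA : ∀ v f, (v, f) ∈ (idAddDtn g).graph ↔ v = R (R f)) : ∃ C : ℝ≥0∞, C ≠ ⊤ ∧
      (∀ u, halfEnergy (R u) ≤ C * ‖u‖ₑ ^ 2) ∧
      ∀ v, halfEnergy v < ⊤ → ∃ u, v = R u ∧ ‖u‖ₑ ^ 2 ≤ C * halfEnergy v := by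
  obtain ⟨C, hC, hCA⟩ := exists_form_equiv hg
  refine ⟨2 * C, by finiteness, fun u => ?_, fun v hv => ?_⟩
  -- For vectors in the dense range of R the bound is `exists_form_equiv`; lower semicontinuity of
  -- the energy extends it with a factor 2.
  · obtain ⟨s, hs1, hs2⟩ := mem_closure_iff_seq_limit.1 (denseRange_of_injective hR0 hinj u)
    choose f hf using hs1
    rw [mul_assoc]
    refine halfEnergy_le_of_tendsto (u := fun n => R (s n)) (c := fun n => C * ‖s n‖ₑ ^ 2)
      ((R.continuous.tendsto _).comp hs2) ?_ fun n => ?_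
    · exact ENNReal.Tendsto.const_mul (((ENNReal.continuous_pow 2).tendsto _).comp
        ((continuous_enorm.tendsto _).comp hs2)) (Or.inr hC)
    · have h1 : (R (s n), f n) ∈ (idAddDtn g).graph := (hA _ _).2 (by rw [hf])
      have h2 := (hCA _ h1).2
      rw [← enorm_sq_eq_form hR0 hA h1, hf] at h2
      exact h2
  -- The cut-offs w n lie in W^{1,2}, so w n = R (R (f n)). They are Cauchy in energy, hence R (f n)
  -- is Cauchy in L², and its limit is the preimage of v.
  · obtain ⟨w, hw⟩ := exists_cutoff v
    choose f hf using fun n => mem_idAddDtn_domain (g := g) (cutoff_mem_sobolevOne hw n)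
    have hE := cutoff_energy_tendsto hw (m := fun ξ => 1 + ‖ξ‖ₑ) (by fun_prop) hv.ne
    have hE1 : Tendsto (fun n => 2 * C * halfEnergy (v - w n)) atTop (𝓝 (2 * C * 0)) :=
      ENNReal.Tendsto.const_mul hE (Or.inr (by finiteness))
    rw [mul_zero] at hE1
    have hdiff : ∀ n k, ‖R (f n) - R (f k)‖ₑ ^ 2
        ≤ 2 * C * halfEnergy (v - w n) + 2 * C * halfEnergy (v - w k) := by
      intro n k
      have h1 := (idAddDtn g).graph.sub_mem (hf n) (hf k)
      have h2 := (hCA _ h1).1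
      rw [Prod.mk_sub_mk] at h1 h2
      rw [← enorm_sq_eq_form hR0 hA h1, map_sub] at h2
      refine h2.trans ?_
      have h3 : w n - w k = (v - w k) - (v - w n) := by abel
      have h4 := energy_sub_le (m := fun ξ => 1 + ‖ξ‖ₑ) (by fun_prop) (v - w k) (v - w n)
      rw [← h3] at h4
      calc C * halfEnergy (w n - w k)
          ≤ C * (2 * halfEnergy (v - w k) + 2 * halfEnergy (v - w n)) := by
            gcongr
            exact h4
        _ = _ := by ring
    have hcau : CauchySeq fun n => R (f n) := by
      refine EMetric.cauchySeq_iff.2 fun ε hε => ?_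
      have hε2 : 0 < ε ^ 2 / 2 := ENNReal.half_pos (by positivity)
      obtain ⟨N, hN⟩ := eventually_atTop.1 (hE1.eventually (gt_mem_nhds hε2))
      refine ⟨N, fun n hn k hk => ?_⟩
      rw [edist_eq_enorm_sub]
      refine lt_of_not_ge fun hle => absurd (pow_le_pow_left₀ zero_le hle 2) (not_le.2 ?_)
      calc ‖R (f n) - R (f k)‖ₑ ^ 2 ≤ _ := hdiff n k
        _ < ε ^ 2 / 2 + ε ^ 2 / 2 := ENNReal.add_lt_add (hN n hn) (hN k hk)
        _ = ε ^ 2 := ENNReal.add_halves _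
    obtain ⟨u, hu⟩ := cauchySeq_tendsto_of_complete hcau
    refine ⟨u, ?_, ?_⟩
    · have h1 : Tendsto w atTop (𝓝 v) :=
        tendsto_of_energy_one (cutoff_energy_tendsto hw measurable_const (by
          rw [energy_one]
          finiteness))
      refine tendsto_nhds_unique h1 ?_
      have e : w = fun n => R (R (f n)) := funext fun n => (hA _ _).1 (hf n)
      rw [e]
      exact (R.continuous.tendsto _).comp hu
    · refine le_of_tendsto' (((ENNReal.continuous_pow 2).tendsto _).comp
        ((continuous_enorm.tendsto _).comp hu)) fun n => ?_
      have h2 := (hCA _ (hf n)).1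
      rw [← enorm_sq_eq_form hR0 hA (hf n)] at h2
      refine h2.trans ?_
      rw [two_mul, add_mul]
      refine le_trans ?_ le_self_add
      gcongr
      exact halfEnergy_cutoff_le hw n

end Root

/-! ### Real interpolation -/

/-- The weight `(1 + (2 π ξ)²)^{1/2}` of the `W^{1,2}` norm. -/
noncomputable def bracket (ξ : ℝ) : ℝ := √(1 + (2 * Real.pi * ξ) ^ 2)

lemma one_le_bracket (ξ : ℝ) : 1 ≤ bracket ξ :=
  Real.one_le_sqrt.2 (by nlinarith [sq_nonneg (2 * Real.pi * ξ)])

lemma measurable_bracket : Measurable bracket := by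
  unfold bracket
  fun_prop

lemma ofReal_bracket_sq (ξ : ℝ) :
    ENNReal.ofReal (bracket ξ) ^ 2 = 1 + ‖2 * Real.pi * ξ‖ₑ ^ 2 := by
  rw [← ENNReal.ofReal_pow (zero_le_one.trans (one_le_bracket ξ)), bracket,
    Real.sq_sqrt (by positivity), ENNReal.ofReal_add (by norm_num) (by positivity),
    ENNReal.ofReal_one, ← sq_abs, ENNReal.ofReal_pow (abs_nonneg _), ← Real.norm_eq_abs, ofReal_norm]

lemma IsWeakDeriv.energy_bracket {v d : L2E} (h : IsWeakDeriv v d) :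
    energy (fun ξ => ENNReal.ofReal (bracket ξ) ^ 2) v = 2 * (‖v‖ₑ ^ 2 + ‖d‖ₑ ^ 2) := by
  simp only [ofReal_bracket_sq]
  rw [energy_add measurable_const, energy_one, h.energy_eq, mul_add]

/-- The spectral weight of the `K`-functional. -/
noncomputable def kWeight (t ξ : ℝ) : ℝ≥0∞ :=
  min 1 (ENNReal.ofReal t ^ 2 * ENNReal.ofReal (bracket ξ) ^ 2)

lemma measurable_kWeight : Measurable (Function.uncurry kWeight) := by
  have := measurable_bracket
  unfold Function.uncurry kWeight
  fun_prop

lemma add_sq_le_two_mul (a b : ℝ≥0∞) : (a + b) ^ 2 ≤ 2 * a ^ 2 + 2 * b ^ 2 := by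
  have := ENNReal.rpow_add_le_mul_rpow_add_rpow a b (p := 2) (by norm_num)
  norm_num at this
  rw [← mul_add]
  exact this

lemma rpow_half_sq (a : ℝ≥0∞) : (a ^ (1 / 2 : ℝ)) ^ 2 = a := by
  rw [← ENNReal.rpow_natCast, ← ENNReal.rpow_mul]
  norm_num

/-- For any splitting, the weight is at most 1 on v - b and at most t²w² on b. The constant 4 is 2
from `energy_sub_le` times 2 from even extension. -/
lemma energy_kWeight_le {t : ℝ} (v : L2E) :
    energy (kWeight t) v ≤ 4 * kFunctional t v ^ 2 := by
  have hm : Measurable (kWeight t) := measurable_kWeight.of_uncurry_left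
  have hb := measurable_bracket
  have key : ∀ b d : L2E, IsWeakDeriv b d → (energy (kWeight t) v / 4) ^ (1 / 2 : ℝ) ≤
      ‖v - b‖ₑ + ENNReal.ofReal t * (‖b‖ₑ ^ 2 + ‖d‖ₑ ^ 2) ^ (1 / 2 : ℝ) := by
    intro b d h
    have e : v = b - (b - v) := by abel
    have h1 : energy (kWeight t) (b - v) ≤ 2 * ‖v - b‖ₑ ^ 2 := by
      rw [← enorm_neg (v - b), neg_sub, ← energy_one]
      exact energy_mono (fun ξ => min_le_left _ _) _
    have h2 : energy (kWeight t) b ≤ ENNReal.ofReal t ^ 2 * (2 * (‖b‖ₑ ^ 2 + ‖d‖ₑ ^ 2)) := by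
      rw [← h.energy_bracket, ← energy_const_mul (by fun_prop)]
      exact energy_mono (fun ξ => min_le_right _ _) _
    have h3 : energy (kWeight t) v ≤ 4 *
        (‖v - b‖ₑ + ENNReal.ofReal t * (‖b‖ₑ ^ 2 + ‖d‖ₑ ^ 2) ^ (1 / 2 : ℝ)) ^ 2 := by
      calc energy (kWeight t) v = energy (kWeight t) (b - (b - v)) := by rw [← e]
        _ ≤ 2 * energy (kWeight t) b + 2 * energy (kWeight t) (b - v) := energy_sub_le hm _ _
        _ ≤ 2 * (ENNReal.ofReal t ^ 2 * (2 * (‖b‖ₑ ^ 2 + ‖d‖ₑ ^ 2)))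
            + 2 * (2 * ‖v - b‖ₑ ^ 2) := by gcongr
        _ = 4 * (‖v - b‖ₑ ^ 2
            + (ENNReal.ofReal t * (‖b‖ₑ ^ 2 + ‖d‖ₑ ^ 2) ^ (1 / 2 : ℝ)) ^ 2) := by
          rw [mul_pow, rpow_half_sq]
          ring
        _ ≤ _ := by
          gcongr
          rw [add_sq, add_right_comm]
          exact le_self_add
    calc (energy (kWeight t) v / 4) ^ (1 / 2 : ℝ)
        ≤ ((‖v - b‖ₑ + ENNReal.ofReal t * (‖b‖ₑ ^ 2 + ‖d‖ₑ ^ 2) ^ (1 / 2 : ℝ)) ^ 2)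
          ^ (1 / 2 : ℝ) := by
          gcongr
          exact ENNReal.div_le_of_le_mul' h3
      _ = _ := by
          rw [← ENNReal.rpow_natCast, ← ENNReal.rpow_mul]
          norm_num
  have h1 : (energy (kWeight t) v / 4) ^ (1 / 2 : ℝ) ≤ kFunctional t v :=
    le_iInf fun b => le_iInf fun d => le_iInf fun h => key b d h
  calc energy (kWeight t) v = 4 * ((energy (kWeight t) v / 4) ^ (1 / 2 : ℝ)) ^ 2 := by
        rw [rpow_half_sq, ENNReal.mul_div_cancel (by simp) (by simp)]
    _ ≤ _ := by gcongr

/-- The competitor b keeps the frequencies with tw ≤ 1, where the minimum in the weight is t²w². The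
factor 2 lost in squaring a sum is exactly the doubling in the energy, so the constant is 1. -/
lemma kFunctional_sq_le {t : ℝ} (ht : 0 < t) (v : L2E) :
    kFunctional t v ^ 2 ≤ energy (kWeight t) v := by
  have hb := measurable_bracket
  set τ := ENNReal.ofReal t with hτ
  have hτ0 : τ ≠ 0 := (ENNReal.ofReal_pos.2 ht).ne'
  have hτt : τ ≠ ⊤ := ENNReal.ofReal_ne_top
  set S : Set ℝ := {ξ | τ ^ 2 * ENNReal.ofReal (bracket ξ) ^ 2 ≤ 1} with hS
  have hSm : MeasurableSet S := measurableSet_le (by fun_prop) measurable_const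
  have hSe : ∀ ξ, -ξ ∈ S ↔ ξ ∈ S := fun ξ => by
    simp only [hS, Set.mem_ofPred_eq, bracket, mul_neg, neg_sq]
  obtain ⟨b, hbS⟩ := exists_spec_indicator hSm hSe v
  have h1 : τ ^ 2 * energy (fun ξ => ENNReal.ofReal (bracket ξ) ^ 2) b
      = energy (fun ξ => τ ^ 2 * ENNReal.ofReal (bracket ξ) ^ 2 * S.indicator 1 ξ) v := by
    rw [← energy_const_mul (by fun_prop), energy_mul hbS]
    simp only [enorm_indicator_one_sq]
  have h2 : 2 * ‖v - b‖ₑ ^ 2 = energy (fun ξ => Sᶜ.indicator 1 ξ) v := by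
    rw [← energy_one, energy_mul (spec_sub_indicator hbS)]
    simp only [enorm_indicator_one_sq, one_mul]
  have h3 : energy (fun ξ => Sᶜ.indicator 1 ξ) v
      + energy (fun ξ => τ ^ 2 * ENNReal.ofReal (bracket ξ) ^ 2 * S.indicator 1 ξ) v
      = energy (kWeight t) v := by
    rw [← energy_add (measurable_one.indicator hSm.compl)]
    congr 1
    funext ξ
    by_cases h : ξ ∈ S
    · rw [Set.indicator_of_notMem (by simpa using h), Set.indicator_of_mem h, kWeight,
        min_eq_right h, zero_add, Pi.one_apply, mul_one]
    · rw [Set.indicator_of_mem (by simpa using h), Set.indicator_of_notMem h, kWeight,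
        min_eq_left (not_le.1 h).le, mul_zero, add_zero, Pi.one_apply]
  have h4 : energy (kWeight t) v ≠ ⊤ := by
    refine ne_top_of_le_ne_top (b := energy (fun _ => 1) v) ?_
      (energy_mono (fun ξ => min_le_left _ _) _)
    rw [energy_one]
    finiteness
  obtain ⟨d, hd⟩ : b ∈ sobolevOne := by
    rw [mem_sobolevOne_iff]
    refine ne_top_of_le_ne_top (b := energy (fun ξ => ENNReal.ofReal (bracket ξ) ^ 2) b) ?_
      (energy_mono (fun ξ => ?_) _)
    -- Infinite W^{1,2} energy of b would make the energy of v for `kWeight t` infinite, whereas it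
    -- is at most 2‖v‖².
    · intro htop
      rw [htop, ENNReal.mul_top (pow_ne_zero 2 hτ0)] at h1
      rw [← h1, add_top] at h3
      exact h4 h3.symm
    · rw [ofReal_bracket_sq]
      exact le_add_self
  calc kFunctional t v ^ 2
      ≤ (‖v - b‖ₑ + τ * (‖b‖ₑ ^ 2 + ‖d‖ₑ ^ 2) ^ (1 / 2 : ℝ)) ^ 2 := by
        gcongr
        exact iInf_le_of_le b (iInf_le_of_le d (iInf_le_of_le hd le_rfl))
    _ ≤ 2 * ‖v - b‖ₑ ^ 2 + 2 * (τ * (‖b‖ₑ ^ 2 + ‖d‖ₑ ^ 2) ^ (1 / 2 : ℝ)) ^ 2 :=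
        add_sq_le_two_mul _ _
    _ = energy (kWeight t) v := by
        rw [← h3, ← h2, ← h1, hd.energy_bracket, mul_pow, rpow_half_sq]
        ring

/-- The minimum switches at t = 1/w: below, the integrand is the constant w²; above, it is t⁻². Each
part contributes w. -/
lemma lintegral_kWeight (ξ : ℝ) :
    ∫⁻ t in Set.Ioi (0 : ℝ), (ENNReal.ofReal t ^ 2)⁻¹ * kWeight t ξ
      = 2 * ENNReal.ofReal (bracket ξ) := by
  set w := bracket ξ with hw
  have hw0 : 0 < w := zero_lt_one.trans_le (one_le_bracket ξ)
  have hi : 0 < w⁻¹ := inv_pos.2 hw0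
  rw [← Set.Ioc_union_Ioi_eq_Ioi hi.le, lintegral_union measurableSet_Ioi
    (Set.disjoint_left.2 fun x hx hx' => not_lt.2 hx.2 hx'), two_mul]
  congr 1
  · calc ∫⁻ t in Set.Ioc 0 w⁻¹, (ENNReal.ofReal t ^ 2)⁻¹ * kWeight t ξ
        = ∫⁻ _ in Set.Ioc 0 w⁻¹, ENNReal.ofReal w ^ 2 := by
          refine setLIntegral_congr_fun measurableSet_Ioc fun t ht => ?_
          have ht0 : 0 < t := ht.1
          have h1 : ENNReal.ofReal t * ENNReal.ofReal w ≤ 1 := by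
            rw [← ENNReal.ofReal_mul ht0.le, ENNReal.ofReal_le_one]
            have := mul_le_mul_of_nonneg_right ht.2 hw0.le
            rwa [inv_mul_cancel₀ hw0.ne'] at this
          rw [kWeight, min_eq_right (by rw [← mul_pow]; exact pow_le_one₀ zero_le h1), ← mul_assoc,
            ENNReal.inv_mul_cancel (pow_ne_zero 2 (ENNReal.ofReal_pos.2 ht0).ne') (by finiteness),
            one_mul]
      _ = ENNReal.ofReal w := by
          rw [lintegral_const, Measure.restrict_apply MeasurableSet.univ, Set.univ_inter,
            Real.volume_Ioc, sub_zero, pow_two, mul_assoc, ← ENNReal.ofReal_mul hw0.le,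
            mul_inv_cancel₀ hw0.ne', ENNReal.ofReal_one, mul_one]
  · calc ∫⁻ t in Set.Ioi w⁻¹, (ENNReal.ofReal t ^ 2)⁻¹ * kWeight t ξ
        = ∫⁻ t in Set.Ioi w⁻¹, ENNReal.ofReal (t ^ (-2 : ℝ)) := by
          refine setLIntegral_congr_fun measurableSet_Ioi fun t ht => ?_
          have ht0 : 0 < t := hi.trans ht
          have h1 : 1 ≤ ENNReal.ofReal t * ENNReal.ofReal w := by
            rw [← ENNReal.ofReal_mul ht0.le, ENNReal.one_le_ofReal]
            have := mul_le_mul_of_nonneg_right (le_of_lt ht) hw0.le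
            rwa [inv_mul_cancel₀ hw0.ne'] at this
          rw [kWeight, min_eq_left (by rw [← mul_pow]; exact one_le_pow₀ h1), mul_one,
            Real.rpow_neg ht0.le, ENNReal.ofReal_inv_of_pos (by positivity), Real.rpow_two,
            ENNReal.ofReal_pow ht0.le]
      _ = ENNReal.ofReal w := by
          rw [← ofReal_integral_eq_lintegral_ofReal (integrableOn_Ioi_rpow_of_lt (by norm_num) hi),
            integral_Ioi_rpow_of_lt (by norm_num) hi]
          · congr 1
            norm_num
            rw [Real.rpow_neg_one, inv_inv]
          · filter_upwards [ae_restrict_mem measurableSet_Ioi] with t ht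
            have ht0 : 0 < t := hi.trans ht
            positivity

lemma lintegral_energy (v : L2E) :
    ∫⁻ t in Set.Ioi (0 : ℝ), (ENNReal.ofReal t ^ 2)⁻¹ * energy (kWeight t) v
      = energy (fun ξ => 2 * ENNReal.ofReal (bracket ξ)) v := by
  have hk := measurable_kWeight
  have hm : Measurable fun p : ℝ × ℝ => kWeight p.1 p.2 := hk
  have hb : ∀ b, ∫⁻ t in Set.Ioi (0 : ℝ), (ENNReal.ofReal t ^ 2)⁻¹ *
      ∫⁻ ξ, kWeight t ξ * ‖spec b v ξ‖ₑ ^ 2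
      = ∫⁻ ξ, 2 * ENNReal.ofReal (bracket ξ) * ‖spec b v ξ‖ₑ ^ 2 := fun b => by
    have h1 := measurable_spec b v
    have hkt : ∀ t, Measurable (kWeight t) := fun t => hk.of_uncurry_left
    have hkξ : ∀ ξ, Measurable fun t => kWeight t ξ := fun ξ => hk.of_uncurry_right
    calc ∫⁻ t in Set.Ioi (0 : ℝ), (ENNReal.ofReal t ^ 2)⁻¹ *
          ∫⁻ ξ, kWeight t ξ * ‖spec b v ξ‖ₑ ^ 2
        = ∫⁻ t in Set.Ioi (0 : ℝ), ∫⁻ ξ, (ENNReal.ofReal t ^ 2)⁻¹ *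
          (kWeight t ξ * ‖spec b v ξ‖ₑ ^ 2) := by
          refine lintegral_congr fun t => ?_
          have := hkt t
          rw [lintegral_const_mul _ (by fun_prop)]
      _ = ∫⁻ ξ, ∫⁻ t in Set.Ioi (0 : ℝ), (ENNReal.ofReal t ^ 2)⁻¹ *
          (kWeight t ξ * ‖spec b v ξ‖ₑ ^ 2) := by
          refine lintegral_lintegral_swap (Measurable.aemeasurable ?_)
          unfold Function.uncurry
          fun_prop
      _ = _ := by
          refine lintegral_congr fun ξ => ?_
          have := hkξ ξ
          rw [← lintegral_kWeight, ← lintegral_mul_const _ (by fun_prop)]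
          simp only [mul_assoc]
  have hmeas : Measurable fun t : ℝ => (ENNReal.ofReal t ^ 2)⁻¹ *
      ∫⁻ ξ, kWeight t ξ * ‖spec true v ξ‖ₑ ^ 2 := by
    have h1 := measurable_spec true v
    refine Measurable.mul (by fun_prop) ?_
    refine Measurable.lintegral_prod_right ?_
    fun_prop
  simp only [energy, mul_add]
  rw [lintegral_add_left hmeas, hb, hb]

lemma interpNorm_sq (v : L2E) : interpNorm v ^ 2
    = ∫⁻ t in Set.Ioi (0 : ℝ), (ENNReal.ofReal t ^ 2)⁻¹ * kFunctional t v ^ 2 := by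
  rw [interpNorm, rpow_half_sq]
  refine setLIntegral_congr_fun measurableSet_Ioi fun t ht => ?_
  have ht0 : 0 < t := ht
  rw [mul_pow, ← ENNReal.ofReal_pow (by positivity), ← Real.rpow_natCast (t ^ _),
    ← Real.rpow_mul ht0.le]
  norm_num
  rw [Real.rpow_neg_one, ENNReal.ofReal_inv_of_pos ht0, div_eq_mul_inv, mul_right_comm, pow_two (ENNReal.ofReal t),
    ENNReal.mul_inv (Or.inr ENNReal.ofReal_ne_top) (Or.inl ENNReal.ofReal_ne_top)]

/-- After Tonelli the interpolation norm has spectral weight 2w. The constant 16 comes from w ≤ 8(1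
+ |ξ|), as (2π)² ≤ 64; the other direction only needs the 4 of `energy_kWeight_le`. -/
lemma exists_interpNorm_equiv (v : L2E) :
    interpNorm v ^ 2 ≤ 16 * halfEnergy v ∧ halfEnergy v ≤ 16 * interpNorm v ^ 2 := by
  have hb := measurable_bracket
  have h1 : ∀ ξ, 2 * ENNReal.ofReal (bracket ξ) ≤ 16 * (1 + ‖ξ‖ₑ) := fun ξ => by
    rw [← ofReal_norm, ← ENNReal.ofReal_one, ← ENNReal.ofReal_add zero_le_one (norm_nonneg _),
      ← ENNReal.ofReal_ofNat 2, ← ENNReal.ofReal_ofNat 16, ← ENNReal.ofReal_mul (by norm_num),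
      ← ENNReal.ofReal_mul (by norm_num)]
    refine ENNReal.ofReal_le_ofReal ?_
    have : bracket ξ ≤ 8 * (1 + ‖ξ‖) := by
      refine Real.sqrt_le_iff.2 ⟨by positivity, ?_⟩
      have h4 : (2 * Real.pi * ξ) ^ 2 = (2 * Real.pi) ^ 2 * ‖ξ‖ ^ 2 := by
        rw [mul_pow, Real.norm_eq_abs, sq_abs]
      have h5 : (2 * Real.pi) ^ 2 ≤ 64 := by nlinarith [Real.pi_lt_four, Real.pi_pos]
      rw [h4]
      nlinarith [norm_nonneg ξ, mul_le_mul_of_nonneg_right h5 (sq_nonneg ‖ξ‖)]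
    linarith
  have h2 : ∀ ξ, 1 + ‖ξ‖ₑ ≤ 2 * ENNReal.ofReal (bracket ξ) := fun ξ => by
    rw [← ofReal_norm, ← ENNReal.ofReal_one, ← ENNReal.ofReal_add zero_le_one (norm_nonneg _),
      ← ENNReal.ofReal_ofNat 2, ← ENNReal.ofReal_mul (by norm_num)]
    refine ENNReal.ofReal_le_ofReal ?_
    have h3 : ‖ξ‖ ≤ bracket ξ := by
      refine Real.le_sqrt_of_sq_le ?_
      rw [Real.norm_eq_abs, sq_abs]
      nlinarith [Real.pi_gt_three, sq_nonneg ξ, mul_nonneg (sq_nonneg ξ)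
        (by nlinarith [Real.pi_gt_three] : 0 ≤ (2 * Real.pi) ^ 2 - 1)]
    linarith [one_le_bracket ξ]
  rw [interpNorm_sq]
  constructor
  · calc ∫⁻ t in Set.Ioi (0 : ℝ), (ENNReal.ofReal t ^ 2)⁻¹ * kFunctional t v ^ 2
        ≤ ∫⁻ t in Set.Ioi (0 : ℝ), (ENNReal.ofReal t ^ 2)⁻¹ * energy (kWeight t) v := by
          refine setLIntegral_mono_ae' measurableSet_Ioi (Eventually.of_forall fun t ht => ?_)
          gcongr
          exact kFunctional_sq_le ht v
      _ ≤ _ := by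
          rw [lintegral_energy, halfEnergy, ← energy_const_mul (by fun_prop)]
          exact energy_mono h1 v
  · calc halfEnergy v ≤ energy (fun ξ => 2 * ENNReal.ofReal (bracket ξ)) v := energy_mono h2 v
      _ = ∫⁻ t in Set.Ioi (0 : ℝ), (ENNReal.ofReal t ^ 2)⁻¹ * energy (kWeight t) v :=
          (lintegral_energy v).symm
      _ ≤ ∫⁻ t in Set.Ioi (0 : ℝ), 4 * ((ENNReal.ofReal t ^ 2)⁻¹ * kFunctional t v ^ 2) := by
          refine lintegral_mono fun t => ?_
          rw [mul_left_comm]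
          gcongr
          exact energy_kWeight_le v
      _ = 4 * ∫⁻ t in Set.Ioi (0 : ℝ), (ENNReal.ofReal t ^ 2)⁻¹ * kFunctional t v ^ 2 :=
          lintegral_const_mul' _ _ (by simp)
      _ ≤ _ := by
          gcongr
          norm_num

lemma le_of_sq_le_mul_sq {a b C : ℝ≥0∞} (h : a ^ 2 ≤ C * b ^ 2) : a ≤ C ^ (1 / 2 : ℝ) * b := by
  refine le_of_not_gt fun hlt => absurd h (not_le.2 ?_)
  calc C * b ^ 2 = (C ^ (1 / 2 : ℝ) * b) ^ 2 := by rw [mul_pow, rpow_half_sq]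
    _ < a ^ 2 := ENNReal.pow_lt_pow_left two_ne_zero hlt

lemma exists_norm_equiv {C : ℝ≥0∞} (hC : C ≠ ⊤) : ∃ c : ℝ≥0, ∀ a b : ℝ≥0∞,
    a ^ 2 ≤ C * b ^ 2 → a ≤ c * b := by
  refine ⟨(C ^ (1 / 2 : ℝ)).toNNReal, fun a b h => ?_⟩
  rw [ENNReal.coe_toNNReal (by finiteness)]
  exact le_of_sq_le_mul_sq h

lemma interpNorm_lt_top_iff {v : L2E} : interpNorm v < ⊤ ↔ halfEnergy v < ⊤ := by
  obtain ⟨h1, h2⟩ := exists_interpNorm_equiv v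
  constructor
  · intro hv
    exact h2.trans_lt (by finiteness)
  · intro hv
    have : interpNorm v ^ 2 < ⊤ := h1.trans_lt (by finiteness)
    exact (ENNReal.pow_lt_top_iff.1 this).resolve_right two_ne_zero

end HalfSobolev

theorem mainTheorem6 (g : ℝ) (hg : 0 < g) :
    -- the Dirichlet-to-Neumann map is a well-defined operator with domain `W^{1,2}`
    (HalfSobolev.dtn.graph = HalfSobolev.dtnGraph ∧
      (HalfSobolev.dtn.domain : Set HalfSobolev.L2E) = HalfSobolev.sobolevOne) ∧
    -- the operator `I + g Λ` has exactly one nonnegative self-adjoint square root `S`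
    (∃! S : HalfSobolev.L2E →ₗ.[ℂ] HalfSobolev.L2E,
      HalfSobolev.IsPosSqrt S (HalfSobolev.idAddDtn g)) ∧
    -- the form domain is `W^{1/2,2}`, with equivalent norms
    (∀ S : HalfSobolev.L2E →ₗ.[ℂ] HalfSobolev.L2E,
      HalfSobolev.IsPosSqrt S (HalfSobolev.idAddDtn g) →
        HalfSobolev.formCompletion S (HalfSobolev.idAddDtn g) = HalfSobolev.sobolevHalf ∧
        (S.domain : Set HalfSobolev.L2E) = HalfSobolev.sobolevHalf ∧
        ∃ C : ℝ≥0, ∀ v : S.domain,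
          ‖S v‖ₑ ≤ C * HalfSobolev.halfNorm v ∧ HalfSobolev.halfNorm v ≤ C * ‖S v‖ₑ) ∧
    -- both coincide with the real interpolation space, with equivalent norms
    HalfSobolev.interpSpace = HalfSobolev.sobolevHalf ∧
    (∃ C : ℝ≥0, ∀ v : HalfSobolev.L2E,
      HalfSobolev.interpNorm v ≤ C * HalfSobolev.halfNorm v ∧
        HalfSobolev.halfNorm v ≤ C * HalfSobolev.interpNorm v) := by
  obtain ⟨R, hR0, hRinj, hA, hS⟩ := HalfSobolev.exists_sqrt (A := HalfSobolev.idAddDtn g)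
    (fun p hp q hq => HalfSobolev.idAddDtn_symm hp hq)
    (fun p hp => HalfSobolev.norm_sq_le_idAddDtn hg hp) (HalfSobolev.idAddDtn_surjective hg)
  obtain ⟨C₁, hC₁, h₁⟩ := HalfSobolev.exists_halfNorm_equiv
  obtain ⟨C₂, hC₂, h₂, h₃⟩ := HalfSobolev.exists_root_equiv hg hR0 hRinj hA
  refine ⟨⟨HalfSobolev.dtn_graph, HalfSobolev.dtn_domain⟩, ?_, fun S hSA => ?_, ?_, ?_⟩
  · obtain ⟨S, -, hSR⟩ := HalfSobolev.exists_selfAdjoint_inverse hR0 hRinj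
    refine ⟨S, (hS S).2 hSR, fun S' hS' => LinearPMap.eq_of_eq_graph ?_⟩
    ext ⟨v, u⟩
    rw [(hS S').1 hS', hSR]
  · have hSR := (hS S).1 hSA
    -- S is the inverse of R, so its domain is the range of R, which is the space of finite
    -- `halfEnergy`.
    have hdom : (S.domain : Set HalfSobolev.L2E) = HalfSobolev.sobolevHalf := by
      ext v
      refine LinearPMap.mem_domain_iff.trans (Iff.trans ?_ HalfSobolev.halfNorm_lt_top_iff.symm)
      constructor
      · rintro ⟨u, hu⟩
        rw [(hSR _ _).1 hu]
        exact (h₂ u).trans_lt (by finiteness)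
      · intro hv
        obtain ⟨u, hu, -⟩ := h₃ v hv
        exact ⟨u, (hSR _ _).2 hu⟩
    refine ⟨(HalfSobolev.formCompletion_eq_domain hR0 hRinj hA hSR).trans hdom, hdom, ?_⟩
    obtain ⟨c, hc⟩ := HalfSobolev.exists_norm_equiv (C := C₁ * C₂) (by finiteness)
    refine ⟨c, fun v => ?_⟩
    have hv : (v : HalfSobolev.L2E) = R (S v) := (hSR _ _).1 (S.mem_graph v)
    constructor
    · refine hc _ _ ?_
      have hE : HalfSobolev.halfEnergy v < ⊤ := by
        rw [hv]
        exact (h₂ _).trans_lt (by finiteness)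
      obtain ⟨u, hu, hle⟩ := h₃ v hE
      have huS : u = S v := by
        refine sub_eq_zero.1 (hRinj _ ?_)
        rw [map_sub, ← hu, ← hv, sub_self]
      rw [← huS]
      calc ‖u‖ₑ ^ 2 ≤ C₂ * HalfSobolev.halfEnergy v := hle
        _ ≤ C₂ * (C₁ * HalfSobolev.halfNorm v ^ 2) := by
          gcongr
          exact (h₁ v).2
        _ = _ := by ring
    · refine hc _ _ ?_
      have h4 := h₂ (S v)
      rw [← hv] at h4
      calc HalfSobolev.halfNorm v ^ 2 ≤ C₁ * HalfSobolev.halfEnergy v := (h₁ v).1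
        _ ≤ C₁ * (C₂ * ‖S v‖ₑ ^ 2) := by gcongr
        _ = _ := by ring
  · ext v
    exact HalfSobolev.interpNorm_lt_top_iff.trans HalfSobolev.halfNorm_lt_top_iff.symm
  · obtain ⟨c, hc⟩ := HalfSobolev.exists_norm_equiv (C := C₁ * 16) (by finiteness)
    refine ⟨c, fun v => ?_⟩
    obtain ⟨h5, h6⟩ := HalfSobolev.exists_interpNorm_equiv v
    constructor
    · refine hc _ _ (h5.trans ?_)
      calc 16 * HalfSobolev.halfEnergy v ≤ 16 * (C₁ * HalfSobolev.halfNorm v ^ 2) := by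
            gcongr
            exact (h₁ v).2
        _ = _ := by ring
    · refine hc _ _ ((h₁ v).1.trans ?_)
      calc C₁ * HalfSobolev.halfEnergy v ≤ C₁ * (16 * HalfSobolev.interpNorm v ^ 2) := by gcongr
        _ = _ := by ring
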